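/- Let $\Omega\subset\mathbb R^3$ be a bounded open set with smooth ($C^\infty$) boundary, $\Omega$ lying locally on one side of $\partial\Omega$. Let $0<t_0<\infty$, $u_0\in H^1_0(\Omega)$, $u_1\in L^2(\Omega)$ (real-valued), and let $u$ be a solution of $$\partial_t^2u-\Delta u+u^5=0\ \text{ in }(0,t_0)\times\Omega,\qquad u|_{t=0}=u_0,\quad \partial_tu|_{t=0}=u_1,\quad u|_{(0,t_0)\times\partial\Omega}=0$$ with $(u,\partial_tu)$ in the space $$X_{<t_0}=\bigl(C^0([0,t_0);H^1_0(\Omega))\cap L^5_{\mathrm{loc}}([0,t_0);L^{10}(\Omega))\bigr)\times C^0([0,t_0);L^2(\Omega)),$$ where the equation holds in the sense of distributions on $(0,t_0)\times\Omega$, the boundary condition means $u(t)\in H^1_0(\Omega)$, and $L^5_{\mathrm{loc}}([0,t_0);L^{10}(\Omega))$ means $\int_0^T\|u(t)\|_{L^{10}(\Omega)}^5\,dt<\infty$ for every $0\le T<t_0$. Then for every $x_0\in\overline\Omega$ (boundary points included), $u(t)^6$ is integrable on $\Omega\cap\{|x-x_0|<t_0-t\}$ for every $t\in[0,t_0)$,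 and $$\lim_{t\to t_0^-}\int_{\Omega\cap\{|x-x_0|<t_0-t\}}u^6(t,x)\,dx=0.$$ -/

import Mathlib

open Set Filter Topology MeasureTheory
open scoped ContDiff

noncomputable section

namespace NLW

/-- Three-dimensional Euclidean space. -/
abbrev E3 : Type := EuclideanSpace ℝ (Fin 3)

/-- `Ω` is a bounded open set whose boundary is smooth, with `Ω` lying locally on one side of it:
near each boundary point, `Ω` is the negativity set of a smooth function with nonzero differential
at that point. -/
structure IsSmoothBoundedDomain (Ω : Set E3) : Prop where
  isOpen : IsOpen Ω
  isBounded : Bornology.IsBounded Ω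
  smooth_boundary : ∀ x ∈ frontier Ω, ∃ (U : Set E3) (ρ : E3 → ℝ), IsOpen U ∧ x ∈ U ∧
    ContDiffOn ℝ ∞ ρ U ∧ fderiv ℝ ρ x ≠ 0 ∧ ∀ y ∈ U, (y ∈ Ω ↔ ρ y < 0)

/-- The real space `L²(Ω)`. -/
abbrev L2 (Ω : Set E3) : Type := Lp ℝ 2 (volume.restrict Ω)

/-- The space `L²(Ω; ℝ³)` of square integrable vector fields. -/
abbrev L2Vec (Ω : Set E3) : Type := Lp E3 2 (volume.restrict Ω)

/-- The pairs `(φ, ∇φ)` with `φ ∈ C_c^∞(Ω)`, as a subspace of the Hilbert space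
`L²(Ω) × L²(Ω; ℝ³)`. -/
def testGraph (Ω : Set E3) : Submodule ℝ (WithLp 2 (L2 Ω × L2Vec Ω)) where
  carrier := {p | ∃ φ : E3 → ℝ, ContDiff ℝ ∞ φ ∧ HasCompactSupport φ ∧ tsupport φ ⊆ Ω ∧
    p.fst =ᵐ[volume.restrict Ω] φ ∧ p.snd =ᵐ[volume.restrict Ω] gradient φ}
  zero_mem' := by
    refine ⟨fun _ => 0, contDiff_const, HasCompactSupport.zero, ?_, ?_, ?_⟩
    · simp [tsupport, Function.support]
    · exact Lp.coeFn_zero ℝ 2 (volume.restrict Ω)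
    · have h : gradient (fun _ : E3 => (0 : ℝ)) = 0 := by
        ext1 x
        simp [gradient]
      rw [h]
      simpa using Lp.coeFn_zero E3 2 (volume.restrict Ω)
  add_mem' := by
    rintro p q ⟨φ, hφ, hφc, hφs, hp1, hp2⟩ ⟨ψ, hψ, hψc, hψs, hq1, hq2⟩
    refine ⟨φ + ψ, hφ.add hψ, hφc.add hψc, (tsupport_add φ ψ).trans (union_subset hφs hψs),
      ?_, ?_⟩
    · exact (Lp.coeFn_add p.fst q.fst).trans (hp1.add hq1)
    · have h : gradient (φ + ψ) = gradient φ + gradient ψ := by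
        ext1 x
        have h1 : DifferentiableAt ℝ φ x := (hφ.differentiable (by simp)).differentiableAt
        have h2 : DifferentiableAt ℝ ψ x := (hψ.differentiable (by simp)).differentiableAt
        simp [gradient, fderiv_add h1 h2]
      rw [h]
      exact (Lp.coeFn_add p.snd q.snd).trans (hp2.add hq2)
  smul_mem' := by
    rintro c p ⟨φ, hφ, hφc, hφs, hp1, hp2⟩
    refine ⟨c • φ, contDiff_const.smul hφ, hφc.smul_left, ?_, ?_, ?_⟩
    · exact (closure_mono (Function.support_const_smul_subset c φ)).trans hφs
    · exact (Lp.coeFn_smul c p.fst).trans (hp1.const_smul c)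
    · have h : gradient (c • φ) = c • gradient φ := by
        ext1 x
        have h1 : DifferentiableAt ℝ φ x := (hφ.differentiable (by simp)).differentiableAt
        simp [gradient, fderiv_const_smul h1]
      rw [h]
      exact (Lp.coeFn_smul c p.snd).trans (hp2.const_smul c)

/-- The Sobolev space `H¹₀(Ω)`: the closure of `C_c^∞(Ω)` for the `H¹` norm
`(‖f‖² + ‖∇f‖²)^{1/2}`. An element is a function in `L²(Ω)` paired with its weak gradient. -/
def H10 (Ω : Set E3) : Submodule ℝ (WithLp 2 (L2 Ω × L2Vec Ω)) :=
  (testGraph Ω).topologicalClosure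

/-- The function in `L²(Ω)` underlying an element of `H¹₀(Ω)`. -/
def toL2 {Ω : Set E3} (f : H10 Ω) : L2 Ω := (f : WithLp 2 (L2 Ω × L2Vec Ω)).fst

/-- `(u, ∂ₜu)` belongs to
`X_{<t₀} = C⁰([0,t₀); H¹₀(Ω)) ∩ L⁵_loc([0,t₀); L¹⁰(Ω)) × C⁰([0,t₀); L²(Ω))`.
The values of `u` and `ut` outside `[0,t₀)` are irrelevant. -/
structure MemX (Ω : Set E3) (t₀ : ℝ) (u : ℝ → H10 Ω) (ut : ℝ → L2 Ω) : Prop where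
  continuousOn : ContinuousOn u (Ico 0 t₀)
  hasDerivWithinAt : ∀ t ∈ Ico 0 t₀,
    HasDerivWithinAt (fun s => toL2 (u s)) (ut t) (Ico 0 t₀) t
  continuousOn_deriv : ContinuousOn ut (Ico 0 t₀)
  lintegral_lt_top : ∀ T ∈ Ico 0 t₀,
    ∫⁻ t in Icc 0 T, (eLpNorm (toL2 (u t)) 10 (volume.restrict Ω)) ^ 5 < ⊤

/-- `∂ₜ²u - Δu + u⁵ = 0` in the sense of distributions on `(0,t₀) × Ω`. -/
def SatisfiesNLW (Ω : Set E3) (t₀ : ℝ) (u : ℝ → H10 Ω) : Prop :=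
  ∀ φ : ℝ × E3 → ℝ, ContDiff ℝ ∞ φ → HasCompactSupport φ → tsupport φ ⊆ Ioo 0 t₀ ×ˢ Ω →
    ∫ t in Ioo 0 t₀, ∫ x in Ω,
      (toL2 (u t) x *
          (iteratedDeriv 2 (fun s => φ (s, x)) t
            - Laplacian.laplacian (fun y => φ (t, y)) x)
        + toL2 (u t) x ^ 5 * φ (t, x)) = 0

/-- `u`, with time derivative `ut`, is a solution in `X_{<t₀}` of the Dirichlet problem for
`∂ₜ²u - Δu + u⁵ = 0` with initial data `(u₀, u₁)`. The boundary condition is contained in the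
requirement `u t ∈ H¹₀(Ω)`. -/
structure IsSolution (Ω : Set E3) (t₀ : ℝ) (u₀ : H10 Ω) (u₁ : L2 Ω)
    (u : ℝ → H10 Ω) (ut : ℝ → L2 Ω) : Prop where
  memX : MemX Ω t₀ u ut
  equation : SatisfiesNLW Ω t₀ u
  initial : u 0 = u₀
  initial_deriv : ut 0 = u₁

end NLW

end

open Set Filter Topology MeasureTheory
open scoped ContDiff

noncomputable section

namespace NLW

section

/-! Write τ = t₀ - t and s = |x - x₀|²/τ² (the function `sim`). Everything rests on one integrated
inequality for multipliers a ∂ₜu + X·∇u + b u (`IsMultiplier.total_sub_le`), applied to two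
multipliers.

The inequality. Formally, the multiplier identity has a single boundary term, ½∫ (X·n)|∂ₙu|² over
∂Ω, which is nonpositive when X points into Ω. No trace of ∂ₙu is ever taken. Instead X is required
to be pushing: x ↦ x - σX(x) maps the complement of Ω into itself, so v(x - σX(x)) stays in H¹₀(Ω)
for small σ > 0 and can be used as a test function. Comparing Dirichlet energies to first order as σ
→ 0⁺ gives `rellich`, an inequality with the favourable sign. As u is only a weak solution, the
quadratic part is proved for mollifications of u in time; they solve a linear wave equation whose
source is the mollified u⁵, and u⁵ is in L¹ in time with values in L² because of the L⁵L¹⁰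
hypothesis. The part involving u⁶ is obtained separately, by truncating r⁵ to a Lipschitz function.

First multiplier: Θ(s) ∂ₜu with Θ nonincreasing and constant for s ≤ 1. The surfaces s = const > 1
shrink faster than light, so the weighted energy is nonincreasing and converges as t → t₀. For a
suitable Θ the energy of a ring 1 < c ≤ s ≤ 4 is lost at a rate at least k/τ times itself. If that
ring energy had a positive limit, each interval [S, (S + t₀)/2] would cost a fixed amount,
contradicting convergence; hence it tends to 0 (`tendsto_ring`). The ring integral of u²/τ² follows
by interpolation (`mass_le`).

Second multiplier: Θ(s)(-τ ∂ₜu + Y·∇u + u), where Y = (x - x₀) - |x - x₀|² w is made to point inward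
near x₀ by the choice of w. For w = 0 and Θ = 1 all quadratic terms of the rate cancel and -u⁶/3 ≤ 0
remains. The vector w costs O(τ) times the energy, and Θ' only sees a ring, so the rate is bounded
above by o(1). The attached functional is at least -O(τ), so integration from t up to t₀ bounds its
negative by o(τ). Conversely, minus that functional divided by τ controls ∫ Θ u⁶/6 up to small
errors: a square is completed in ∂ₜu, the radial derivative is bounded by the full gradient where s
≤ 1 + δ, and the cross term with u is removed by an integration by parts (`virial_density_le`).
Hence ∫ Θ u⁶ → 0 (`eventually_cut_sixth_le`), and Θ = 1 on the light cone. -/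

/-- Continuous linear maps between normed spaces, elaborated along the norm structures. -/
abbrev CLM (G H : Type*) [NormedAddCommGroup G] [NormedSpace ℝ G] [NormedAddCommGroup H]
    [NormedSpace ℝ H] := G →L[ℝ] H

/-! ### Multiplication operators on Lᵖ and their dependence on time. -/

section MulOp

variable {α E F : Type*} [MeasurableSpace α] {μ : Measure α}
  [NormedAddCommGroup E] [InnerProductSpace ℝ E] [NormedAddCommGroup F] [InnerProductSpace ℝ F]
  {p : ENNReal} [Fact (1 ≤ p)]

open Classical in
/-- Pointwise action of a bounded field of operators on `Lᵖ`. -/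
def mulOp (μ : Measure α) (A : α → E →L[ℝ] F) : CLM (Lp E p μ) (Lp F p μ) :=
  if h : MemLp A ⊤ μ then
    (ContinuousLinearMap.id ℝ (E →L[ℝ] F)).holderL μ ⊤ p p (h.toLp A)
  else 0

theorem mulOp_coe {A : α → E →L[ℝ] F} (h : MemLp A ⊤ μ) (w : Lp E p μ) :
    mulOp μ A w =ᵐ[μ] fun x => A x (w x) := by
  rw [mulOp, dif_pos h]
  have h1 := ContinuousLinearMap.coeFn_holder (r := p)
    (ContinuousLinearMap.id ℝ (E →L[ℝ] F)) (h.toLp A) w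
  filter_upwards [h1, h.coeFn_toLp] with x hx1 hx2
  simp only [ContinuousLinearMap.holderL_apply_apply]
  rw [hx1, hx2]
  rfl

theorem mulOp_sub {A B : α → E →L[ℝ] F} (hA : MemLp A ⊤ μ) (hB : MemLp B ⊤ μ) :
    (mulOp μ (fun x => A x - B x) : CLM (Lp E p μ) (Lp F p μ)) = mulOp μ A - mulOp μ B := by
  ext1 w
  apply Lp.ext
  filter_upwards [mulOp_coe (hA.sub hB) w, mulOp_coe hA w, mulOp_coe hB w,
    Lp.coeFn_sub (mulOp μ A w) (mulOp μ B w)] with x h1 h2 h3 h4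
  rw [_root_.sub_apply, h4, Pi.sub_apply, h2, h3]
  exact h1

theorem mulOp_smul {A : α → E →L[ℝ] F} (c : ℝ) (hA : MemLp A ⊤ μ) :
    (mulOp μ (fun x => c • A x) : CLM (Lp E p μ) (Lp F p μ)) = c • mulOp μ A := by
  ext1 w
  apply Lp.ext
  filter_upwards [mulOp_coe (hA.const_smul c) w, mulOp_coe hA w,
    Lp.coeFn_smul c (mulOp μ A w)] with x h1 h2 h4
  rw [_root_.smul_apply, h4, Pi.smul_apply, h2]
  exact h1

theorem norm_mulOp_le {A : α → E →L[ℝ] F} {C : ℝ} (hC : 0 ≤ C) (h : ∀ᵐ x ∂μ, ‖A x‖ ≤ C) :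
    ‖(mulOp μ A : CLM (Lp E p μ) (Lp F p μ))‖ ≤ C := by
  by_cases hA : MemLp A ⊤ μ
  · refine ContinuousLinearMap.opNorm_le_bound _ hC fun w => ?_
    apply Lp.norm_le_mul_norm_of_ae_le_mul
    filter_upwards [mulOp_coe hA w, h] with x h1 h2
    rw [h1]
    exact (A x).le_of_opNorm_le h2 _
  · rw [mulOp, dif_neg hA]
    rwa [norm_zero]

theorem inner_mulOp {A : α → E →L[ℝ] F} (h : MemLp A ⊤ μ) (w : Lp E 2 μ) (v : Lp F 2 μ) :
    inner ℝ (mulOp μ A w) v = ∫ x, inner ℝ (A x (w x)) (v x) ∂μ := by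
  rw [L2.inner_def]
  apply integral_congr_ae
  filter_upwards [mulOp_coe h w] with x hx
  rw [hx]

theorem integrable_inner_mulOp {A : α → E →L[ℝ] F} (h : MemLp A ⊤ μ) (w : Lp E 2 μ)
    (v : Lp F 2 μ) : Integrable (fun x => inner ℝ (A x (w x)) (v x)) μ := by
  refine (L2.integrable_inner (𝕜 := ℝ) (mulOp μ A w) v).congr ?_
  filter_upwards [mulOp_coe h w] with x hx
  rw [hx]

end MulOp

section TimeDependent

variable {E F : Type*}
  [NormedAddCommGroup E] [InnerProductSpace ℝ E] [FiniteDimensional ℝ E]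
  [NormedAddCommGroup F] [InnerProductSpace ℝ F] [FiniteDimensional ℝ F]
  {p : ENNReal} [Fact (1 ≤ p)] {Ω : Set E3} {I : Set ℝ}

theorem exists_bound_of_continuous {W : Type*} [NormedAddCommGroup W] (hΩ : Bornology.IsBounded Ω) {A : E3 → W}
    (hA : Continuous A) : ∃ C, 0 ≤ C ∧ ∀ x ∈ closure Ω, ‖A x‖ ≤ C := by
  obtain ⟨C, hC⟩ := hΩ.isCompact_closure.exists_bound_of_continuousOn hA.continuousOn
  exact ⟨max C 0, le_max_right _ _, fun x hx => (hC x hx).trans (le_max_left _ _)⟩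

theorem memLp_top_of_continuous {W : Type*} [NormedAddCommGroup W]
    [SecondCountableTopologyEither E3 W] (hΩ : Bornology.IsBounded Ω) (hm : MeasurableSet Ω) {A : E3 → W}
    (hA : Continuous A) : MemLp A ⊤ (volume.restrict Ω) := by
  obtain ⟨C, -, hC⟩ := exists_bound_of_continuous hΩ hA
  refine memLp_top_of_bound hA.aestronglyMeasurable C ?_
  filter_upwards [ae_restrict_mem hm] with x hx using hC x (subset_closure hx)

theorem continuous_slice {W : Type*} [NormedAddCommGroup W] {A : ℝ → E3 → W}
    (hA : ContinuousOn (Function.uncurry A) (I ×ˢ univ)) {t : ℝ} (ht : t ∈ I) :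
    Continuous (A t) := by
  have : ContinuousOn (fun x : E3 => Function.uncurry A (t, x)) univ :=
    hA.comp (by fun_prop) (fun x _ => ⟨ht, mem_univ _⟩)
  exact continuousOn_univ.1 this

/-- Joint continuity is uniform in x over the compact closure of Ω, which makes the operators
continuous in time for the operator norm and not only strongly. -/
theorem continuousOn_mulOp (hΩ : Bornology.IsBounded Ω) (hm : MeasurableSet Ω)
    {A : ℝ → E3 → E →L[ℝ] F} (hA : ContinuousOn (Function.uncurry A) (I ×ˢ univ)) :
    ContinuousOn (fun t => (mulOp (volume.restrict Ω) (A t) :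
      CLM (Lp E p (volume.restrict Ω)) (Lp F p (volume.restrict Ω)))) I := by
  intro t ht
  refine Metric.tendsto_nhds.2 fun ε hε => ?_
  obtain ⟨v, hv, h⟩ := hΩ.isCompact_closure.mem_uniformity_of_prod
    (hA.mono (prod_mono_right (subset_univ _))) ht (Metric.dist_mem_uniformity (half_pos hε))
  filter_upwards [hv, self_mem_nhdsWithin] with s hs hsI
  rw [dist_eq_norm, ← mulOp_sub (memLp_top_of_continuous hΩ hm (continuous_slice hA hsI))
    (memLp_top_of_continuous hΩ hm (continuous_slice hA ht))]
  refine (norm_mulOp_le (half_pos hε).le ?_).trans_lt (half_lt_self hε)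
  filter_upwards [ae_restrict_mem hm] with x hx
  have := h s hs x (subset_closure hx)
  simp only [mem_ofPred_eq, dist_eq_norm] at this
  exact this.le

/-- The mean value inequality is applied, for each fixed x, to s ↦ A s x - s • A' t x. Its
derivative is at most ε near t, uniformly in x on the compact closure, so the remainder is small in
operator norm. -/
theorem hasDerivAt_mulOp (hΩ : Bornology.IsBounded Ω) (hm : MeasurableSet Ω) (hI : IsOpen I)
    {A A' : ℝ → E3 → E →L[ℝ] F} (hA : ∀ t ∈ I, Continuous (A t))
    (hd : ∀ t ∈ I, ∀ x, HasDerivAt (fun s => A s x) (A' t x) t)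
    (hA' : ContinuousOn (Function.uncurry A') (I ×ˢ univ)) {t : ℝ} (ht : t ∈ I) :
    HasDerivAt (fun t => (mulOp (volume.restrict Ω) (A t) :
      CLM (Lp E p (volume.restrict Ω)) (Lp F p (volume.restrict Ω)))) (mulOp (volume.restrict Ω) (A' t)) t := by
  rw [hasDerivAt_iff_isLittleO, Asymptotics.isLittleO_iff]
  intro ε hε
  obtain ⟨v, hv, h⟩ := hΩ.isCompact_closure.mem_uniformity_of_prod
    (hA'.mono (prod_mono_right (subset_univ _))) ht (Metric.dist_mem_uniformity hε)
  rw [hI.nhdsWithin_eq ht] at hv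
  obtain ⟨δ, hδ, hball⟩ := Metric.mem_nhds_iff.1 (inter_mem hv (hI.mem_nhds ht))
  filter_upwards [Metric.ball_mem_nhds t hδ] with s hs
  have hA1 : ∀ r ∈ I, MemLp (A r) ⊤ (volume.restrict Ω) := fun r hr =>
    memLp_top_of_continuous hΩ hm (hA r hr)
  have hA2 : MemLp (A' t) ⊤ (volume.restrict Ω) :=
    memLp_top_of_continuous hΩ hm (continuous_slice hA' ht)
  rw [← mulOp_sub (hA1 s (hball hs).2) (hA1 t ht), ← mulOp_smul _ hA2,
    ← mulOp_sub (A := fun x => A s x - A t x) (B := fun x => (s - t) • A' t x)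
      ((hA1 s (hball hs).2).sub (hA1 t ht)) (hA2.const_smul (s - t))]
  refine norm_mulOp_le (by positivity) ?_
  filter_upwards [ae_restrict_mem hm] with x hx
  have key : ∀ r ∈ Metric.ball t δ, HasDerivWithinAt (fun s => A s x - s • A' t x)
      (A' r x - A' t x) (Metric.ball t δ) r := by
    intro r hr
    have h2 := (hasDerivAt_id r).smul_const (A' t x)
    rw [one_smul] at h2
    exact ((hd r (hball hr).2 x).sub h2).hasDerivWithinAt
  have := (convex_ball t δ).norm_image_sub_le_of_norm_hasDerivWithin_le (C := ε) key
    (fun r hr => by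
      have := h r (hball hr).1 x (subset_closure hx)
      simp only [mem_ofPred_eq, dist_eq_norm] at this
      exact this.le) (Metric.mem_ball_self hδ) hs
  refine le_trans (le_of_eq ?_) this
  congr 1
  simp only [sub_smul]
  abel

end TimeDependent

end

/-! ### The space H¹₀(Ω): density of test functions and multiplication by smooth functions. -/

section

variable {Ω : Set E3}

/-- The weak gradient of an element of `H¹₀(Ω)`. -/
def gradH (f : H10 Ω) : L2Vec Ω := (f : WithLp 2 (L2 Ω × L2Vec Ω)).snd

instance : CompleteSpace (H10 Ω) :=
  inferInstanceAs (CompleteSpace (testGraph Ω).topologicalClosure)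

variable (Ω) in
/-- `toL2` as a continuous linear map. -/
def toL2L : CLM (H10 Ω) (L2 Ω) :=
  LinearMap.mkContinuous
    { toFun := toL2, map_add' := fun _ _ => rfl, map_smul' := fun _ _ => rfl } 1
    (fun f => by rw [one_mul]; exact WithLp.norm_fst_le _ (f : WithLp 2 (L2 Ω × L2Vec Ω)))

variable (Ω) in
/-- `gradH` as a continuous linear map. -/
def gradL : CLM (H10 Ω) (L2Vec Ω) :=
  LinearMap.mkContinuous
    { toFun := gradH, map_add' := fun _ _ => rfl, map_smul' := fun _ _ => rfl } 1
    (fun f => by rw [one_mul]; exact WithLp.norm_snd_le _ (f : WithLp 2 (L2 Ω × L2Vec Ω)))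

@[simp] theorem toL2L_apply (f : H10 Ω) : toL2L Ω f = toL2 f := rfl

@[simp] theorem gradL_apply (f : H10 Ω) : gradL Ω f = gradH f := rfl

theorem continuous_toL2 : Continuous (toL2 : H10 Ω → L2 Ω) := (toL2L Ω).continuous

theorem continuous_gradH : Continuous (gradH : H10 Ω → L2Vec Ω) := (gradL Ω).continuous

/-- Smooth functions with compact support in `Ω`. -/
structure IsTest (Ω : Set E3) (φ : E3 → ℝ) : Prop where
  contDiff : ContDiff ℝ ∞ φ
  compact : HasCompactSupport φ
  subset : tsupport φ ⊆ Ω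

theorem continuous_gradient {φ : E3 → ℝ} (h : ContDiff ℝ 1 φ) : Continuous (gradient φ) :=
  (InnerProductSpace.toDual ℝ E3).symm.continuous.comp (h.continuous_fderiv (by simp))

theorem gradient_eq_zero_of_notMem {φ : E3 → ℝ} {x : E3} (hx : x ∉ tsupport φ) :
    gradient φ x = 0 := by
  have : fderiv ℝ φ x = 0 := by
    by_contra h
    exact hx (support_fderiv_subset ℝ (Function.mem_support.2 h))
  simp [gradient, this]

theorem hasCompactSupport_gradient {φ : E3 → ℝ} (h : HasCompactSupport φ) :
    HasCompactSupport (gradient φ) :=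
  HasCompactSupport.intro h fun _ hx => gradient_eq_zero_of_notMem hx

theorem IsTest.memLp {φ : E3 → ℝ} (h : IsTest Ω φ) (p : ENNReal) :
    MemLp φ p (volume.restrict Ω) :=
  (h.contDiff.continuous.memLp_of_hasCompactSupport h.compact).restrict Ω

theorem IsTest.memLp_gradient {φ : E3 → ℝ} (h : IsTest Ω φ) (p : ENNReal) :
    MemLp (gradient φ) p (volume.restrict Ω) :=
  ((continuous_gradient (h.contDiff.of_le (by norm_cast))).memLp_of_hasCompactSupport
    (hasCompactSupport_gradient h.compact)).restrict Ω

/-- `f` is represented by the test function `φ`. -/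
structure Represents (f : H10 Ω) (φ : E3 → ℝ) : Prop where
  isTest : IsTest Ω φ
  coe : toL2 f =ᵐ[volume.restrict Ω] φ
  grad : gradH f =ᵐ[volume.restrict Ω] gradient φ

theorem dense_represented : Dense {f : H10 Ω | ∃ φ, Represents f φ} := by
  intro f
  rw [closure_subtype]
  have hf : (f : WithLp 2 (L2 Ω × L2Vec Ω)) ∈ closure (testGraph Ω : Set _) := by
    rw [← Submodule.topologicalClosure_coe]
    exact f.2
  refine closure_mono ?_ hf
  rintro p ⟨φ, h1, h2, h3, h4, h5⟩
  exact ⟨⟨p, Submodule.le_topologicalClosure _ ⟨φ, h1, h2, h3, h4, h5⟩⟩,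
    ⟨φ, ⟨h1, h2, h3⟩, h4, h5⟩, rfl⟩

/-- A closed property that holds for test functions holds on `H¹₀(Ω)`. -/
theorem H10.induction {p : H10 Ω → Prop} (hc : IsClosed {f | p f})
    (h : ∀ f φ, Represents f φ → p f) (f : H10 Ω) : p f := by
  have : closure {f : H10 Ω | ∃ φ, Represents f φ} ⊆ {f | p f} :=
    closure_minimal (fun f ⟨φ, hφ⟩ => h f φ hφ) hc
  exact this (dense_represented f)

/-- Continuous maps which send test functions to test functions preserve `H¹₀(Ω)`. -/
theorem H10.exists_of_map {T : H10 Ω → L2 Ω} {S : H10 Ω → L2Vec Ω} (hT : Continuous T)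
    (hS : Continuous S)
    (h : ∀ f φ, Represents f φ → ∃ ψ, IsTest Ω ψ ∧ T f =ᵐ[volume.restrict Ω] ψ ∧
      S f =ᵐ[volume.restrict Ω] gradient ψ) (f : H10 Ω) :
    ∃ g : H10 Ω, toL2 g = T f ∧ gradH g = S f := by
  have key : ∀ f : H10 Ω, WithLp.toLp 2 (T f, S f) ∈ H10 Ω := by
    apply H10.induction
    · have h1 : Continuous fun f : H10 Ω => WithLp.toLp 2 (T f, S f) :=
        (WithLp.prod_continuous_toLp 2 _ _).comp (hT.prodMk hS)
      exact (Submodule.isClosed_topologicalClosure (testGraph Ω)).preimage h1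
    · intro f φ hf
      obtain ⟨ψ, h1, h2, h3⟩ := h f φ hf
      exact Submodule.le_topologicalClosure _ ⟨ψ, h1.contDiff, h1.compact, h1.subset, h2, h3⟩
  exact ⟨⟨_, key f⟩, rfl, rfl⟩

/-- Multiplication by a scalar function on `Lp`. -/
abbrev smulOp (Ω : Set E3) (E : Type*) [NormedAddCommGroup E] [InnerProductSpace ℝ E]
    (p : ENNReal) [Fact (1 ≤ p)] (b : E3 → ℝ) :
    CLM (Lp E p (volume.restrict Ω)) (Lp E p (volume.restrict Ω)) :=
  mulOp (volume.restrict Ω) fun x => b x • ContinuousLinearMap.id ℝ E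

/-- The operator `ξ ↦ X · ξ`. -/
abbrev dotOp (Ω : Set E3) (X : E3 → E3) : CLM (L2Vec Ω) (L2 Ω) :=
  mulOp (volume.restrict Ω) fun x => innerSL ℝ (X x)

/-- The operator `p ↦ p Y`. -/
abbrev spanOp (Ω : Set E3) (Y : E3 → E3) : CLM (L2 Ω) (L2Vec Ω) :=
  mulOp (volume.restrict Ω) fun x => ContinuousLinearMap.toSpanSingleton ℝ (Y x)

theorem continuous_smul_id {E : Type*} [NormedAddCommGroup E] [NormedSpace ℝ E]
    {b : E3 → ℝ} (hb : Continuous b) :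
    Continuous fun x => b x • ContinuousLinearMap.id ℝ E :=
  hb.smul continuous_const

theorem continuous_innerSL {X : E3 → E3} (hX : Continuous X) :
    Continuous fun x => innerSL ℝ (X x) :=
  (innerSL ℝ).continuous.comp hX

theorem continuous_toSpanSingleton {X : E3 → E3} (hX : Continuous X) :
    Continuous fun x => ContinuousLinearMap.toSpanSingleton ℝ (X x) :=
  (ContinuousLinearMap.toSpanSingletonCLE (𝕜 := ℝ) (E := E3)).continuous.comp hX

theorem gradient_mul {b φ : E3 → ℝ} {x : E3} (hb : DifferentiableAt ℝ b x)
    (hφ : DifferentiableAt ℝ φ x) :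
    gradient (fun y => b y * φ y) x = b x • gradient φ x + φ x • gradient b x := by
  simp [gradient, fderiv_fun_mul hb hφ]

/-- This makes a ∂ₜu and b u admissible test functions in the weak wave equation; the product rule
is checked on test functions and passes to the closure. -/
theorem exists_smul_mem (hΩ : Bornology.IsBounded Ω) (ho : IsOpen Ω) {b : E3 → ℝ}
    (hb : ContDiff ℝ ∞ b) (f : H10 Ω) :
    ∃ g : H10 Ω, toL2 g = smulOp Ω ℝ 2 b (toL2 f) ∧
      gradH g = smulOp Ω E3 2 b (gradH f) + spanOp Ω (gradient b) (toL2 f) := by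
  have hgb : Continuous (gradient b) :=
    continuous_gradient (hb.of_le (by norm_cast))
  refine H10.exists_of_map (T := fun f => smulOp Ω ℝ 2 b (toL2 f))
    (S := fun f => smulOp Ω E3 2 b (gradH f) + spanOp Ω (gradient b) (toL2 f))
    ((mulOp _ _).continuous.comp continuous_toL2)
    (((mulOp _ _).continuous.comp continuous_gradH).add
      ((mulOp _ _).continuous.comp continuous_toL2)) ?_ f
  intro f φ hf
  have hm := ho.measurableSet
  refine ⟨fun y => b y * φ y, ⟨hb.mul hf.isTest.contDiff, hf.isTest.compact.mul_left,
    (tsupport_mul_subset_right).trans hf.isTest.subset⟩, ?_, ?_⟩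
  · filter_upwards [mulOp_coe (memLp_top_of_continuous hΩ hm
      (continuous_smul_id hb.continuous)) (toL2 f), hf.coe] with x h1 h2
    rw [h1, h2]
    simp
  · filter_upwards [mulOp_coe (memLp_top_of_continuous hΩ hm
      (continuous_smul_id hb.continuous)) (gradH f), hf.coe, hf.grad,
      mulOp_coe (memLp_top_of_continuous hΩ hm (continuous_toSpanSingleton hgb)) (toL2 f),
      Lp.coeFn_add (smulOp Ω E3 2 b (gradH f)) (spanOp Ω (gradient b) (toL2 f))]
      with x h1 h2 h3 h4 h5
    rw [h5, Pi.add_apply, h1, h3, h4, h2, gradient_mul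
      ((hb.differentiable (by simp)) x) ((hf.isTest.contDiff.differentiable (by simp)) x)]
    simp

end

/-! ### Nemytskii operators from L² to L¹ and differentiation of potential energies. -/

section

/-- `G` is a primitive, vanishing at `0`, of the Lipschitz function `g` with `g 0 = 0`. -/
structure IsPrimitive (G g : ℝ → ℝ) (K : NNReal) : Prop where
  deriv : ∀ r, HasDerivAt G (g r) r
  lip : LipschitzWith K g
  map_zero : g 0 = 0
  prim_zero : G 0 = 0

namespace IsPrimitive

variable {G g : ℝ → ℝ} {K : NNReal}

theorem abs_sub_le (h : IsPrimitive G g K) (r s : ℝ) :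
    |G r - G s - g s * (r - s)| ≤ K * (r - s) ^ 2 := by
  have key := (convex_uIcc s r).norm_image_sub_le_of_norm_hasDerivWithin_le
    (f := fun y => G y - g s * y) (f' := fun y => g y - g s * 1) (C := K * |r - s|) (x := s) (y := r)
    (fun y _ => ((h.deriv y).sub ((hasDerivAt_id y).const_mul (g s))).hasDerivWithinAt)
    (fun y hy => by
      have h1 := h.lip.dist_le_mul y s
      rw [Real.dist_eq, Real.dist_eq] at h1
      rw [mul_one, Real.norm_eq_abs]
      refine h1.trans (mul_le_mul_of_nonneg_left ?_ K.2)
      exact abs_sub_left_of_mem_uIcc hy) left_mem_uIcc right_mem_uIcc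
  rw [Real.norm_eq_abs, Real.norm_eq_abs, mul_assoc, ← sq, sq_abs] at key
  refine le_trans (le_of_eq ?_) key
  congr 1
  ring

theorem abs_le (h : IsPrimitive G g K) (r : ℝ) : |G r| ≤ K * r ^ 2 := by
  simpa [h.map_zero, h.prim_zero] using h.abs_sub_le r 0

theorem continuous (h : IsPrimitive G g K) : Continuous G :=
  continuous_iff_continuousAt.2 fun r => (h.deriv r).continuousAt

variable {α : Type*} [MeasurableSpace α] {μ : Measure α}

theorem memLp (h : IsPrimitive G g K) (w : Lp ℝ 2 μ) : MemLp (fun x => G (w x)) 1 μ := by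
  rw [memLp_one_iff_integrable]
  have h1 : Integrable (fun x => (K : ℝ) * (w x) ^ 2) μ := (Lp.memLp w).integrable_sq.const_mul _
  refine h1.mono' (h.continuous.comp_aestronglyMeasurable (Lp.aestronglyMeasurable w))
    (Eventually.of_forall fun x => h.abs_le _)

/-- The Nemytskii operator `w ↦ G ∘ w` from `L²` to `L¹`. -/
def toL1 (h : IsPrimitive G g K) (w : Lp ℝ 2 μ) : Lp ℝ 1 μ := (h.memLp w).toLp _

theorem toL1_coe (h : IsPrimitive G g K) (w : Lp ℝ 2 μ) :
    h.toL1 w =ᵐ[μ] fun x => G (w x) := (h.memLp w).coeFn_toLp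

/-- The Nemytskii operator `w ↦ g ∘ w` on `L²`. -/
def comp (h : IsPrimitive G g K) (w : Lp ℝ 2 μ) : Lp ℝ 2 μ := h.lip.compLp h.map_zero w

theorem comp_coe (h : IsPrimitive G g K) (w : Lp ℝ 2 μ) :
    h.comp w =ᵐ[μ] fun x => g (w x) := h.lip.coeFn_compLp h.map_zero w

theorem continuous_comp (h : IsPrimitive G g K) :
    Continuous (h.comp : Lp ℝ 2 μ → Lp ℝ 2 μ) := h.lip.continuous_compLp h.map_zero

theorem norm_sq_eq (w : Lp ℝ 2 μ) : ‖w‖ ^ 2 = ∫ x, (w x) ^ 2 ∂μ := by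
  rw [← real_inner_self_eq_norm_sq, L2.inner_def]
  simp [sq]

/-- The pointwise remainder is at most K (v - w)², whose integral is K‖v - w‖². The target is L¹
precisely because a quadratic remainder is controlled there. -/
theorem hasFDerivAt_toL1 (h : IsPrimitive G g K) (w : Lp ℝ 2 μ) :
    HasFDerivAt (h.toL1 : Lp ℝ 2 μ → Lp ℝ 1 μ)
      (((ContinuousLinearMap.mul ℝ ℝ).holderL μ 2 2 1 : CLM (Lp ℝ 2 μ)
        (CLM (Lp ℝ 2 μ) (Lp ℝ 1 μ))) (h.comp w)) w := by
  rw [hasFDerivAt_iff_isLittleO]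
  refine Asymptotics.IsBigO.trans_isLittleO (g := fun v => ‖v - w‖ ^ 2) ?_ ?_
  · refine Asymptotics.IsBigO.of_bound K (Eventually.of_forall fun v => ?_)
    rw [L1.norm_eq_integral_norm]
    rw [Real.norm_of_nonneg (by positivity), norm_sq_eq, ← integral_const_mul]
    refine integral_mono_ae (L1.integrable_coeFn _).norm
      ((Lp.memLp (v - w)).integrable_sq.const_mul _) ?_
    filter_upwards [Lp.coeFn_sub (h.toL1 v - h.toL1 w)
      ((((ContinuousLinearMap.mul ℝ ℝ).holderL μ 2 2 1 : CLM (Lp ℝ 2 μ)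
        (CLM (Lp ℝ 2 μ) (Lp ℝ 1 μ))) (h.comp w)) (v - w)), Lp.coeFn_sub (h.toL1 v) (h.toL1 w),
      h.toL1_coe v, h.toL1_coe w, Lp.coeFn_sub v w,
      ContinuousLinearMap.coeFn_holder (r := 1) (ContinuousLinearMap.mul ℝ ℝ) (h.comp w) (v - w),
      h.comp_coe w] with x h1 h2 h3 h4 h5 h6 h7
    have h8 : ((((ContinuousLinearMap.mul ℝ ℝ).holderL μ 2 2 1 : CLM (Lp ℝ 2 μ)
        (CLM (Lp ℝ 2 μ) (Lp ℝ 1 μ))) (h.comp w)) (v - w)) x = g (w x) * (v x - w x) := by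
      rw [ContinuousLinearMap.holderL_apply_apply, h6, h7, h5]
      rfl
    rw [h1, Pi.sub_apply, h2, Pi.sub_apply, h3, h4, h8, h5, Pi.sub_apply]
    exact h.abs_sub_le _ _
  · have h1 : Tendsto (fun v : Lp ℝ 2 μ => v - w) (𝓝 w) (𝓝 0) := by
      have : Continuous fun v : Lp ℝ 2 μ => v - w := by fun_prop
      simpa using this.tendsto w
    exact (Asymptotics.isLittleO_norm_pow_id (E' := Lp ℝ 2 μ) one_lt_two).comp_tendsto h1

end IsPrimitive

/-- Integration as a continuous linear functional on `L¹`. -/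
def intCLM {α : Type*} [MeasurableSpace α] (μ : Measure α) : CLM (Lp ℝ 1 μ) ℝ := L1.integralCLM

theorem intCLM_apply {α : Type*} [MeasurableSpace α] {μ : Measure α} (f : Lp ℝ 1 μ) :
    intCLM μ f = ∫ x, f x ∂μ := by
  rw [intCLM, ← L1.integral_eq_integral, L1.integral_eq]

section Potential

variable {Ω : Set E3} {G g : ℝ → ℝ} {K : NNReal}

/-- The functional `w ↦ ∫_Ω a G(w)`. -/
def potential (Ω : Set E3) (G : ℝ → ℝ) (a : E3 → ℝ) (w : L2 Ω) : ℝ :=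
  ∫ x in Ω, a x * G (w x)

theorem IsPrimitive.integrable (h : IsPrimitive G g K) (hΩ : Bornology.IsBounded Ω)
    (ho : IsOpen Ω) {a : E3 → ℝ} (ha : Continuous a) (w : L2 Ω) :
    IntegrableOn (fun x => a x * G (w x)) Ω := by
  have := L1.integrable_coeFn (smulOp Ω ℝ 1 a (h.toL1 w))
  refine this.congr ?_
  filter_upwards [mulOp_coe (memLp_top_of_continuous hΩ ho.measurableSet
    (continuous_smul_id ha)) (h.toL1 w), h.toL1_coe w] with x h1 h2
  rw [h1, h2]
  simp

theorem IsPrimitive.potential_eq (h : IsPrimitive G g K) (hΩ : Bornology.IsBounded Ω)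
    (ho : IsOpen Ω) {a : E3 → ℝ} (ha : Continuous a) (w : L2 Ω) :
    potential Ω G a w = intCLM _ (smulOp Ω ℝ 1 a (h.toL1 w)) := by
  rw [intCLM_apply]
  apply integral_congr_ae
  filter_upwards [mulOp_coe (memLp_top_of_continuous hΩ ho.measurableSet
    (continuous_smul_id ha)) (h.toL1 w), h.toL1_coe w] with x h1 h2
  rw [h1, h2]
  simp

theorem hasDerivAt_smulOp {E : Type*} [NormedAddCommGroup E] [InnerProductSpace ℝ E]
    [FiniteDimensional ℝ E] {p : ENNReal} [Fact (1 ≤ p)] (hΩ : Bornology.IsBounded Ω)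
    (ho : IsOpen Ω) {I : Set ℝ} (hI : IsOpen I) {a a' : ℝ → E3 → ℝ}
    (ha : ∀ t ∈ I, Continuous (a t))
    (hd : ∀ t ∈ I, ∀ x, HasDerivAt (fun s => a s x) (a' t x) t)
    (ha' : ContinuousOn (Function.uncurry a') (I ×ˢ univ)) {t : ℝ} (ht : t ∈ I) :
    HasDerivAt (fun t => smulOp Ω E p (a t)) (smulOp Ω E p (a' t)) t :=
  hasDerivAt_mulOp hΩ ho.measurableSet hI (fun s hs => continuous_smul_id (ha s hs))
    (A' := fun t x => a' t x • ContinuousLinearMap.id ℝ E)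
    (fun s hs x => HasDerivAt.smul_const (F := CLM E E) (hd s hs x) (ContinuousLinearMap.id ℝ E))
    (ha'.smul continuousOn_const) ht

/-- Product rule for the operator `smulOp Ω ℝ 1 (a t)` applied to G ∘ w. Only differentiability of w
in L² is needed, which is all that is known for u; this is why the nonlinearity is truncated to have
a Lipschitz derivative. -/
theorem IsPrimitive.hasDerivAt_potential (h : IsPrimitive G g K) (hΩ : Bornology.IsBounded Ω)
    (ho : IsOpen Ω) {I : Set ℝ} (hI : IsOpen I) {a a' : ℝ → E3 → ℝ}
    (ha : ∀ t ∈ I, Continuous (a t))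
    (hd : ∀ t ∈ I, ∀ x, HasDerivAt (fun s => a s x) (a' t x) t)
    (ha' : ContinuousOn (Function.uncurry a') (I ×ˢ univ)) {w : ℝ → L2 Ω} {w' : L2 Ω} {t : ℝ}
    (ht : t ∈ I) (hw : HasDerivAt w w' t) :
    HasDerivAt (fun s => potential Ω G (a s) (w s))
      (potential Ω G (a' t) (w t) + inner ℝ (smulOp Ω ℝ 2 (a t) (h.comp (w t))) w') t := by
  have h1 := hasDerivAt_smulOp (E := ℝ) (p := 1) hΩ ho hI ha hd ha' ht
  have h2 := (h.hasFDerivAt_toL1 (w t)).comp_hasDerivAt t hw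
  have h3 := ((intCLM (volume.restrict Ω)).hasFDerivAt).comp_hasDerivAt t (h1.clm_apply h2)
  refine HasDerivAt.congr_deriv (h3.congr_of_eventuallyEq
    (f₁ := fun s => potential Ω G (a s) (w s)) ?_) ?_
  · filter_upwards [hI.mem_nhds ht] with s hs
    exact h.potential_eq hΩ ho (ha s hs) (w s)
  symm
  rw [map_add, Function.comp_apply, ← h.potential_eq hΩ ho (continuous_slice ha' ht)]
  congr 1
  rw [inner_mulOp (memLp_top_of_continuous hΩ ho.measurableSet (continuous_smul_id (ha t ht))),
    intCLM_apply]
  apply integral_congr_ae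
  filter_upwards [mulOp_coe (p := 1) (memLp_top_of_continuous hΩ ho.measurableSet
    (continuous_smul_id (E := ℝ) (ha t ht))) (((ContinuousLinearMap.mul ℝ ℝ).holderL _ 2 2 1 :
      CLM (L2 Ω) (CLM (L2 Ω) (Lp ℝ 1 (volume.restrict Ω)))) (h.comp (w t)) w'),
    ContinuousLinearMap.coeFn_holder (r := 1) (ContinuousLinearMap.mul ℝ ℝ) (h.comp (w t)) w']
    with x h5 h6
  rw [h5, ContinuousLinearMap.holderL_apply_apply, h6]
  simp
  ring

theorem IsPrimitive.continuous_potential (h : IsPrimitive G g K) (hΩ : Bornology.IsBounded Ω)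
    (ho : IsOpen Ω) {a : E3 → ℝ} (ha : Continuous a) : Continuous (potential Ω G a) := by
  have : potential Ω G a = fun w => intCLM _ (smulOp Ω ℝ 1 a (h.toL1 w)) :=
    funext fun w => h.potential_eq hΩ ho ha w
  rw [this]
  have h1 : Continuous (h.toL1 : L2 Ω → _) :=
    continuous_iff_continuousAt.2 fun w => (h.hasFDerivAt_toL1 w).continuousAt
  exact (intCLM _).continuous.comp ((smulOp Ω ℝ 1 a).continuous.comp h1)

end Potential

end

/-! ### Integration by parts and the Sobolev embedding in H¹₀(Ω). -/

section

/-- The trace of an endomorphism of `ℝ³`; applied to a derivative it gives the divergence. -/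
def dv (A : E3 →L[ℝ] E3) : ℝ := ∑ i, A (EuclideanSpace.single i 1) i

@[fun_prop] theorem continuous_dv : Continuous dv := by
  unfold dv
  fun_prop

theorem sum_coord (x : E3) : ∑ i, x i • EuclideanSpace.single i (1 : ℝ) = x := by
  ext j
  fin_cases j <;> simp [Fin.sum_univ_three]

/-- One-directional integration by parts, summed over coordinates. Compact support of ψ alone gives
integrability; X may grow. -/
theorem integral_inner_gradient {X : E3 → E3} {ψ : E3 → ℝ} (hX : ContDiff ℝ 1 X)
    (hψ : ContDiff ℝ 1 ψ) (hc : HasCompactSupport ψ) :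
    ∫ x, inner ℝ (X x) (gradient ψ x) = - ∫ x, dv (fderiv ℝ X x) * ψ x := by
  have hXi : ∀ i, ContDiff ℝ 1 fun x => X x i := fun i => by fun_prop
  have hfX : ∀ i x v, fderiv ℝ (fun x => X x i) x v = fderiv ℝ X x v i := by
    intro i x v
    have h1 : HasFDerivAt (fun x => X x i) ((EuclideanSpace.proj i).comp (fderiv ℝ X x)) x :=
      (EuclideanSpace.proj i : E3 →L[ℝ] ℝ).hasFDerivAt.comp x
        ((hX.differentiable (by simp)) x).hasFDerivAt
    rw [h1.fderiv]
    rfl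
  have hcd : ∀ v, HasCompactSupport fun x => fderiv ℝ ψ x v := fun v => hc.fderiv_apply ℝ v
  have hψ' : ∀ v, Continuous fun x => fderiv ℝ ψ x v := fun v =>
    (hψ.continuous_fderiv (by simp)).clm_apply continuous_const
  have hX' : ∀ i v, Continuous fun x => fderiv ℝ (fun x => X x i) x v := fun i v =>
    ((hXi i).continuous_fderiv (by simp)).clm_apply continuous_const
  have i1 : ∀ i v, Integrable fun x => X x i * fderiv ℝ ψ x v := fun i v =>
    ((hXi i).continuous.mul (hψ' v)).integrable_of_hasCompactSupport (hcd v).mul_left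
  have i2 : ∀ i v, Integrable fun x => fderiv ℝ (fun x => X x i) x v * ψ x := fun i v =>
    ((hX' i v).mul hψ.continuous).integrable_of_hasCompactSupport hc.mul_left
  have i3 : ∀ i, Integrable fun x => X x i * ψ x := fun i =>
    ((hXi i).continuous.mul hψ.continuous).integrable_of_hasCompactSupport hc.mul_left
  have key : ∀ i, ∫ x, X x i * fderiv ℝ ψ x (EuclideanSpace.single i 1) =
      - ∫ x, fderiv ℝ (fun x => X x i) x (EuclideanSpace.single i 1) * ψ x := fun i =>
    integral_mul_fderiv_eq_neg_fderiv_mul_of_integrable (i2 i _) (i1 i _) (i3 i)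
      (fun x _ => (hXi i).differentiable (by simp) x) (fun x _ => hψ.differentiable (by simp) x)
  have e1 : ∀ x, inner ℝ (X x) (gradient ψ x) =
      ∑ i, X x i * fderiv ℝ ψ x (EuclideanSpace.single i 1) := by
    intro x
    rw [real_inner_comm, inner_gradient_left]
    conv_lhs => rw [← sum_coord (X x)]
    simp [map_sum]
  have e2 : ∀ x, dv (fderiv ℝ X x) * ψ x =
      ∑ i, fderiv ℝ (fun x => X x i) x (EuclideanSpace.single i 1) * ψ x := by
    intro x
    simp only [dv, Finset.sum_mul, hfX]
  simp only [e1, e2]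
  rw [integral_finsetSum _ fun i _ => i1 i _, integral_finsetSum _ fun i _ => i2 i _,
    ← Finset.sum_neg_distrib]
  exact Finset.sum_congr rfl fun i _ => key i

variable {Ω : Set E3}

theorem continuous_dv_fderiv {X : E3 → E3} (hX : ContDiff ℝ 1 X) :
    Continuous fun x => dv (fderiv ℝ X x) :=
  continuous_dv.comp (hX.continuous_fderiv (by simp))

theorem setIntegral_eq_of_tsupport {f : E3 → ℝ} {φ : E3 → ℝ} (h : tsupport φ ⊆ Ω)
    (hf : ∀ x, x ∉ tsupport φ → f x = 0) : ∫ x in Ω, f x = ∫ x, f x :=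
  setIntegral_eq_integral_of_forall_compl_eq_zero fun x hx => hf x fun hx' => hx (h hx')

theorem hasGradientAt_comp {G : ℝ → ℝ} {g : ℝ} {φ : E3 → ℝ} {x : E3} (hG : HasDerivAt G g (φ x))
    (hφ : DifferentiableAt ℝ φ x) : HasGradientAt (fun y => G (φ y)) (g • gradient φ x) x := by
  rw [hasGradientAt_iff_hasFDerivAt]
  refine (hG.comp_hasFDerivAt x hφ.hasFDerivAt).congr_fderiv ?_
  simp [gradient]

/-- Integration by parts for `X · ∇G(v)`, `v ∈ H¹₀(Ω)`. -/
theorem IsPrimitive.inner_dotOp {G g : ℝ → ℝ} {K : NNReal} (h : IsPrimitive G g K)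
    (hΩ : Bornology.IsBounded Ω) (ho : IsOpen Ω) {X : E3 → E3} (hX : ContDiff ℝ 1 X)
    (v : H10 Ω) :
    inner ℝ (dotOp Ω X (gradH v)) (h.comp (toL2 v)) =
      - potential Ω G (fun x => dv (fderiv ℝ X x)) (toL2 v) := by
  revert v
  apply H10.induction
  · refine isClosed_eq ?_ ?_
    · exact ((mulOp _ _).continuous.comp continuous_gradH).inner
        (h.continuous_comp.comp continuous_toL2)
    · exact ((h.continuous_potential hΩ ho (continuous_dv_fderiv hX)).comp continuous_toL2).neg
  · intro v φ hv
    have hφ := hv.isTest.contDiff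
    have hd := hφ.differentiable (by simp)
    -- For a test function the chain rule turns g(φ)∇φ into the gradient of G ∘ φ, which is C¹ with
    -- compact support, so the identity is the divergence theorem.
    have hgr : ∀ x, gradient (fun y => G (φ y)) x = g (φ x) • gradient φ x := fun x =>
      (hasGradientAt_comp (h.deriv _) (hd x)).gradient
    have hG : ContDiff ℝ 1 G := by
      rw [contDiff_one_iff_deriv]
      refine ⟨fun r => (h.deriv r).differentiableAt, ?_⟩
      rw [show _root_.deriv G = g from funext fun r => (h.deriv r).deriv]
      exact h.lip.continuous
    have hc : HasCompactSupport fun x => G (φ x) := hv.isTest.compact.comp_left h.prim_zero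
    have main := integral_inner_gradient hX (hG.comp (hφ.of_le (by norm_cast))) hc
    rw [inner_mulOp (memLp_top_of_continuous hΩ ho.measurableSet
      (continuous_innerSL hX.continuous)), potential]
    have l1 : ∫ x in Ω, inner ℝ (innerSL ℝ (X x) (gradH v x)) (h.comp (toL2 v) x) =
        ∫ x in Ω, inner ℝ (X x) (gradient (fun y => G (φ y)) x) := by
      apply integral_congr_ae
      filter_upwards [hv.coe, hv.grad, h.comp_coe (toL2 v)] with x h1 h2 h3
      rw [h3, h1, h2, hgr, inner_smul_right]
      simp
    have l2 : ∫ x in Ω, dv (fderiv ℝ X x) * G (toL2 v x) =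
        ∫ x in Ω, dv (fderiv ℝ X x) * G (φ x) := by
      apply integral_congr_ae
      filter_upwards [hv.coe] with x h1
      rw [h1]
    rw [l1, l2, setIntegral_eq_of_tsupport hv.isTest.subset, setIntegral_eq_of_tsupport
      hv.isTest.subset]
    · exact main
    · intro x hx
      rw [image_eq_zero_of_notMem_tsupport hx, h.prim_zero, mul_zero]
    · intro x hx
      rw [hgr, gradient_eq_zero_of_notMem hx, smul_zero, inner_zero_right]

theorem contDiff_gradient {φ : E3 → ℝ} (h : ContDiff ℝ ∞ φ) : ContDiff ℝ ∞ (gradient φ) :=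
  (InnerProductSpace.toDual ℝ E3).symm.toContinuousLinearEquiv.contDiff.comp
    (h.fderiv_right (by simp))

theorem dv_fderiv_gradient {φ : E3 → ℝ} (h : ContDiff ℝ ∞ φ) (x : E3) :
    dv (fderiv ℝ (gradient φ) x) = Laplacian.laplacian φ x := by
  rw [InnerProductSpace.laplacian_eq_iteratedFDeriv_orthonormalBasis φ
    (EuclideanSpace.basisFun (Fin 3) ℝ)]
  simp only [dv, EuclideanSpace.basisFun_apply]
  refine Finset.sum_congr rfl fun i _ => ?_
  rw [iteratedFDeriv_two_apply]
  have h1 : ∀ y, gradient φ y i = fderiv ℝ φ y (EuclideanSpace.single i 1) := by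
    intro y
    rw [← inner_gradient_left, EuclideanSpace.inner_single_right]
    simp
  have h2 : HasFDerivAt (fun y => gradient φ y i)
      ((EuclideanSpace.proj i).comp (fderiv ℝ (gradient φ) x)) x :=
    (EuclideanSpace.proj i : E3 →L[ℝ] ℝ).hasFDerivAt.comp x
      (((contDiff_gradient h).differentiable (by simp)) x).hasFDerivAt
  simp only [h1] at h2
  have h3 : DifferentiableAt ℝ (fderiv ℝ φ) x :=
    (h.fderiv_right (m := 1) (by norm_cast)).differentiable (by simp) x
  have h4 := h3.hasFDerivAt.clm_apply (hasFDerivAt_const (EuclideanSpace.single i (1 : ℝ)) x)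
  have h5 := congrArg (fun L => L (EuclideanSpace.single i (1 : ℝ))) (h2.unique h4)
  simpa using h5

/-- Both sides are L²-pairings of v and ∇v with fixed vectors, hence continuous in v, and for a test
function this is the divergence theorem with the field ∇φ. -/
theorem integral_mul_laplacian {φ : E3 → ℝ} (hφ : IsTest Ω φ) (v : H10 Ω) :
    ∫ x in Ω, toL2 v x * Laplacian.laplacian φ x =
      - ∫ x in Ω, inner ℝ (gradH v x) (gradient φ x) := by
  have hL : MemLp (fun x => dv (fderiv ℝ (gradient φ) x)) 2 (volume.restrict Ω) := by
    refine MemLp.restrict Ω (Continuous.memLp_of_hasCompactSupport ?_ ?_)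
    · exact continuous_dv_fderiv ((contDiff_gradient hφ.contDiff).of_le (by norm_cast))
    · refine HasCompactSupport.intro hφ.compact fun x hx => ?_
      have : fderiv ℝ (gradient φ) x = 0 := by
        by_contra h0
        have h1 := support_fderiv_subset ℝ (Function.mem_support.2 h0)
        refine hx (closure_minimal (fun y hy => ?_) (isClosed_tsupport φ) h1)
        by_contra h2
        exact hy (gradient_eq_zero_of_notMem h2)
      rw [this]
      simp [dv]
  have e1 : ∀ v : H10 Ω, ∫ x in Ω, toL2 v x * Laplacian.laplacian φ x =
      inner ℝ (hL.toLp _) (toL2 v) := by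
    intro v
    rw [L2.inner_def]
    apply integral_congr_ae
    filter_upwards [hL.coeFn_toLp] with x hx
    rw [hx, dv_fderiv_gradient hφ.contDiff]
    simp
  have e2 : ∀ v : H10 Ω, ∫ x in Ω, inner ℝ (gradH v x) (gradient φ x) =
      inner ℝ (gradH v) ((hφ.memLp_gradient 2).toLp _) := by
    intro v
    rw [L2.inner_def]
    apply integral_congr_ae
    filter_upwards [(hφ.memLp_gradient 2).coeFn_toLp] with x hx
    rw [hx]
  rw [e1, e2]
  revert v
  apply H10.induction
  · exact isClosed_eq (continuous_const.inner continuous_toL2)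
      (continuous_gradH.inner continuous_const).neg
  · intro v ψ hv
    rw [← e1, ← e2]
    have h1 : ∫ x in Ω, toL2 v x * Laplacian.laplacian φ x =
        ∫ x in Ω, dv (fderiv ℝ (gradient φ) x) * ψ x := by
      apply integral_congr_ae
      filter_upwards [hv.coe] with x hx
      rw [hx, dv_fderiv_gradient hφ.contDiff, mul_comm]
    have h2 : ∫ x in Ω, inner ℝ (gradH v x) (gradient φ x) =
        ∫ x in Ω, inner ℝ (gradient φ x) (gradient ψ x) := by
      apply integral_congr_ae
      filter_upwards [hv.grad] with x hx
      rw [hx, real_inner_comm]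
    rw [h1, h2, setIntegral_eq_of_tsupport hv.isTest.subset, setIntegral_eq_of_tsupport
      hv.isTest.subset, integral_inner_gradient
        ((contDiff_gradient hφ.contDiff).of_le (by norm_cast))
        (hv.isTest.contDiff.of_le (by norm_cast)) hv.isTest.compact, neg_neg]
    · intro x hx
      rw [gradient_eq_zero_of_notMem hx, inner_zero_right]
    · intro x hx
      rw [image_eq_zero_of_notMem_tsupport hx, mul_zero]

/-- The Sobolev embedding `H¹₀(Ω) ⊂ L⁶(Ω)`. -/
theorem sobolev (Ω : Set E3) : ∃ C : NNReal, ∀ v : H10 Ω,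
    eLpNorm (toL2 v) 6 (volume.restrict Ω) ≤ C * eLpNorm (gradH v) 2 (volume.restrict Ω) := by
  let C : NNReal := eLpNormLESNormFDerivOfEqInnerConst (volume : Measure E3) 2
  have key : ∀ v φ, Represents (Ω := Ω) v φ → eLpNorm (toL2 v) 6 (volume.restrict Ω) ≤
      C * eLpNorm (gradH v) 2 (volume.restrict Ω) := by
    intro v φ hv
    rw [eLpNorm_congr_ae hv.coe, eLpNorm_congr_ae hv.grad]
    have h1 := eLpNorm_le_eLpNorm_fderiv_of_eq_inner (volume : Measure E3) (p := 2) (p' := 6)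
      (hv.isTest.contDiff.of_le (by norm_cast)) hv.isTest.compact (by norm_num)
      (by simp) (by simp; norm_num)
    have h2 : eLpNorm (fderiv ℝ φ) 2 volume = eLpNorm (gradient φ) 2 (volume.restrict Ω) := by
      rw [eLpNorm_restrict_eq_of_support_subset]
      · refine eLpNorm_congr_norm_ae (Eventually.of_forall fun x => ?_)
        simp [gradient]
      · intro x hx
        by_contra h
        exact hx (gradient_eq_zero_of_notMem fun h' => h (hv.isTest.subset h'))
    calc eLpNorm φ 6 (volume.restrict Ω) ≤ eLpNorm φ 6 volume := eLpNorm_restrict_le ..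
      _ ≤ _ := h1
      _ = _ := by rw [← h2]; rfl
  refine ⟨C, fun v => ?_⟩
  -- The approximating test functions converge in L², hence a.e. along a subsequence. The L⁶ norm is
  -- lower semicontinuous under a.e. convergence, and the gradient norms converge.
  obtain ⟨w, hw, hlim⟩ := mem_closure_iff_seq_limit.1 (dense_represented v)
  have hl2 : Tendsto (fun n => toL2 (w n)) atTop (𝓝 (toL2 v)) := (continuous_toL2.tendsto v).comp hlim
  have hlg : Tendsto (fun n => gradH (w n)) atTop (𝓝 (gradH v)) :=
    (continuous_gradH.tendsto v).comp hlim
  obtain ⟨ns, hns, hae⟩ := (tendstoInMeasure_of_tendsto_Lp hl2).exists_seq_tendsto_ae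
  have h1 := Lp.eLpNorm_lim_le_liminf_eLpNorm (p := 6)
    (fun n => (Lp.aestronglyMeasurable (toL2 (w (ns n))))) (toL2 v) hae
  refine h1.trans ?_
  have h2 : Tendsto (fun n => (C : ENNReal) * eLpNorm (gradH (w (ns n))) 2 (volume.restrict Ω)) atTop
      (𝓝 (C * eLpNorm (gradH v) 2 (volume.restrict Ω))) := by
    refine ENNReal.Tendsto.const_mul ?_ (Or.inr ENNReal.coe_ne_top)
    have h3 := ((continuous_enorm.tendsto _).comp hlg).comp hns.tendsto_atTop
    simpa only [Lp.enorm_def, Function.comp_def] using h3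
  rw [← h2.liminf_eq]
  refine liminf_le_liminf (Eventually.of_forall fun n => ?_)
  obtain ⟨φ, hφ⟩ := hw (ns n)
  exact key _ φ hφ

end

/-! ### Strong convergence of operators and composition with maps of ℝ³. -/

section

/-- A family of uniformly bounded operators that converges to `0` on a dense set converges
strongly to `0`. -/
theorem tendsto_zero_of_dense {ι G H : Type*} [NormedAddCommGroup G] [NormedSpace ℝ G]
    [NormedAddCommGroup H] [NormedSpace ℝ H] {l : Filter ι} {T : ι → G → H} {M : ℝ}
    (hT : ∀ i v w, T i (v + w) = T i v + T i w)
    (hM : ∀ᶠ i in l, ∀ v, ‖T i v‖ ≤ M * ‖v‖) {D : Set G} (hD : Dense D)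
    (h : ∀ d ∈ D, Tendsto (fun i => T i d) l (𝓝 0)) (v : G) :
    Tendsto (fun i => T i v) l (𝓝 0) := by
  rw [Metric.tendsto_nhds]
  intro ε hε
  obtain ⟨d, hd, hvd⟩ := Metric.dense_iff.1 hD v (ε / 2 / (|M| + 1)) (by positivity)
  have h1 := (Metric.tendsto_nhds.1 (h d hvd) (ε / 2) (half_pos hε))
  filter_upwards [h1, hM] with i hi1 hi2
  rw [dist_zero_right] at hi1 ⊢
  have h2 : T i v = T i (v - d) + T i d := by rw [← hT, sub_add_cancel]
  have h3 : ‖T i (v - d)‖ ≤ ε / 2 := by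
    refine (hi2 _).trans ?_
    have h4 : ‖v - d‖ ≤ ε / 2 / (|M| + 1) := by
      rw [← dist_eq_norm, dist_comm]
      exact (Metric.mem_ball.1 hd).le
    calc M * ‖v - d‖ ≤ (|M| + 1) * (ε / 2 / (|M| + 1)) :=
          mul_le_mul ((le_abs_self M).trans (by linarith)) h4 (norm_nonneg _) (by positivity)
      _ = ε / 2 := by field_simp
  rw [h2]
  exact (norm_add_le _ _).trans_lt (by linarith)

/-- Dominated convergence in `L²` of a set of finite measure. -/
theorem tendsto_L2_of_dominated {α E : Type*} [MeasurableSpace α] {μ : Measure α}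
    [NormedAddCommGroup E] [InnerProductSpace ℝ E] {ι : Type*} {l : Filter ι}
    [l.IsCountablyGenerated] {F : ι → Lp E 2 μ} {f : Lp E 2 μ} {F' : ι → α → E} {f' : α → E}
    (hF : ∀ᶠ i in l, F i =ᵐ[μ] F' i) (hf : f =ᵐ[μ] f') {B : α → ℝ}
    (hB : Integrable (fun x => B x ^ 2) μ)
    (hb : ∀ᶠ i in l, ∀ᵐ x ∂μ, ‖F' i x - f' x‖ ≤ B x)
    (h : ∀ᵐ x ∂μ, Tendsto (fun i => F' i x) l (𝓝 (f' x))) : Tendsto F l (𝓝 f) := by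
  rw [tendsto_iff_norm_sub_tendsto_zero]
  have h1 : ∀ᶠ i in l, ∫ x, ‖F' i x - f' x‖ ^ 2 ∂μ = ‖F i - f‖ ^ 2 := by
    filter_upwards [hF] with i hi
    rw [← real_inner_self_eq_norm_sq, L2.inner_def]
    apply integral_congr_ae
    filter_upwards [Lp.coeFn_sub (F i) f, hi, hf] with x hx hx1 hx2
    rw [hx, real_inner_self_eq_norm_sq, Pi.sub_apply, hx1, hx2]
  have h2 : Tendsto (fun i => ‖F i - f‖ ^ 2) l (𝓝 0) := by
    have : Tendsto (fun i => ∫ x, ‖F' i x - f' x‖ ^ 2 ∂μ) l (𝓝 (∫ _, (0 : ℝ) ∂μ)) := by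
      refine tendsto_integral_filter_of_dominated_convergence (fun x => B x ^ 2) ?_ ?_
        hB ?_
      · filter_upwards [hF] with i hi
        exact ((((Lp.aestronglyMeasurable (F i)).congr hi).sub
          ((Lp.aestronglyMeasurable f).congr hf)).norm.pow 2)
      · filter_upwards [hb] with i hi
        filter_upwards [hi] with x hx
        rw [norm_pow, norm_norm]
        gcongr
      · filter_upwards [h] with x hx
        simpa using ((hx.sub_const (f' x)).norm.pow 2)
    rw [integral_zero] at this
    exact this.congr' h1
  have h3 := h2.sqrt
  simpa [Real.sqrt_sq (norm_nonneg _)] using h3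

theorem tendsto_L2_of_bounded {α E : Type*} [MeasurableSpace α] {μ : Measure α}
    [IsFiniteMeasure μ] [NormedAddCommGroup E] [InnerProductSpace ℝ E] {ι : Type*} {l : Filter ι}
    [l.IsCountablyGenerated] {F : ι → Lp E 2 μ} {f : Lp E 2 μ} {F' : ι → α → E} {f' : α → E}
    (hF : ∀ᶠ i in l, F i =ᵐ[μ] F' i) (hf : f =ᵐ[μ] f') (B : ℝ)
    (hb : ∀ᶠ i in l, ∀ᵐ x ∂μ, ‖F' i x - f' x‖ ≤ B)
    (h : ∀ᵐ x ∂μ, Tendsto (fun i => F' i x) l (𝓝 (f' x))) : Tendsto F l (𝓝 f) :=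
  tendsto_L2_of_dominated hF hf (B := fun _ => B) (integrable_const _) hb h

/-- Continuous maps of `ℝ³` such that composition with them is bounded on `L¹`. -/
structure BoundedComp (Φ : E3 → E3) : Prop where
  cont : Continuous Φ
  le : ∀ h : E3 → ENNReal, ∫⁻ x, h (Φ x) ≤ 2 * ∫⁻ x, h x

/-- The L¹ bound applied to the indicator of a null set shows that its preimage is null, so
composition is well defined on a.e. classes. -/
theorem BoundedComp.quasi {Φ : E3 → E3} (hΦ : BoundedComp Φ) :
    Measure.QuasiMeasurePreserving Φ volume volume := by
  refine ⟨hΦ.cont.measurable, Measure.AbsolutelyContinuous.mk fun s hs h0 => ?_⟩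
  rw [Measure.map_apply hΦ.cont.measurable hs]
  have h1 := hΦ.le (s.indicator 1)
  rw [lintegral_indicator_one hs, h0, mul_zero] at h1
  have h2 : ∫⁻ x, s.indicator 1 (Φ x) = volume (Φ ⁻¹' s) := by
    rw [← lintegral_indicator_one (hΦ.cont.measurable hs)]
    rfl
  rw [← h2]
  exact le_antisymm h1 bot_le

section CompOp

variable {E : Type*} [NormedAddCommGroup E] [InnerProductSpace ℝ E] {Ω : Set E3}

theorem indicator_ae_congr {E : Type*} [NormedAddCommGroup E] (hm : MeasurableSet Ω) {w v : E3 → E}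
    (h : w =ᵐ[volume.restrict Ω] v) : Ω.indicator w =ᵐ[volume] Ω.indicator v := by
  filter_upwards [(ae_restrict_iff' hm).1 h] with x hx
  by_cases hxΩ : x ∈ Ω
  · simp [hxΩ, hx hxΩ]
  · simp [hxΩ]

theorem BoundedComp.lintegral_sq_le {E : Type*} [NormedAddCommGroup E] {Φ : E3 → E3} (hΦ : BoundedComp Φ) (hm : MeasurableSet Ω)
    (w : Lp E 2 (volume.restrict Ω)) :
    ∫⁻ x in Ω, ‖Ω.indicator w (Φ x)‖ₑ ^ 2 ≤ 2 * ∫⁻ x in Ω, ‖w x‖ₑ ^ 2 := by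
  calc ∫⁻ x in Ω, ‖Ω.indicator w (Φ x)‖ₑ ^ 2 ≤ ∫⁻ x, ‖Ω.indicator w (Φ x)‖ₑ ^ 2 :=
        setLIntegral_le_lintegral _ _
    _ ≤ 2 * ∫⁻ x, ‖Ω.indicator w x‖ₑ ^ 2 := hΦ.le fun y => ‖Ω.indicator w y‖ₑ ^ 2
    _ = _ := by
        congr 1
        rw [← lintegral_indicator hm]
        refine lintegral_congr fun x => ?_
        by_cases hx : x ∈ Ω <;> simp [hx]

theorem BoundedComp.memLp {E : Type*} [NormedAddCommGroup E] {Φ : E3 → E3} (hΦ : BoundedComp Φ) (hm : MeasurableSet Ω)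
    (w : Lp E 2 (volume.restrict Ω)) :
    MemLp (fun x => Ω.indicator w (Φ x)) 2 (volume.restrict Ω) := by
  refine ⟨?_, ?_⟩
  · have h1 : AEStronglyMeasurable (Ω.indicator w) volume :=
      (aestronglyMeasurable_indicator_iff hm).2 (Lp.aestronglyMeasurable w)
    exact (h1.comp_quasiMeasurePreserving hΦ.quasi).restrict
  · have h2 : ∫⁻ x in Ω, ‖w x‖ₑ ^ 2 < ⊤ := by
      have := lintegral_rpow_enorm_lt_top_of_eLpNorm_lt_top two_ne_zero ENNReal.ofNat_ne_top
        (Lp.eLpNorm_lt_top w)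
      simpa using this
    rw [eLpNorm_lt_top_iff_lintegral_rpow_enorm_lt_top two_ne_zero ENNReal.ofNat_ne_top]
    have := (hΦ.lintegral_sq_le hm w).trans_lt (ENNReal.mul_lt_top ENNReal.ofNat_lt_top h2)
    simpa using this

theorem BoundedComp.ae_congr {E : Type*} [NormedAddCommGroup E] {Φ : E3 → E3} (hΦ : BoundedComp Φ) (hm : MeasurableSet Ω)
    {w v : E3 → E} (h : w =ᵐ[volume.restrict Ω] v) :
    (fun x => Ω.indicator w (Φ x)) =ᵐ[volume.restrict Ω] fun x => Ω.indicator v (Φ x) :=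
  ae_restrict_of_ae (hΦ.quasi.ae_eq (indicator_ae_congr hm h))

theorem norm_sq_eq_integral {α : Type*} [MeasurableSpace α] {μ : Measure α} (w : Lp E 2 μ) :
    ‖w‖ ^ 2 = ∫ x, ‖w x‖ ^ 2 ∂μ := by
  rw [← real_inner_self_eq_norm_sq, L2.inner_def]
  simp

theorem integrable_norm_sq {α : Type*} [MeasurableSpace α] {μ : Measure α} (w : Lp E 2 μ) :
    Integrable (fun x => ‖w x‖ ^ 2) μ := by
  simpa [real_inner_self_eq_norm_sq] using L2.integrable_inner (𝕜 := ℝ) w w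

theorem ofReal_norm_sq {α : Type*} [MeasurableSpace α] {μ : Measure α} (w : Lp E 2 μ) :
    ENNReal.ofReal (‖w‖ ^ 2) = ∫⁻ x, ‖w x‖ₑ ^ 2 ∂μ := by
  rw [norm_sq_eq_integral, ofReal_integral_eq_lintegral_ofReal (integrable_norm_sq w)
    (Eventually.of_forall fun x => by positivity)]
  refine lintegral_congr fun x => ?_
  rw [ENNReal.ofReal_pow (norm_nonneg _), ofReal_norm]

theorem BoundedComp.norm_toLp_le {Φ : E3 → E3} (hΦ : BoundedComp Φ) (hm : MeasurableSet Ω)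
    (w : Lp E 2 (volume.restrict Ω)) : ‖(hΦ.memLp hm w).toLp _‖ ≤ 2 * ‖w‖ := by
  rw [← sq_le_sq₀ (norm_nonneg _) (by positivity), mul_pow]
  have h1 := hΦ.lintegral_sq_le hm w
  rw [← ofReal_norm_sq] at h1
  have h2 : ENNReal.ofReal (‖(hΦ.memLp hm w).toLp _‖ ^ 2) ≤ 2 * ENNReal.ofReal (‖w‖ ^ 2) := by
    refine le_trans (le_of_eq ?_) h1
    rw [ofReal_norm_sq]
    refine lintegral_congr_ae ?_
    filter_upwards [(hΦ.memLp hm w).coeFn_toLp] with x hx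
    rw [hx]
  have e2 : 2 * ENNReal.ofReal (‖w‖ ^ 2) = ENNReal.ofReal (2 * ‖w‖ ^ 2) := by
    rw [ENNReal.ofReal_mul (by norm_num), ENNReal.ofReal_ofNat]
  rw [e2, ENNReal.ofReal_le_ofReal_iff (by positivity)] at h2
  -- The bound obtained is √2; the constant 2 is kept for convenience.
  exact h2.trans (by nlinarith [sq_nonneg ‖w‖])

open Classical in
/-- Composition with `Φ` of functions extended by zero outside `Ω`. -/
def compOp (Ω : Set E3) (Φ : E3 → E3) :
    CLM (Lp E 2 (volume.restrict Ω)) (Lp E 2 (volume.restrict Ω)) :=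
  if h : BoundedComp Φ ∧ MeasurableSet Ω then
    LinearMap.mkContinuous
      { toFun := fun w => (h.1.memLp h.2 w).toLp _
        map_add' := fun v w => by
          rw [← MemLp.toLp_add]
          refine MemLp.toLp_congr _ _ ?_
          filter_upwards [h.1.ae_congr h.2 (Lp.coeFn_add v w)] with x hx
          rw [hx, indicator_add']
          rfl
        map_smul' := fun c w => by
          rw [RingHom.id_apply, ← MemLp.toLp_const_smul]
          refine MemLp.toLp_congr _ _ ?_
          filter_upwards [h.1.ae_congr h.2 (Lp.coeFn_smul c w)] with x hx
          rw [hx, Pi.smul_apply]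
          by_cases hx' : Φ x ∈ Ω <;> simp [hx'] } 2
      (fun w => h.1.norm_toLp_le h.2 w)
  else 0

theorem compOp_coe {Φ : E3 → E3} (hΦ : BoundedComp Φ) (hm : MeasurableSet Ω)
    (w : Lp E 2 (volume.restrict Ω)) :
    compOp Ω Φ w =ᵐ[volume.restrict Ω] fun x => Ω.indicator w (Φ x) := by
  rw [compOp, dif_pos ⟨hΦ, hm⟩]
  exact (hΦ.memLp hm w).coeFn_toLp

theorem norm_compOp_le (Φ : E3 → E3) (w : Lp E 2 (volume.restrict Ω)) :
    ‖compOp Ω Φ w‖ ≤ 2 * ‖w‖ := by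
  by_cases h : BoundedComp Φ ∧ MeasurableSet Ω
  · refine (compOp Ω Φ).le_of_opNorm_le ?_ w
    rw [compOp, dif_pos h]
    exact LinearMap.mkContinuous_norm_le _ (by norm_num) _
  · rw [compOp, dif_neg h, _root_.zero_apply, norm_zero]
    positivity

end CompOp

end

/-! ### The maps x ↦ x - σX(x): Jacobian, injectivity and change of variables. -/

section

/-- The map `x ↦ x - σ X(x)`. -/
def shift (X : E3 → E3) (σ : ℝ) (x : E3) : E3 := x - σ • X x

/-- The Jacobian matrix of `shift X σ`. -/
def shiftDeriv (X : E3 → E3) (σ : ℝ) (x : E3) : E3 →L[ℝ] E3 :=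
  ContinuousLinearMap.id ℝ E3 - σ • fderiv ℝ X x

/-- The second order part of `det (1 - σ B)`. -/
def detRemainder (p : ℝ × (E3 →L[ℝ] E3)) : ℝ :=
  let b : Fin 3 → Fin 3 → ℝ := fun i j => p.2 (EuclideanSpace.single j 1) i
  (b 0 0 * b 1 1 - b 0 1 * b 1 0 + b 0 0 * b 2 2 - b 0 2 * b 2 0 + b 1 1 * b 2 2 - b 1 2 * b 2 1)
    - p.1 * (b 0 0 * b 1 1 * b 2 2 - b 0 0 * b 1 2 * b 2 1 - b 0 1 * b 1 0 * b 2 2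
      + b 0 1 * b 1 2 * b 2 0 + b 0 2 * b 1 0 * b 2 1 - b 0 2 * b 1 1 * b 2 0)

theorem continuous_detRemainder : Continuous detRemainder := by
  unfold detRemainder
  fun_prop

/-- The characteristic polynomial in dimension three: the coefficient of -σ is the trace, and
`detRemainder` collects the second elementary symmetric function minus σ det B. -/
theorem det_id_sub_smul (B : E3 →L[ℝ] E3) (σ : ℝ) :
    (ContinuousLinearMap.id ℝ E3 - σ • B).det = 1 - σ * dv B + σ ^ 2 * detRemainder (σ, B) := by
  have h := LinearMap.det_toMatrix (EuclideanSpace.basisFun (Fin 3) ℝ).toBasis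
    ((ContinuousLinearMap.id ℝ E3 - σ • B : E3 →L[ℝ] E3) : E3 →ₗ[ℝ] E3)
  rw [ContinuousLinearMap.det, ← h, Matrix.det_fin_three]
  simp only [LinearMap.toMatrix_apply, OrthonormalBasis.coe_toBasis_repr_apply,
    OrthonormalBasis.coe_toBasis, EuclideanSpace.basisFun_repr, EuclideanSpace.basisFun_apply,
    ContinuousLinearMap.coe_coe, _root_.sub_apply, _root_.smul_apply, PiLp.sub_apply,
    PiLp.smul_apply, smul_eq_mul, ContinuousLinearMap.id_apply, detRemainder, dv,
    Fin.sum_univ_three, PiLp.single_apply]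
  simp
  ring

theorem hasFDerivAt_shift {X : E3 → E3} (hX : Differentiable ℝ X) (σ : ℝ) (x : E3) :
    HasFDerivAt (shift X σ) (shiftDeriv X σ x) x :=
  (hasFDerivAt_id x).sub ((hX x).hasFDerivAt.const_smul σ)

theorem exists_fderiv_bound {X : E3 → E3} (hX : ContDiff ℝ 1 X) (hc : HasCompactSupport X) :
    ∃ L : NNReal, LipschitzWith L X ∧ ∀ x, ‖fderiv ℝ X x‖ ≤ L := by
  obtain ⟨L, hL⟩ := hX.lipschitzWith_of_hasCompactSupport hc (by simp)
  exact ⟨L, hL, fun x => norm_fderiv_le_of_lipschitz ℝ hL⟩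

theorem exists_jacobian_bound {X : E3 → E3} (hX : ContDiff ℝ 1 X) (hc : HasCompactSupport X) :
    ∃ σ₀ ∈ Ioc (0 : ℝ) 1, ∃ C, 0 ≤ C ∧ ∀ σ ∈ Icc 0 σ₀, Function.Injective (shift X σ) ∧
      ∀ x, 1 / 2 ≤ (shiftDeriv X σ x).det ∧
        1 - σ * dv (fderiv ℝ X x) - C * σ ^ 2 ≤ (shiftDeriv X σ x).det := by
  obtain ⟨L, hL, hL'⟩ := exists_fderiv_bound hX hc
  obtain ⟨C, hC⟩ := (isCompact_Icc.prod (isCompact_closedBall (0 : E3 →L[ℝ] E3) L)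
    (s := Icc (0 : ℝ) 1)).exists_bound_of_continuousOn continuous_detRemainder.continuousOn
  obtain ⟨M, hM⟩ := (isCompact_closedBall (0 : E3 →L[ℝ] E3) L).exists_bound_of_continuousOn
    continuous_dv.continuousOn
  have hC0 : 0 ≤ |C| := abs_nonneg C
  have hM0 : 0 ≤ |M| := abs_nonneg M
  -- With σ ≤ 1/N the quantities σ|C|, σ|M| and σL add up to at most 1/2. The last makes the shift
  -- injective, since σX is then a contraction; the first two keep the determinant above 1/2.
  set N := 2 * (|C| + |M| + L) + 1 with hN
  have hN1 : 1 ≤ N := by have := L.2; linarith [L.2]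
  refine ⟨1 / N, ⟨by positivity, by rw [div_le_one (by positivity)]; exact hN1⟩, |C|, hC0,
    fun σ hσ => ?_⟩
  have hσN : σ * N ≤ 1 := by
    have := hσ.2
    rwa [le_div_iff₀ (by positivity)] at this
  have hσ0 := hσ.1
  have hσ1 : σ ≤ 1 := by nlinarith
  have hσL : 0 ≤ σ * L := mul_nonneg hσ0 L.2
  have hσC : 0 ≤ σ * |C| := mul_nonneg hσ0 hC0
  have hσM : 0 ≤ σ * |M| := mul_nonneg hσ0 hM0
  have hsum : 2 * (σ * |C| + σ * |M| + σ * L) + σ ≤ 1 := by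
    rw [hN] at hσN; linarith
  constructor
  · intro x y hxy
    by_contra hne
    have h1 : 0 < ‖x - y‖ := norm_pos_iff.2 (sub_ne_zero.2 hne)
    have h2 : x - y = σ • (X x - X y) := by
      have : x - σ • X x = y - σ • X y := hxy
      rw [smul_sub]
      rw [sub_eq_sub_iff_add_eq_add] at this ⊢
      rw [add_comm (σ • X x), ← this]
    have h3 : ‖x - y‖ ≤ σ * (L * ‖x - y‖) := by
      conv_lhs => rw [h2]
      rw [norm_smul, Real.norm_of_nonneg hσ0]
      exact mul_le_mul_of_nonneg_left (hL.norm_sub_le x y) hσ0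
    nlinarith
  · intro x
    have hB : fderiv ℝ X x ∈ Metric.closedBall (0 : E3 →L[ℝ] E3) L := by
      rw [mem_closedBall_zero_iff]; exact hL' x
    have h1 := hC (σ, fderiv ℝ X x) ⟨⟨hσ0, hσ1⟩, hB⟩
    have h2 := hM _ hB
    rw [Real.norm_eq_abs] at h1 h2
    have h1' := (abs_le.1 (h1.trans (le_abs_self C))).1
    have h2' := (abs_le.1 (h2.trans (le_abs_self M))).2
    rw [shiftDeriv, det_id_sub_smul]
    have h3 : σ * dv (fderiv ℝ X x) ≤ σ * |M| := mul_le_mul_of_nonneg_left h2' hσ0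
    have h4 : σ ^ 2 * (-|C|) ≤ σ ^ 2 * detRemainder (σ, fderiv ℝ X x) :=
      mul_le_mul_of_nonneg_left h1' (sq_nonneg σ)
    have h5 : σ ^ 2 * |C| ≤ σ * |C| := by nlinarith
    constructor <;> nlinarith

/-- Change of variables on an injective image. Surjectivity of the shift is not needed, because
extending a nonnegative integral from the image to the whole space only increases it. -/
theorem lintegral_det_mul_le {X : E3 → E3} (hX : Differentiable ℝ X) {σ : ℝ}
    (hi : Function.Injective (shift X σ)) (h : E3 → ENNReal) :
    ∫⁻ x, ENNReal.ofReal (shiftDeriv X σ x).det * h (shift X σ x) ≤ ∫⁻ x, h x := by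
  have h1 := lintegral_image_eq_lintegral_abs_det_fderiv_mul volume MeasurableSet.univ
    (fun x _ => (hasFDerivAt_shift hX σ x).hasFDerivWithinAt) hi.injOn h
  rw [Measure.restrict_univ] at h1
  calc _ ≤ ∫⁻ x, ENNReal.ofReal |(shiftDeriv X σ x).det| * h (shift X σ x) :=
        lintegral_mono fun x => mul_le_mul' (ENNReal.ofReal_le_ofReal (le_abs_self _)) le_rfl
    _ = ∫⁻ x in shift X σ '' univ, h x := h1.symm
    _ ≤ _ := setLIntegral_le_lintegral _ _

theorem boundedComp_shift {X : E3 → E3} (hX : Differentiable ℝ X) {σ : ℝ}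
    (hi : Function.Injective (shift X σ)) (hJ : ∀ x, 1 / 2 ≤ (shiftDeriv X σ x).det) :
    BoundedComp (shift X σ) := by
  refine ⟨?_, fun h => ?_⟩
  · unfold shift
    exact continuous_id.sub (hX.continuous.const_smul σ)
  · calc ∫⁻ x, h (shift X σ x)
        ≤ ∫⁻ x, 2 * (ENNReal.ofReal (shiftDeriv X σ x).det * h (shift X σ x)) := by
          refine lintegral_mono fun x => ?_
          rw [← mul_assoc]
          refine le_mul_of_one_le_left' ?_
          have h2 : ENNReal.ofReal (1 / 2) ≤ ENNReal.ofReal (shiftDeriv X σ x).det :=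
            ENNReal.ofReal_le_ofReal (hJ x)
          calc (1 : ENNReal) = 2 * ENNReal.ofReal (1 / 2) := by
                rw [← ENNReal.ofReal_ofNat 2, ← ENNReal.ofReal_mul (by norm_num)]
                norm_num
            _ ≤ _ := by gcongr
      _ = 2 * ∫⁻ x, ENNReal.ofReal (shiftDeriv X σ x).det * h (shift X σ x) :=
          lintegral_const_mul' _ _ ENNReal.ofNat_ne_top
      _ ≤ _ := mul_le_mul' le_rfl (lintegral_det_mul_le hX hi h)

end

/-! ### Domain variations along pushing fields and the one-sided Rellich inequality. -/

section

/-- Smooth compactly supported fields whose backward translations preserve the complement of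
`Ω`. -/
structure IsPushing (Ω : Set E3) (X : E3 → E3) : Prop where
  smooth : ContDiff ℝ ∞ X
  compact : HasCompactSupport X
  push : ∀ σ ∈ Icc (0 : ℝ) 1, ∀ y ∉ Ω, shift X σ y ∉ Ω

variable {Ω : Set E3} {X : E3 → E3}

theorem IsPushing.contDiff_one (h : IsPushing Ω X) : ContDiff ℝ 1 X :=
  h.smooth.of_le (by norm_cast)

theorem IsPushing.differentiable (h : IsPushing Ω X) : Differentiable ℝ X :=
  h.smooth.differentiable (by simp)

/-- The operator `ξ ↦ (DX)ᵀ ξ`. -/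
abbrev adjOp (Ω : Set E3) (X : E3 → E3) : CLM (L2Vec Ω) (L2Vec Ω) :=
  mulOp (volume.restrict Ω) fun x => ContinuousLinearMap.adjoint (fderiv ℝ X x)

theorem continuous_adjoint_fderiv (hX : ContDiff ℝ 1 X) :
    Continuous fun x => ContinuousLinearMap.adjoint (fderiv ℝ X x) :=
  (ContinuousLinearMap.adjoint (𝕜 := ℝ) (E := E3) (F := E3)).continuous.comp
    (hX.continuous_fderiv (by simp))

theorem indicator_represents (ho : IsOpen Ω) {v : H10 Ω} {φ : E3 → ℝ} (hv : Represents v φ)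
    {Φ : E3 → E3} (hΦ : BoundedComp Φ) :
    compOp Ω Φ (toL2 v) =ᵐ[volume.restrict Ω] fun x => φ (Φ x) := by
  filter_upwards [compOp_coe hΦ ho.measurableSet (toL2 v),
    hΦ.ae_congr ho.measurableSet hv.coe] with x h1 h2
  rw [h1, h2]
  by_cases h : Φ x ∈ Ω
  · simp [h]
  · rw [indicator_of_notMem h, image_eq_zero_of_notMem_tsupport fun h' => h (hv.isTest.subset h')]

theorem indicator_represents_grad (ho : IsOpen Ω) {v : H10 Ω} {φ : E3 → ℝ}
    (hv : Represents v φ) {Φ : E3 → E3} (hΦ : BoundedComp Φ) :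
    compOp Ω Φ (gradH v) =ᵐ[volume.restrict Ω] fun x => gradient φ (Φ x) := by
  filter_upwards [compOp_coe hΦ ho.measurableSet (gradH v),
    hΦ.ae_congr ho.measurableSet hv.grad] with x h1 h2
  rw [h1, h2]
  by_cases h : Φ x ∈ Ω
  · simp [h]
  · rw [indicator_of_notMem h, gradient_eq_zero_of_notMem fun h' => h (hv.isTest.subset h')]

theorem gradient_comp_shift {φ : E3 → ℝ} (hφ : Differentiable ℝ φ) (hX : Differentiable ℝ X)
    (σ : ℝ) (x : E3) : gradient (fun y => φ (shift X σ y)) x =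
      gradient φ (shift X σ x) -
        σ • ContinuousLinearMap.adjoint (fderiv ℝ X x) (gradient φ (shift X σ x)) := by
  refine HasGradientAt.gradient ?_
  rw [hasGradientAt_iff_hasFDerivAt]
  refine ((hφ _).hasFDerivAt.comp x (hasFDerivAt_shift hX σ x)).congr_fderiv ?_
  ext ξ
  simp only [shiftDeriv, ContinuousLinearMap.comp_apply, _root_.sub_apply, _root_.smul_apply,
    ContinuousLinearMap.id_apply, map_sub, map_smul, InnerProductSpace.toDual_apply_apply,
    ContinuousLinearMap.adjoint_inner_left, inner_gradient_left]

/-- The pushing condition enters here: a point whose shift lies in the support of φ, a subset of Ω,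
must itself lie in Ω. So φ ∘ `shift X σ` is supported in Ω, and compactly since Ω is bounded. -/
theorem exists_shift_mem (hΩ : Bornology.IsBounded Ω) (ho : IsOpen Ω) (hX : IsPushing Ω X)
    {σ : ℝ} (hσ : σ ∈ Icc (0 : ℝ) 1) (hΦ : BoundedComp (shift X σ)) (v : H10 Ω) :
    ∃ w : H10 Ω, toL2 w = compOp Ω (shift X σ) (toL2 v) ∧
      gradH w = compOp Ω (shift X σ) (gradH v) -
        σ • adjOp Ω X (compOp Ω (shift X σ) (gradH v)) := by
  refine H10.exists_of_map (T := fun v => compOp Ω (shift X σ) (toL2 v))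
    (S := fun v => compOp Ω (shift X σ) (gradH v) -
        σ • adjOp Ω X (compOp Ω (shift X σ) (gradH v)))
    ((compOp _ _).continuous.comp continuous_toL2) ?_ ?_ v
  · have h1 : Continuous fun v : H10 Ω => compOp Ω (shift X σ) (gradH v) :=
      (compOp _ _).continuous.comp continuous_gradH
    exact h1.sub (((adjOp Ω X).continuous.comp h1).const_smul σ)
  · intro v φ hv
    have hsm : ContDiff ℝ ∞ (shift X σ) := contDiff_id.sub (hX.smooth.const_smul σ)
    have hsub : tsupport (fun x => φ (shift X σ x)) ⊆ shift X σ ⁻¹' tsupport φ :=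
      closure_minimal (fun x hx => subset_tsupport φ hx)
        ((isClosed_tsupport φ).preimage hΦ.cont)
    have hsub' : tsupport (fun x => φ (shift X σ x)) ⊆ Ω := fun x hx => by
      by_contra h
      exact hX.push σ hσ x h (hv.isTest.subset (hsub hx))
    refine ⟨fun x => φ (shift X σ x), ⟨hv.isTest.contDiff.comp hsm, ?_, hsub'⟩, ?_, ?_⟩
    · exact Metric.isCompact_of_isClosed_isBounded (isClosed_tsupport _) (hΩ.subset hsub')
    · exact indicator_represents ho hv hΦ
    · filter_upwards [indicator_represents_grad ho hv hΦ, Lp.coeFn_sub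
        (compOp Ω (shift X σ) (gradH v)) (σ • adjOp Ω X (compOp Ω (shift X σ) (gradH v))),
        Lp.coeFn_smul σ (adjOp Ω X (compOp Ω (shift X σ) (gradH v))),
        mulOp_coe (memLp_top_of_continuous hΩ ho.measurableSet
          (continuous_adjoint_fderiv hX.contDiff_one)) (compOp Ω (shift X σ) (gradH v))]
        with x h1 h2 h3 h4
      rw [h2, Pi.sub_apply, h3, Pi.smul_apply, h4, h1, gradient_comp_shift
        (hv.isTest.contDiff.differentiable (by simp)) hX.differentiable]

/-- Change of variables bounds ∫ det · |w ∘ shift|² by ‖w‖². Inserting the first-order lower bound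
of the determinant leaves the term in div X and an error of order σ². -/
theorem norm_compOp_shift_sq_le {E : Type*} [NormedAddCommGroup E] [InnerProductSpace ℝ E]
    [FiniteDimensional ℝ E] (hΩ : Bornology.IsBounded Ω) (ho : IsOpen Ω) (hX : ContDiff ℝ 1 X)
    {σ C : ℝ} (hi : Function.Injective (shift X σ))
    (hJ : ∀ x, 1 / 2 ≤ (shiftDeriv X σ x).det ∧
      1 - σ * dv (fderiv ℝ X x) - C * σ ^ 2 ≤ (shiftDeriv X σ x).det)
    (w : Lp E 2 (volume.restrict Ω)) :
    ‖compOp Ω (shift X σ) w‖ ^ 2 ≤ ‖w‖ ^ 2 +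
      σ * inner ℝ (smulOp Ω E 2 (fun x => dv (fderiv ℝ X x)) (compOp Ω (shift X σ) w))
        (compOp Ω (shift X σ) w) + C * σ ^ 2 * ‖compOp Ω (shift X σ) w‖ ^ 2 := by
  have hm := ho.measurableSet
  have hXd : Differentiable ℝ X := hX.differentiable (by simp)
  have hΦ := boundedComp_shift hXd hi fun x => (hJ x).1
  set F := compOp Ω (shift X σ) w with hF
  have hd := continuous_dv_fderiv hX
  have hmem : MemLp (fun x => dv (fderiv ℝ X x) • ContinuousLinearMap.id ℝ E) ⊤
      (volume.restrict Ω) := memLp_top_of_continuous hΩ hm (continuous_smul_id hd)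
  have hint : Integrable (fun x => dv (fderiv ℝ X x) * ‖F x‖ ^ 2) (volume.restrict Ω) := by
    have := integrable_inner_mulOp hmem F F
    simpa [inner_smul_left, real_inner_self_eq_norm_sq] using this
  have hin : inner ℝ (smulOp Ω E 2 (fun x => dv (fderiv ℝ X x)) F) F =
      ∫ x in Ω, dv (fderiv ℝ X x) * ‖F x‖ ^ 2 := by
    rw [inner_mulOp hmem]
    simp [inner_smul_left]
  have h1 : ∫⁻ x in Ω, ENNReal.ofReal ((shiftDeriv X σ x).det * ‖F x‖ ^ 2) ≤
      ENNReal.ofReal (‖w‖ ^ 2) := by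
    calc ∫⁻ x in Ω, ENNReal.ofReal ((shiftDeriv X σ x).det * ‖F x‖ ^ 2)
        = ∫⁻ x in Ω, ENNReal.ofReal (shiftDeriv X σ x).det *
            ‖Ω.indicator w (shift X σ x)‖ₑ ^ 2 := by
          refine lintegral_congr_ae ?_
          filter_upwards [compOp_coe hΦ hm w] with x hx
          rw [hF, hx, ENNReal.ofReal_mul (by linarith [(hJ x).1]),
            ENNReal.ofReal_pow (norm_nonneg _), ofReal_norm]
      _ ≤ ∫⁻ x, ENNReal.ofReal (shiftDeriv X σ x).det *
            ‖Ω.indicator w (shift X σ x)‖ₑ ^ 2 := setLIntegral_le_lintegral _ _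
      _ ≤ ∫⁻ x, ‖Ω.indicator w x‖ₑ ^ 2 :=
          lintegral_det_mul_le hXd hi fun y => ‖Ω.indicator w y‖ₑ ^ 2
      _ = ∫⁻ x in Ω, ‖w x‖ₑ ^ 2 := by
          rw [← lintegral_indicator hm]
          refine lintegral_congr fun x => ?_
          by_cases hx : x ∈ Ω <;> simp [hx]
      _ = _ := (ofReal_norm_sq w).symm
  have hsq := integrable_norm_sq F
  have hint2 : Integrable (fun x => ‖F x‖ ^ 2 - σ * (dv (fderiv ℝ X x) * ‖F x‖ ^ 2)
      - C * σ ^ 2 * ‖F x‖ ^ 2) (volume.restrict Ω) :=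
    (hsq.sub (hint.const_mul σ)).sub (hsq.const_mul _)
  have h2 : ∫ x in Ω, (‖F x‖ ^ 2 - σ * (dv (fderiv ℝ X x) * ‖F x‖ ^ 2)
      - C * σ ^ 2 * ‖F x‖ ^ 2) ≤ ‖w‖ ^ 2 := by
    -- The truncated expansion of det · ‖F‖² may be negative, so its positive part is compared with
    -- the nonnegative integrand.
    have hpos : Integrable (fun x => max (‖F x‖ ^ 2 - σ * (dv (fderiv ℝ X x) * ‖F x‖ ^ 2)
      - C * σ ^ 2 * ‖F x‖ ^ 2) 0) (volume.restrict Ω) := hint2.pos_part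
    refine (integral_mono hint2 hpos fun x => le_max_left _ _).trans ?_
    have hnn : 0 ≤ᵐ[volume.restrict Ω] fun x => max (‖F x‖ ^ 2 -
        σ * (dv (fderiv ℝ X x) * ‖F x‖ ^ 2) - C * σ ^ 2 * ‖F x‖ ^ 2) 0 :=
      Eventually.of_forall fun x => le_max_right _ _
    rw [integral_eq_lintegral_of_nonneg_ae hnn hpos.aestronglyMeasurable]
    refine ENNReal.toReal_le_of_le_ofReal (by positivity) (le_trans ?_ h1)
    refine lintegral_mono fun x => ENNReal.ofReal_le_ofReal (max_le ?_ ?_)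
    · have := mul_le_mul_of_nonneg_right (hJ x).2 (sq_nonneg ‖F x‖)
      linarith
    · exact mul_nonneg (by linarith [(hJ x).1]) (sq_nonneg _)
  have e : ∫ x in Ω, (‖F x‖ ^ 2 - σ * (dv (fderiv ℝ X x) * ‖F x‖ ^ 2)
      - C * σ ^ 2 * ‖F x‖ ^ 2) = ‖F‖ ^ 2 - σ * (∫ x in Ω, dv (fderiv ℝ X x) * ‖F x‖ ^ 2)
      - C * σ ^ 2 * ‖F‖ ^ 2 := by
    rw [integral_sub (f := fun x => ‖F x‖ ^ 2 - σ * (dv (fderiv ℝ X x) * ‖F x‖ ^ 2))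
      (hsq.sub (hint.const_mul σ)) (hsq.const_mul _), integral_sub hsq (hint.const_mul σ), integral_const_mul, integral_const_mul,
      norm_sq_eq_integral]
  rw [hin]
  linarith

theorem tendsto_shift (X : E3 → E3) (x : E3) :
    Tendsto (fun σ => shift X σ x) (𝓝[>] 0) (𝓝 x) := by
  have h : Continuous fun σ : ℝ => shift X σ x := by unfold shift; fun_prop
  have := (h.tendsto 0).mono_left (nhdsWithin_le_nhds (s := Ioi (0 : ℝ)))
  simpa [shift] using this

theorem isFiniteMeasure_restrict (hΩ : Bornology.IsBounded Ω) :
    IsFiniteMeasure (volume.restrict Ω) :=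
  ⟨by rw [Measure.restrict_apply_univ]; exact hΩ.measure_lt_top⟩

/-- The operators w ↦ w ∘ shift - w are bounded by 3, uniformly in σ, so bounded continuous
functions suffice. For those, openness of Ω keeps the shifted point in Ω for small σ, and dominated
convergence applies. -/
theorem tendsto_compOp_shift {E : Type*} [NormedAddCommGroup E] [InnerProductSpace ℝ E]
    [FiniteDimensional ℝ E] (hΩ : Bornology.IsBounded Ω) (ho : IsOpen Ω)
    (hB : ∀ᶠ σ in 𝓝[>] (0 : ℝ), BoundedComp (shift X σ)) (w : Lp E 2 (volume.restrict Ω)) :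
    Tendsto (fun σ => compOp Ω (shift X σ) w) (𝓝[>] 0) (𝓝 w) := by
  have := isFiniteMeasure_restrict hΩ
  have key : Tendsto (fun σ => compOp Ω (shift X σ) w - w) (𝓝[>] 0) (𝓝 0) := by
    refine tendsto_zero_of_dense (T := fun σ w => compOp Ω (shift X σ) w - w) (M := 3) ?_
      (Eventually.of_forall fun σ v => ?_)
      (BoundedContinuousFunction.toLp_denseRange E (volume.restrict Ω) ℝ ENNReal.ofNat_ne_top)
      ?_ w
    · intro σ v w
      rw [map_add]
      abel
    · refine (norm_sub_le _ _).trans ?_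
      have := norm_compOp_le (Ω := Ω) (shift X σ) v
      linarith
    · rintro _ ⟨g, rfl⟩
      have hg : BoundedContinuousFunction.toLp 2 (volume.restrict Ω) ℝ g
          =ᵐ[volume.restrict Ω] g := BoundedContinuousFunction.coeFn_toLp _ _ _ g
      have h1 : Tendsto (fun σ => compOp Ω (shift X σ)
          (BoundedContinuousFunction.toLp 2 (volume.restrict Ω) ℝ g)) (𝓝[>] 0)
          (𝓝 (BoundedContinuousFunction.toLp 2 (volume.restrict Ω) ℝ g)) := by
        refine tendsto_L2_of_bounded (F' := fun σ x => Ω.indicator g (shift X σ x)) ?_ hg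
          (2 * ‖g‖) ?_ ?_
        · filter_upwards [hB] with σ hσ
          filter_upwards [compOp_coe hσ ho.measurableSet
            (BoundedContinuousFunction.toLp 2 (volume.restrict Ω) ℝ g),
            hσ.ae_congr ho.measurableSet hg] with x h1 h2
          rw [h1, h2]
        · refine Eventually.of_forall fun σ => Eventually.of_forall fun x => ?_
          have h3 : ‖Ω.indicator g (shift X σ x)‖ ≤ ‖g‖ :=
            (norm_indicator_le_norm_self _ _).trans (g.norm_coe_le_norm _)
          linarith [norm_sub_le (Ω.indicator g (shift X σ x)) (g x), g.norm_coe_le_norm x]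
        · filter_upwards [ae_restrict_mem ho.measurableSet] with x hx
          have h3 := tendsto_shift X x
          refine ((g.continuous.tendsto x).comp h3).congr' ?_
          filter_upwards [h3 (ho.mem_nhds hx)] with σ hσ
          have hσ' : shift X σ x ∈ Ω := hσ
          exact (indicator_of_mem hσ' _).symm
      simpa using h1.sub_const (BoundedContinuousFunction.toLp 2 (volume.restrict Ω) ℝ g)
  simpa using key.add_const w

theorem taylor_bound {φ : E3 → ℝ} (hφ : Differentiable ℝ φ) {K : NNReal}
    (hK : LipschitzWith K (fderiv ℝ φ)) (a b : E3) :
    |φ (a + b) - φ a - inner ℝ (gradient φ a) b| ≤ K * ‖b‖ ^ 2 := by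
  have key := (convex_segment a (a + b)).norm_image_sub_le_of_norm_hasFDerivWithin_le
    (f := fun y => φ y - fderiv ℝ φ a y) (f' := fun y => fderiv ℝ φ y - fderiv ℝ φ a)
    (C := K * ‖b‖) (x := a) (y := a + b)
    (fun y _ => ((hφ y).hasFDerivAt.sub (fderiv ℝ φ a).hasFDerivAt).hasFDerivWithinAt)
    (fun y hy => by
      refine (hK.norm_sub_le y a).trans (mul_le_mul_of_nonneg_left ?_ K.2)
      obtain ⟨θ, ⟨h0, h1⟩, rfl⟩ := segment_eq_image' ℝ a (a + b) ▸ hy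
      rw [add_sub_cancel_left, add_sub_cancel_left, norm_smul, Real.norm_of_nonneg h0]
      nlinarith [norm_nonneg b]) (left_mem_segment ℝ _ _) (right_mem_segment ℝ _ _)
  rw [Real.norm_eq_abs, add_sub_cancel_left, mul_assoc, ← sq] at key
  rw [inner_gradient_left]
  refine le_trans (le_of_eq ?_) key
  congr 1
  rw [map_add]
  ring

theorem exists_norm_bound {F : Type*} [NormedAddCommGroup F] {f : E3 → F} (hf : Continuous f)
    (hc : HasCompactSupport f) : ∃ C, 0 ≤ C ∧ ∀ x, ‖f x‖ ≤ C := by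
  obtain ⟨C, hC⟩ := hc.exists_bound_of_continuous hf
  exact ⟨C, (norm_nonneg _).trans (hC 0), hC⟩

/-- Since ∇φ is Lipschitz, the Taylor remainder along σ ↦ φ(x - σX(x)) is quadratic uniformly in x,
which gives differentiability in L². -/
theorem hasDerivWithinAt_compOp_shift (hΩ : Bornology.IsBounded Ω) (ho : IsOpen Ω)
    (hX : IsPushing Ω X) {S : Set ℝ} (hB : ∀ σ ∈ S, BoundedComp (shift X σ)) {v : H10 Ω}
    {φ : E3 → ℝ} (hv : Represents v φ) {σ : ℝ} (hσ : σ ∈ S) :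
    HasDerivWithinAt (fun σ => compOp Ω (shift X σ) (toL2 v))
      (- dotOp Ω X (compOp Ω (shift X σ) (gradH v))) S σ := by
  have := isFiniteMeasure_restrict hΩ
  have hφ : ContDiff ℝ ∞ φ := hv.isTest.contDiff
  obtain ⟨K, hK⟩ := (hφ.fderiv_right (m := 1) (by norm_cast)).lipschitzWith_of_hasCompactSupport
    (hv.isTest.compact.fderiv ℝ) (by simp)
  obtain ⟨B, hB0, hXB⟩ := exists_norm_bound hX.smooth.continuous hX.compact
  rw [hasDerivWithinAt_iff_isLittleO]
  refine Asymptotics.IsBigO.trans_isLittleO (g := fun τ => ‖τ - σ‖ ^ 2) ?_ ?_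
  · refine Asymptotics.IsBigO.of_bound
      (measureUnivNNReal (volume.restrict Ω) ^ (2 : ENNReal).toReal⁻¹ * (K * B ^ 2)) ?_
    filter_upwards [self_mem_nhdsWithin] with τ hτ
    rw [Real.norm_of_nonneg (by positivity), mul_assoc]
    refine Lp.norm_le_of_ae_bound (by positivity) ?_
    have hmem : MemLp (fun x => innerSL ℝ (X x)) ⊤ (volume.restrict Ω) :=
      memLp_top_of_continuous hΩ ho.measurableSet (continuous_innerSL hX.smooth.continuous)
    filter_upwards [indicator_represents ho hv (hB τ hτ), indicator_represents ho hv (hB σ hσ),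
      indicator_represents_grad ho hv (hB σ hσ), mulOp_coe hmem (compOp Ω (shift X σ) (gradH v)),
      Lp.coeFn_sub (compOp Ω (shift X τ) (toL2 v) - compOp Ω (shift X σ) (toL2 v))
        ((τ - σ) • - dotOp Ω X (compOp Ω (shift X σ) (gradH v))),
      Lp.coeFn_sub (compOp Ω (shift X τ) (toL2 v)) (compOp Ω (shift X σ) (toL2 v)),
      Lp.coeFn_smul (τ - σ) (- dotOp Ω X (compOp Ω (shift X σ) (gradH v))),
      Lp.coeFn_neg (dotOp Ω X (compOp Ω (shift X σ) (gradH v)))] with x h1 h2 h3 h4 h5 h6 h7 h8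
    rw [h5, Pi.sub_apply, h6, Pi.sub_apply, h7, Pi.smul_apply, h8, Pi.neg_apply, h4, h1, h2, h3]
    have hb := taylor_bound (hφ.differentiable (by simp)) hK (shift X σ x) (-((τ - σ) • X x))
    have e1 : shift X σ x + -((τ - σ) • X x) = shift X τ x := by
      simp only [shift, sub_smul]
      abel
    rw [e1, norm_neg, norm_smul, mul_pow] at hb
    have e2 : φ (shift X τ x) - φ (shift X σ x) -
        (τ - σ) • -(innerSL ℝ (X x)) (gradient φ (shift X σ x)) =
        φ (shift X τ x) - φ (shift X σ x) -
          inner ℝ (gradient φ (shift X σ x)) (-((τ - σ) • X x)) := by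
      rw [inner_neg_right, inner_smul_right, innerSL_apply_apply, real_inner_comm]
      simp
    rw [e2, Real.norm_eq_abs]
    refine hb.trans ?_
    have h9 : ‖X x‖ ^ 2 ≤ B ^ 2 := by gcongr; exact hXB x
    have h10 : 0 ≤ ‖τ - σ‖ ^ 2 := by positivity
    calc (K : ℝ) * (‖τ - σ‖ ^ 2 * ‖X x‖ ^ 2) ≤ K * (‖τ - σ‖ ^ 2 * B ^ 2) := by gcongr
      _ = K * B ^ 2 * ‖τ - σ‖ ^ 2 := by ring
  · have h1 : Tendsto (fun τ : ℝ => τ - σ) (𝓝[S] σ) (𝓝 0) := by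
      have : Continuous fun τ : ℝ => τ - σ := by fun_prop
      simpa using (this.tendsto σ).mono_left (nhdsWithin_le_nhds (s := S))
    exact (Asymptotics.isLittleO_norm_pow_id (E' := ℝ) one_lt_two).comp_tendsto h1

theorem compOp_shift_zero (ho : IsOpen Ω) {E : Type*} [NormedAddCommGroup E]
    [InnerProductSpace ℝ E] (hB : BoundedComp (shift X 0)) (w : Lp E 2 (volume.restrict Ω)) :
    compOp Ω (shift X 0) w = w := by
  apply Lp.ext
  filter_upwards [compOp_coe hB ho.measurableSet w, ae_restrict_mem ho.measurableSet] with x h1 h2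
  rw [h1]
  simp [shift, h2]

/-- Test functions give the limit directly. To reach all of H¹₀(Ω), the mean value inequality bounds
the difference quotient by 2B‖∇v‖, first on test functions and then by closure, so density applies
with the uniform constant 2B + B. -/
theorem tendsto_difference_quotient (hΩ : Bornology.IsBounded Ω) (ho : IsOpen Ω)
    (hX : IsPushing Ω X) {σ₀ : ℝ} (hσ₀ : 0 < σ₀)
    (hB : ∀ σ ∈ Icc 0 σ₀, BoundedComp (shift X σ)) (v : H10 Ω) :
    Tendsto (fun σ => σ⁻¹ • (compOp Ω (shift X σ) (toL2 v) - toL2 v)) (𝓝[>] 0)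
      (𝓝 (- dotOp Ω X (gradH v))) := by
  obtain ⟨B, hB0, hXB⟩ := exists_norm_bound hX.smooth.continuous hX.compact
  have hdot : ‖dotOp Ω X‖ ≤ B := norm_mulOp_le hB0
    (Eventually.of_forall fun x => (innerSL_apply_norm (𝕜 := ℝ) (X x)).trans_le (hXB x))
  have h0 : (0 : ℝ) ∈ Icc 0 σ₀ := ⟨le_rfl, hσ₀.le⟩
  have hmem : Ioc 0 σ₀ ∈ 𝓝[>] (0 : ℝ) := Ioc_mem_nhdsGT hσ₀
  have bound : ∀ σ ∈ Icc 0 σ₀, ∀ v : H10 Ω,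
      ‖compOp Ω (shift X σ) (toL2 v) - toL2 v‖ ≤ B * (2 * ‖gradH v‖) * σ := by
    intro σ hσ
    apply H10.induction
    · refine isClosed_le ?_ ?_
      · exact (((compOp _ _).continuous.comp continuous_toL2).sub continuous_toL2).norm
      · exact (continuous_const.mul (continuous_const.mul continuous_gradH.norm)).mul
          continuous_const
    · intro v φ hv
      have key := norm_image_sub_le_of_norm_deriv_le_segment'
        (f := fun σ => compOp Ω (shift X σ) (toL2 v)) (C := B * (2 * ‖gradH v‖))
        (fun s hs => hasDerivWithinAt_compOp_shift hΩ ho hX hB hv hs)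
        (fun s hs => by
          rw [norm_neg]
          refine ((dotOp Ω X).le_of_opNorm_le hdot _).trans ?_
          exact mul_le_mul_of_nonneg_left (norm_compOp_le _ _) hB0) σ hσ
      rwa [compOp_shift_zero ho (hB 0 h0), sub_zero] at key
  have main : Tendsto (fun σ => σ⁻¹ • (compOp Ω (shift X σ) (toL2 v) - toL2 v)
      + dotOp Ω X (gradH v)) (𝓝[>] 0) (𝓝 0) := by
    refine tendsto_zero_of_dense (T := fun σ v => σ⁻¹ • (compOp Ω (shift X σ) (toL2 v) - toL2 v)
      + dotOp Ω X (gradH v)) (M := 3 * B) ?_ ?_ dense_represented ?_ v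
    · intro σ v w
      simp only [← toL2L_apply, ← gradL_apply, map_add, smul_sub, smul_add]
      abel
    · filter_upwards [hmem] with σ hσ v
      have hg : ‖gradH v‖ ≤ ‖v‖ :=
        WithLp.norm_snd_le _ (v : WithLp 2 (L2 Ω × L2Vec Ω))
      have h1 := bound σ ⟨hσ.1.le, hσ.2⟩ v
      have h2 : ‖σ⁻¹ • (compOp Ω (shift X σ) (toL2 v) - toL2 v)‖ ≤ B * (2 * ‖gradH v‖) := by
        rw [norm_smul, norm_inv, Real.norm_of_nonneg hσ.1.le, inv_mul_le_iff₀ hσ.1]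
        linarith
      have h3 := (dotOp Ω X).le_of_opNorm_le hdot (gradH v)
      refine (norm_add_le _ _).trans ?_
      nlinarith
    · rintro v ⟨φ, hv⟩
      have h1 := hasDerivWithinAt_compOp_shift hΩ ho hX hB hv h0
      rw [hasDerivWithinAt_iff_tendsto_slope, compOp_shift_zero ho (hB 0 h0)] at h1
      have h2 : Tendsto (slope (fun σ => compOp Ω (shift X σ) (toL2 v)) 0) (𝓝[>] 0)
          (𝓝 (- dotOp Ω X (gradH v))) := by
        refine h1.mono_left ?_
        rw [← nhdsWithin_Ioc_eq_nhdsGT hσ₀]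
        exact nhdsWithin_mono _ fun x hx => ⟨⟨hx.1.le, hx.2⟩, hx.1.ne'⟩
      have h3 := h2.add_const (dotOp Ω X (gradH v))
      rw [neg_add_cancel] at h3
      refine h3.congr fun σ => ?_
      rw [slope_def_module, sub_zero, compOp_shift_zero ho (hB 0 h0)]
  have h4 := main.sub_const (dotOp Ω X (gradH v))
  rw [zero_sub] at h4
  exact h4.congr fun σ => by abel

theorem toL2_sub (v w : H10 Ω) : toL2 (v - w) = toL2 v - toL2 w := (toL2L Ω).map_sub v w

theorem gradH_sub (v w : H10 Ω) : gradH (v - w) = gradH v - gradH w := (gradL Ω).map_sub v w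

/-- Algebra of the domain variation, with v the gradient, F its transport and A its image under
(DX)ᵀ. The cross term ⟨v, F⟩ is bounded by (‖v‖² + ‖F‖²)/2 and ‖F‖² by the change of variables; both
are exact to first order in σ. -/
theorem inner_difference_quotient_le {G H : Type*} [NormedAddCommGroup G] [InnerProductSpace ℝ G]
    [NormedAddCommGroup H] [InnerProductSpace ℝ H] {g d : G} {v F A : H} {σ C I : ℝ} (hσ : 0 < σ)
    (h : inner ℝ v (F - σ • A - v) = - inner ℝ g d)
    (hF : ‖F‖ ^ 2 ≤ ‖v‖ ^ 2 + σ * I + C * σ ^ 2 * ‖F‖ ^ 2) :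
    - inner ℝ g (σ⁻¹ • d) ≤ I / 2 + C * σ * ‖F‖ ^ 2 / 2 - inner ℝ v A := by
  rw [inner_sub_right, inner_sub_right, inner_smul_right, real_inner_self_eq_norm_sq] at h
  rw [inner_smul_right, ← mul_neg, ← h, inv_mul_le_iff₀ hσ]
  have h5 := real_inner_le_norm v F
  nlinarith [sq_nonneg (‖v‖ - ‖F‖)]

set_option maxHeartbeats 1000000 in
/-- The Rellich inequality for a pushing field. -/
theorem rellich (hΩ : Bornology.IsBounded Ω) (ho : IsOpen Ω) (hX : IsPushing Ω X) {v : H10 Ω}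
    {g : L2 Ω} (hg : ∀ ζ : H10 Ω, inner ℝ (gradH v) (gradH ζ) = - inner ℝ g (toL2 ζ)) :
    inner ℝ g (dotOp Ω X (gradH v)) ≤
      inner ℝ (smulOp Ω E3 2 (fun x => dv (fderiv ℝ X x)) (gradH v)) (gradH v) / 2
        - inner ℝ (gradH v) (adjOp Ω X (gradH v)) := by
  -- The weak equation Δv = g is tested with v ∘ shift - v, divided by σ, and σ → 0⁺. Only positive
  -- σ keep the shifted function in H¹₀(Ω), so an inequality results; formally the discarded
  -- quantity is the boundary integral ½∫ (X·n)|∂ₙv|² ≤ 0.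
  obtain ⟨σ₀, ⟨hσ₀, hσ₁⟩, C, hC, hgood⟩ := exists_jacobian_bound hX.contDiff_one hX.compact
  have hB : ∀ σ ∈ Icc 0 σ₀, BoundedComp (shift X σ) := fun σ hσ =>
    boundedComp_shift hX.differentiable (hgood σ hσ).1 fun x => ((hgood σ hσ).2 x).1
  have hmem : Ioc 0 σ₀ ∈ 𝓝[>] (0 : ℝ) := Ioc_mem_nhdsGT hσ₀
  have hev : ∀ᶠ σ in 𝓝[>] (0 : ℝ), BoundedComp (shift X σ) := by
    filter_upwards [hmem] with σ hσ using hB σ ⟨hσ.1.le, hσ.2⟩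
  have hsq := fun σ (hσ : σ ∈ Icc 0 σ₀) => norm_compOp_shift_sq_le hΩ ho hX.contDiff_one
    (hgood σ hσ).1 (hgood σ hσ).2 (gradH v)
  have hw := fun σ (hσ : σ ∈ Icc 0 σ₀) =>
    exists_shift_mem hΩ ho hX ⟨hσ.1, hσ.2.trans hσ₁⟩ (hB σ hσ) v
  generalize smulOp Ω E3 2 (fun x => dv (fderiv ℝ X x)) = D at hsq ⊢
  generalize adjOp Ω X = A at hw ⊢
  have hc := tendsto_compOp_shift hΩ ho hev (gradH v)
  have l1 : Tendsto (fun σ => - inner ℝ g (σ⁻¹ • (compOp Ω (shift X σ) (toL2 v) - toL2 v)))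
      (𝓝[>] 0) (𝓝 (inner ℝ g (dotOp Ω X (gradH v)))) := by
    have := ((tendsto_const_nhds (x := g)).inner (𝕜 := ℝ)
      (tendsto_difference_quotient hΩ ho hX hσ₀ hB v)).neg
    simpa [inner_neg_right] using this
  have hid : Tendsto (fun σ : ℝ => σ) (𝓝[>] 0) (𝓝 0) := nhdsWithin_le_nhds
  have l2 : Tendsto (fun σ => inner ℝ (D (compOp Ω (shift X σ) (gradH v)))
      (compOp Ω (shift X σ) (gradH v)) / 2 +
        C * σ * ‖compOp Ω (shift X σ) (gradH v)‖ ^ 2 / 2 -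
        inner ℝ (gradH v) (A (compOp Ω (shift X σ) (gradH v)))) (𝓝[>] 0)
      (𝓝 (inner ℝ (D (gradH v)) (gradH v) / 2 + C * 0 * ‖gradH v‖ ^ 2 / 2
        - inner ℝ (gradH v) (A (gradH v)))) := by
    refine (((((D.continuous.tendsto _).comp hc).inner hc).div_const 2).add
      (((hid.const_mul C).mul (hc.norm.pow 2)).div_const 2)).sub ?_
    exact tendsto_const_nhds.inner ((A.continuous.tendsto _).comp hc)
  rw [mul_zero, zero_mul, zero_div, add_zero] at l2
  -- The difference quotient tends to -X·∇v, so the left sides tend to ⟨g, X·∇v⟩, and the Cσ term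
  -- disappears.
  refine le_of_tendsto_of_tendsto l1 l2 ?_
  filter_upwards [hmem] with σ hσ
  have hσ' : σ ∈ Icc 0 σ₀ := ⟨hσ.1.le, hσ.2⟩
  obtain ⟨w, hw1, hw2⟩ := hw σ hσ'
  have e1 := hg (w - v)
  have e2 : toL2 (w - v) = compOp Ω (shift X σ) (toL2 v) - toL2 v := by
    rw [toL2_sub, hw1]
  have e3 : gradH (w - v) = compOp Ω (shift X σ) (gradH v) -
      σ • A (compOp Ω (shift X σ) (gradH v)) - gradH v := by
    rw [gradH_sub, hw2]
  rw [e2, e3] at e1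
  exact inner_difference_quotient_le hσ.1 e1 (hsq σ hσ')

end

/-! ### Lipschitz truncations of r⁵ and their primitives. -/

section

/-- The projection of `ℝ` onto `[-N, N]`. -/
def clip (N : ℕ) (r : ℝ) : ℝ := max (-N) (min r N)

theorem abs_clip_le (N : ℕ) (r : ℝ) : |clip N r| ≤ N := by
  have : (0 : ℝ) ≤ N := N.cast_nonneg
  rw [abs_le]
  exact ⟨le_max_left _ _, max_le (by linarith) (min_le_right _ _)⟩

theorem clip_eq {N : ℕ} {r : ℝ} (h : |r| ≤ N) : clip N r = r := by
  obtain ⟨h1, h2⟩ := abs_le.1 h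
  rw [clip, min_eq_left h2, max_eq_right h1]

theorem clip_nonneg (N : ℕ) {r : ℝ} (h : 0 ≤ r) : 0 ≤ clip N r :=
  le_max_of_le_right (le_min h N.cast_nonneg)

theorem clip_le (N : ℕ) {r : ℝ} (h : 0 ≤ r) : clip N r ≤ r :=
  max_le (by linarith [(N.cast_nonneg : (0 : ℝ) ≤ N)]) (min_le_left _ _)

theorem clip_neg (N : ℕ) (r : ℝ) : clip N (-r) = - clip N r := by
  have : (0 : ℝ) ≤ N := N.cast_nonneg
  unfold clip
  rcases le_total r N with h1 | h1 <;> rcases le_total (-N : ℝ) r with h2 | h2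
  · rw [min_eq_left h1, max_eq_right h2, min_eq_left (by linarith), max_eq_right (by linarith)]
  · rw [min_eq_left h1, max_eq_left h2, min_eq_right (by linarith), max_eq_right (by linarith),
      neg_neg]
  · have e : max (-N : ℝ) N = N := max_eq_right (by linarith)
    rw [min_eq_right h1, e, min_eq_left (by linarith), max_eq_left (by linarith)]
  · have : r = N := by linarith
    have h0 : (N : ℝ) = 0 := by linarith
    simp [this, h0]

theorem abs_clip (N : ℕ) (r : ℝ) : |clip N r| = clip N |r| := by
  rcases le_total 0 r with h | h
  · rw [abs_of_nonneg h, abs_of_nonneg (clip_nonneg N h)]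
  · rw [abs_of_nonpos h, clip_neg, abs_of_nonpos]
    have := clip_nonneg N (neg_nonneg.2 h)
    rw [clip_neg] at this
    linarith

theorem abs_clip_le_abs (N : ℕ) (r : ℝ) : |clip N r| ≤ |r| := by
  rw [abs_clip]
  exact clip_le N (abs_nonneg r)

theorem abs_clip_mono (r : ℝ) : Monotone fun N : ℕ => |clip N r| := by
  intro M N h
  simp only [abs_clip]
  have h' : (M : ℝ) ≤ N := by exact_mod_cast h
  have hM : (0 : ℝ) ≤ M := M.cast_nonneg
  refine max_le (le_max_of_le_right (le_min ?_ ?_)) (le_max_of_le_right (min_le_min le_rfl h'))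
  · linarith [abs_nonneg r]
  · linarith

theorem abs_clip_sub_le (N : ℕ) (r s : ℝ) : |clip N r - clip N s| ≤ |r - s| := by
  unfold clip
  refine (abs_max_sub_max_le_max _ _ _ _).trans ?_
  rw [sub_self, abs_zero, max_eq_right (abs_nonneg _)]
  refine (abs_min_sub_min_le_max _ _ _ _).trans ?_
  rw [sub_self, abs_zero, max_eq_left (abs_nonneg _)]

/-- The truncation of `r ↦ r⁵`. -/
def quint (N : ℕ) (r : ℝ) : ℝ := clip N r ^ 5

theorem abs_pow_five_sub_le {M x y : ℝ} (hx : |x| ≤ M) (hy : |y| ≤ M) :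
    |x ^ 5 - y ^ 5| ≤ 5 * M ^ 4 * |x - y| := by
  have h0 : 0 ≤ M := (abs_nonneg x).trans hx
  have e : x ^ 5 - y ^ 5 = (x ^ 4 + x ^ 3 * y + x ^ 2 * y ^ 2 + x * y ^ 3 + y ^ 4) * (x - y) := by
    ring
  rw [e, abs_mul]
  refine mul_le_mul_of_nonneg_right ?_ (abs_nonneg _)
  have hb : ∀ i j : ℕ, |x ^ i * y ^ j| ≤ M ^ i * M ^ j := fun i j => by
    rw [abs_mul, abs_pow, abs_pow]
    gcongr
  have h1 := hb 4 0
  have h2 := hb 3 1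
  have h3 := hb 2 2
  have h4 := hb 1 3
  have h5 := hb 0 4
  simp only [pow_zero, mul_one, one_mul, pow_one] at h1 h2 h3 h4 h5
  have := abs_add_le (x ^ 4 + x ^ 3 * y + x ^ 2 * y ^ 2 + x * y ^ 3) (y ^ 4)
  have := abs_add_le (x ^ 4 + x ^ 3 * y + x ^ 2 * y ^ 2) (x * y ^ 3)
  have := abs_add_le (x ^ 4 + x ^ 3 * y) (x ^ 2 * y ^ 2)
  have := abs_add_le (x ^ 4) (x ^ 3 * y)
  nlinarith

theorem lipschitzWith_quint (N : ℕ) : LipschitzWith (5 * N ^ 4) (quint N) := by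
  refine LipschitzWith.of_dist_le_mul fun r s => ?_
  rw [Real.dist_eq, Real.dist_eq]
  refine (abs_pow_five_sub_le (abs_clip_le N r) (abs_clip_le N s)).trans ?_
  push_cast
  exact mul_le_mul_of_nonneg_left (abs_clip_sub_le N r s) (by positivity)

/-- The primitive of `quint N`. -/
def sext (N : ℕ) (r : ℝ) : ℝ := ∫ s in (0 : ℝ)..r, quint N s

theorem isPrimitive_quint (N : ℕ) : IsPrimitive (sext N) (quint N) (5 * N ^ 4) where
  deriv r := intervalIntegral.integral_hasDerivAt_right
    ((lipschitzWith_quint N).continuous.intervalIntegrable _ _)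
    ((lipschitzWith_quint N).continuous.stronglyMeasurableAtFilter _ _)
    (lipschitzWith_quint N).continuous.continuousAt
  lip := lipschitzWith_quint N
  map_zero := by rw [quint, clip_eq (by simp)]; simp
  prim_zero := by simp [sext]

theorem quint_eq {N : ℕ} {r : ℝ} (h : |r| ≤ N) : quint N r = r ^ 5 := by rw [quint, clip_eq h]

theorem abs_quint_le (N : ℕ) (r : ℝ) : |quint N r| ≤ |r| ^ 5 := by
  rw [quint, abs_pow]
  exact pow_le_pow_left₀ (abs_nonneg _) (abs_clip_le_abs N r) 5

/-- The truncated power is odd, so its primitive is even; estimates of `sext` then reduce to r ≥ 0.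
-/
theorem sext_abs (N : ℕ) (r : ℝ) : sext N |r| = sext N r := by
  rcases le_total 0 r with h | h
  · rw [abs_of_nonneg h]
  · rw [abs_of_nonpos h, sext, sext]
    have h1 : ∀ s, quint N s = - quint N (-s) := fun s => by
      simp only [quint, clip_neg]
      ring
    conv_rhs => rw [intervalIntegral.integral_congr fun s _ => h1 s]
    rw [intervalIntegral.integral_neg, intervalIntegral.integral_comp_neg, neg_zero,
      intervalIntegral.integral_symm]

theorem sext_eq {N : ℕ} {r : ℝ} (h : |r| ≤ N) : sext N r = r ^ 6 / 6 := by
  rw [← sext_abs, sext]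
  have : EqOn (quint N) (fun s => s ^ 5) (uIcc 0 |r|) := fun s hs => by
    rw [uIcc_of_le (abs_nonneg r)] at hs
    exact quint_eq (by rw [abs_of_nonneg hs.1]; exact hs.2.trans h)
  rw [intervalIntegral.integral_congr this, integral_pow]
  have h6 : |r| ^ 6 = r ^ 6 := Even.pow_abs ⟨3, rfl⟩ r
  norm_num [h6]

theorem abs_sext_le (N : ℕ) (r : ℝ) : |sext N r| ≤ r ^ 6 / 6 := by
  have h6 : |r| ^ 6 = r ^ 6 := Even.pow_abs ⟨3, rfl⟩ r
  have h5 : ∀ s ∈ Icc 0 |r|, quint N s ≤ s ^ 5 := fun s hs => by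
    refine (le_abs_self _).trans ((abs_quint_le N s).trans ?_)
    rw [abs_of_nonneg hs.1]
  have hnn : 0 ≤ ∫ s in (0 : ℝ)..|r|, quint N s :=
    intervalIntegral.integral_nonneg (abs_nonneg r) fun s hs => pow_nonneg (clip_nonneg N hs.1) 5
  rw [← sext_abs, sext, abs_of_nonneg hnn]
  refine (intervalIntegral.integral_mono_on (abs_nonneg r)
    ((lipschitzWith_quint N).continuous.intervalIntegrable _ _)
    ((continuous_pow 5).intervalIntegrable _ _) h5).trans ?_
  rw [integral_pow]
  norm_num [h6]

theorem eventually_abs_le (r : ℝ) : ∀ᶠ N : ℕ in atTop, |r| ≤ N :=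
  tendsto_natCast_atTop_atTop.eventually_ge_atTop |r|

theorem tendsto_quint (r : ℝ) : Tendsto (fun N => quint N r) atTop (𝓝 (r ^ 5)) :=
  tendsto_const_nhds.congr' ((eventually_abs_le r).mono fun _ h => (quint_eq h).symm)

theorem tendsto_sext (r : ℝ) : Tendsto (fun N => sext N r) atTop (𝓝 (r ^ 6 / 6)) :=
  tendsto_const_nhds.congr' ((eventually_abs_le r).mono fun _ h => (sext_eq h).symm)

end

/-! ### The nonlinearity u⁵ as an integrable function of time with values in L². -/

section

variable {Ω : Set E3}

/-- The fifth power of an element of `L²`, as an element of `L²` (zero if it is not one). -/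
def fifth {α : Type*} [MeasurableSpace α] {μ : Measure α} (w : Lp ℝ 2 μ) : Lp ℝ 2 μ :=
  open Classical in if h : MemLp (fun x => w x ^ 5) 2 μ then h.toLp _ else 0

section Fifth

variable {α : Type*} [MeasurableSpace α] {μ : Measure α} {w : Lp ℝ 2 μ}

theorem integrable_pow_ten (h : MemLp w 10 μ) : Integrable (fun x => w x ^ 10) μ := by
  have := MemLp.integrable_norm_pow (p := 10) (by exact_mod_cast h) (by norm_num)
  refine this.congr (Eventually.of_forall fun x => ?_)
  simp only [Real.norm_eq_abs]
  exact Even.pow_abs ⟨5, rfl⟩ _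

theorem memLp_pow_five (h : MemLp w 10 μ) : MemLp (fun x => w x ^ 5) 2 μ := by
  have hm : AEStronglyMeasurable (fun x => w x ^ 5) μ := (Lp.aestronglyMeasurable w).pow 5
  rw [memLp_two_iff_integrable_sq hm]
  refine (integrable_pow_ten h).congr (Eventually.of_forall fun x => ?_)
  simp only
  ring

theorem fifth_coe (h : MemLp w 10 μ) : fifth w =ᵐ[μ] fun x => w x ^ 5 := by
  rw [fifth, dif_pos (memLp_pow_five h)]
  exact (memLp_pow_five h).coeFn_toLp

/-- Dominated convergence in L²: the difference is at most 2|w|⁵, which is square integrable when w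
is in L¹⁰. -/
theorem tendsto_comp_quint (h : MemLp w 10 μ) :
    Tendsto (fun N => (isPrimitive_quint N).comp w) atTop (𝓝 (fifth w)) := by
  refine tendsto_L2_of_dominated (F' := fun N x => quint N (w x))
    (Eventually.of_forall fun N => (isPrimitive_quint N).comp_coe w) (fifth_coe h)
    (B := fun x => 2 * |w x| ^ 5) ?_ ?_ ?_
  · refine ((integrable_pow_ten h).const_mul 4).congr (Eventually.of_forall fun x => ?_)
    have : |w x| ^ 10 = w x ^ 10 := Even.pow_abs ⟨5, rfl⟩ _
    simp only
    rw [← this]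
    ring
  · refine Eventually.of_forall fun N => Eventually.of_forall fun x => ?_
    refine (norm_sub_le _ _).trans ?_
    have := abs_quint_le N (w x)
    rw [Real.norm_eq_abs, Real.norm_eq_abs, abs_pow]
    linarith
  · exact Eventually.of_forall fun x => tendsto_quint (w x)

/-- Monotone convergence writes the tenth power integral as a countable supremum of continuous
functions of w in L². This makes the L¹⁰ norm of u(t) measurable in t, although u is only continuous
into weaker spaces. -/
theorem lintegral_pow_ten_eq (w : Lp ℝ 2 μ) :
    ∫⁻ x, ‖w x‖ₑ ^ 10 ∂μ = ⨆ N : ℕ, ENNReal.ofReal (‖(isPrimitive_quint N).comp w‖ ^ 2) := by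
  have hm : ∀ N, AEMeasurable (fun x => ‖quint N (w x)‖ₑ ^ 2) μ := fun N =>
    (((lipschitzWith_quint N).continuous.comp_aestronglyMeasurable
      (Lp.aestronglyMeasurable w)).enorm.pow_const 2)
  have hmono : ∀ x, Monotone fun N => ‖quint N (w x)‖ₑ ^ 2 := fun x M N h => by
    simp only [← ofReal_norm, Real.norm_eq_abs, quint, abs_pow]
    exact pow_le_pow_left' (ENNReal.ofReal_le_ofReal
      (pow_le_pow_left₀ (abs_nonneg _) (abs_clip_mono (w x) h) 5)) 2
  calc ∫⁻ x, ‖w x‖ₑ ^ 10 ∂μ = ∫⁻ x, ⨆ N, ‖quint N (w x)‖ₑ ^ 2 ∂μ := by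
        refine lintegral_congr fun x => ?_
        have h1 := tendsto_atTop_iSup (hmono x)
        have h2 : Tendsto (fun N => ‖quint N (w x)‖ₑ ^ 2) atTop (𝓝 (‖w x‖ₑ ^ 10)) := by
          refine tendsto_const_nhds.congr' ((eventually_abs_le (w x)).mono fun N h => ?_)
          simp only [quint_eq h, enorm_pow, ← pow_mul]
        exact tendsto_nhds_unique h2 h1
    _ = ⨆ N, ∫⁻ x, ‖quint N (w x)‖ₑ ^ 2 ∂μ :=
        lintegral_iSup' hm (Eventually.of_forall hmono)
    _ = _ := by
        refine iSup_congr fun N => ?_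
        rw [ofReal_norm_sq]
        refine lintegral_congr_ae ?_
        filter_upwards [(isPrimitive_quint N).comp_coe w] with x hx
        rw [hx]

theorem eLpNorm_ten_pow (w : Lp ℝ 2 μ) :
    eLpNorm w 10 μ ^ 5 = (∫⁻ x, ‖w x‖ₑ ^ 10 ∂μ) ^ (1 / 2 : ℝ) := by
  rw [eLpNorm_eq_lintegral_rpow_enorm_toReal (by norm_num) (by norm_num), ← ENNReal.rpow_natCast,
    ← ENNReal.rpow_mul]
  norm_num

theorem enorm_fifth_le (w : Lp ℝ 2 μ) : ‖fifth w‖ₑ ≤ eLpNorm w 10 μ ^ 5 := by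
  by_cases h : MemLp (fun x => w x ^ 5) 2 μ
  · have h1 : fifth w =ᵐ[μ] fun x => w x ^ 5 := by
      rw [fifth, dif_pos h]
      exact h.coeFn_toLp
    rw [Lp.enorm_def, eLpNorm_congr_ae h1, eLpNorm_ten_pow,
      eLpNorm_eq_lintegral_rpow_enorm_toReal (by norm_num) (by norm_num)]
    simp only [enorm_pow, ENNReal.toReal_ofNat]
    refine ENNReal.rpow_le_rpow (le_of_eq (lintegral_congr fun x => ?_)) (by norm_num)
    rw [← ENNReal.rpow_natCast, ← ENNReal.rpow_mul, ← ENNReal.rpow_natCast]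
    norm_num
  · rw [fifth, dif_neg h]
    simp

theorem ae_memLp_ten {w : ℝ → Lp ℝ 2 μ} {a b : ℝ} (hw : ContinuousOn w (Icc a b))
    (h : ∫⁻ t in Icc a b, eLpNorm (w t) 10 μ ^ 5 < ⊤) :
    ∀ᵐ t ∂volume.restrict (Icc a b), MemLp (w t) 10 μ := by
  have hm : AEMeasurable (fun t => eLpNorm (w t) 10 μ ^ 5) (volume.restrict (Icc a b)) := by
    simp only [eLpNorm_ten_pow, lintegral_pow_ten_eq]
    refine (AEMeasurable.iSup fun N => ?_).pow_const _
    refine (ContinuousOn.aemeasurable ?_ measurableSet_Icc).ennreal_ofReal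
    exact ((isPrimitive_quint N).continuous_comp.comp_continuousOn hw).norm.pow 2
  filter_upwards [ae_lt_top' hm h.ne] with t ht
  refine ⟨Lp.aestronglyMeasurable _, ?_⟩
  by_contra hc
  rw [not_lt, top_le_iff] at hc
  simp [hc] at ht

/-- Measurability in time comes from an a.e. limit of continuous truncations, and the norm is
dominated by ‖w‖⁵ in L¹⁰, whose time integral is finite. -/
theorem integrableOn_fifth {w : ℝ → Lp ℝ 2 μ} {a b : ℝ} (hw : ContinuousOn w (Icc a b))
    (h : ∫⁻ t in Icc a b, eLpNorm (w t) 10 μ ^ 5 < ⊤) :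
    IntegrableOn (fun t => fifth (w t)) (Icc a b) := by
  refine ⟨?_, (lintegral_mono fun t => enorm_fifth_le (w t)).trans_lt h⟩
  refine aestronglyMeasurable_of_tendsto_ae atTop
    (f := fun N t => (isPrimitive_quint N).comp (w t)) (fun N => ?_) ?_
  · exact ((isPrimitive_quint N).continuous_comp.comp_continuousOn hw).aestronglyMeasurable
      measurableSet_Icc
  · filter_upwards [ae_memLp_ten hw h] with t ht using tendsto_comp_quint ht

end Fifth

end

/-! ### Mollification in time of vector-valued functions. -/

section

section Mollify

variable {G H : Type*} [NormedAddCommGroup G] [NormedSpace ℝ G] [NormedAddCommGroup H]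
  [NormedSpace ℝ H] {k : ℝ → ℝ} {g : ℝ → G} {δ : ℝ}

/-- Convolution of a vector-valued function with a scalar kernel. -/
abbrev mol (k : ℝ → ℝ) (g : ℝ → G) : ℝ → G :=
  convolution k g (ContinuousLinearMap.lsmul ℝ ℝ) volume

theorem mol_apply (k : ℝ → ℝ) (g : ℝ → G) (t : ℝ) : mol k g t = ∫ s, k (t - s) • g s := by
  rw [mol, convolution_eq_swap]
  simp

theorem integrable_mol (hk : Continuous k) (hc : HasCompactSupport k) (hg : Integrable g) (t : ℝ) :
    Integrable fun s => k (t - s) • g s := by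
  have := (hc.convolutionExists_left (ContinuousLinearMap.lsmul ℝ ℝ) hk
    hg.locallyIntegrable t).integrable_swap
  simpa using this

theorem map_mol [CompleteSpace G] [CompleteSpace H] (L : CLM G H) (hk : Continuous k)
    (hc : HasCompactSupport k) (hg : Integrable g) (t : ℝ) :
    L (mol k g t) = mol k (fun s => L (g s)) t := by
  rw [mol_apply, mol_apply, ← L.integral_comp_comm (integrable_mol hk hc hg t)]
  simp

theorem hasDerivAt_mol (hk : ContDiff ℝ 1 k) (hc : HasCompactSupport k) (hg : Integrable g)
    (t : ℝ) : HasDerivAt (mol k g) (mol (deriv k) g t) t :=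
  hc.hasDerivAt_convolution_left _ hk hg.locallyIntegrable t

/-- Smooth probability densities supported in `(-δ, δ)`. -/
structure IsKernel (k : ℝ → ℝ) (δ : ℝ) : Prop where
  contDiff : ContDiff ℝ ∞ k
  compact : HasCompactSupport k
  support : Function.support k ⊆ Metric.ball 0 δ
  nonneg : ∀ s, 0 ≤ k s
  integral : ∫ s, k s = 1

theorem exists_isKernel (hδ : 0 < δ) : ∃ k, IsKernel k δ := by
  let η : ContDiffBump (0 : ℝ) := ⟨δ / 2, δ, by linarith, by linarith⟩
  exact ⟨η.normed volume, η.contDiff_normed, η.hasCompactSupport_normed,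
    η.support_normed_eq.subset, η.nonneg_normed, η.integral_normed⟩

namespace IsKernel

theorem integrable (hk : IsKernel k δ) : Integrable k :=
  hk.contDiff.continuous.integrable_of_hasCompactSupport hk.compact

theorem norm_mol_sub_le [CompleteSpace G] (hk : IsKernel k δ) (hg : AEStronglyMeasurable g)
    {ε : ℝ} (hε : 0 ≤ ε) {c : G} {t : ℝ} (h : ∀ s ∈ Metric.ball t δ, ‖g s - c‖ ≤ ε) :
    ‖mol k g t - c‖ ≤ ε := by
  rw [← dist_eq_norm]
  exact dist_convolution_le hε hk.support hk.nonneg hk.integral hg fun s hs => by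
    rw [dist_eq_norm]
    exact h s hs

theorem integral_norm_mol_le [CompleteSpace G] (hk : IsKernel k δ) (hg : Integrable g) :
    ∫ t, ‖mol k g t‖ ≤ ∫ t, ‖g t‖ := by
  have h1 : ∫ t, mol k (fun s => ‖g s‖) t = ∫ t, ‖g t‖ := by
    rw [integral_convolution _ hk.integrable hg.norm, hk.integral]
    simp
  rw [← h1]
  refine integral_mono (hk.integrable.integrable_convolution _ hg).norm
    (hk.integrable.integrable_convolution _ hg.norm) fun t => ?_
  rw [mol_apply, mol_apply]
  refine (norm_integral_le_integral_norm _).trans (le_of_eq (integral_congr_ae ?_))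
  refine Eventually.of_forall fun s => ?_
  simp only [norm_smul, smul_eq_mul, Real.norm_of_nonneg (hk.nonneg _)]

end IsKernel

theorem tendsto_mol [CompleteSpace G] {κ : ℕ → ℝ → ℝ} {δ : ℕ → ℝ} (hκ : ∀ n, IsKernel (κ n) (δ n))
    (hδ : Tendsto δ atTop (𝓝 0)) (hg : AEStronglyMeasurable g) {t : ℝ} (hc : ContinuousAt g t) :
    Tendsto (fun n => mol (κ n) g t) atTop (𝓝 (g t)) := by
  rw [Metric.tendsto_atTop']
  intro ε hε
  obtain ⟨r, hr, h⟩ := Metric.continuousAt_iff.1 hc (ε / 2) (by linarith)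
  obtain ⟨N, hN⟩ := eventually_atTop.1 (hδ.eventually_lt_const hr)
  refine ⟨N, fun n hn => ?_⟩
  rw [dist_eq_norm]
  refine lt_of_le_of_lt ((hκ n).norm_mol_sub_le hg (ε := ε / 2) (by linarith) fun s hs => ?_)
    (by linarith)
  rw [← dist_eq_norm]
  exact (h (lt_trans hs (hN n hn.le))).le

/-- Approximation in L¹ by a continuous compactly supported h: convolution with a probability
density does not increase the L¹ norm of g - h, and h is uniformly continuous. Each of the three
errors is at most ε/4. -/
theorem tendsto_integral_norm_mol_sub [CompleteSpace G] {κ : ℕ → ℝ → ℝ} {δ : ℕ → ℝ}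
    (hκ : ∀ n, IsKernel (κ n) (δ n)) (hδ : Tendsto δ atTop (𝓝 0)) (hg : Integrable g) (a b : ℝ) :
    Tendsto (fun n => ∫ t in Icc a b, ‖mol (κ n) g t - g t‖) atTop (𝓝 0) := by
  rw [Metric.tendsto_atTop']
  intro ε hε
  obtain ⟨h, hc, hle, hcont, hint⟩ := hg.exists_hasCompactSupport_integral_sub_le
    (ε := ε / 4) (by linarith)
  have hM : 0 < volume.real (Icc a b) + 1 := by positivity
  obtain ⟨r, hr, hu⟩ := Metric.uniformContinuous_iff.1
    (hcont.uniformContinuous_of_tendsto_cocompact hc.is_zero_at_infty) (ε / 4 / (volume.real (Icc a b) + 1))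
    (by positivity)
  obtain ⟨N, hN⟩ := eventually_atTop.1 (hδ.eventually_lt_const hr)
  refine ⟨N, fun n hn => ?_⟩
  have hk := hκ n
  have hd := hg.sub hint
  have i1 : Integrable fun t => ‖mol (κ n) (g - h) t‖ :=
    (hk.integrable.integrable_convolution _ hd).norm
  have i2 : Integrable fun t => ‖mol (κ n) h t - h t‖ :=
    ((hk.integrable.integrable_convolution _ hint).sub hint).norm
  have i3 : Integrable fun t => ‖g t - h t‖ := hd.norm
  have i4 : Integrable fun t => ‖mol (κ n) g t - g t‖ :=
    ((hk.integrable.integrable_convolution _ hg).sub hg).norm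
  have key : ∀ t, ‖mol (κ n) g t - g t‖ ≤
      ‖mol (κ n) (g - h) t‖ + ‖mol (κ n) h t - h t‖ + ‖g t - h t‖ := by
    intro t
    have e : mol (κ n) g t = mol (κ n) (g - h) t + mol (κ n) h t := by
      have := ConvolutionExists.distrib_add (L := ContinuousLinearMap.lsmul ℝ ℝ)
        (hk.compact.convolutionExists_left (ContinuousLinearMap.lsmul ℝ ℝ) hk.contDiff.continuous
          hd.locallyIntegrable)
        (hk.compact.convolutionExists_left (ContinuousLinearMap.lsmul ℝ ℝ) hk.contDiff.continuous
          hint.locallyIntegrable)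
      rw [sub_add_cancel] at this
      exact congrFun this t
    have e2 : mol (κ n) g t - g t =
        mol (κ n) (g - h) t + (mol (κ n) h t - h t) - (g t - h t) := by
      rw [e]
      abel
    rw [e2]
    exact (norm_sub_le _ _).trans (add_le_add_left (norm_add_le _ _) _)
  have b1 : ∫ t in Icc a b, ‖mol (κ n) (g - h) t‖ ≤ ε / 4 :=
    (setIntegral_le_integral i1 (Eventually.of_forall fun _ => norm_nonneg _)).trans
      ((hk.integral_norm_mol_le hd).trans hle)
  have b3 : ∫ t in Icc a b, ‖g t - h t‖ ≤ ε / 4 :=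
    (setIntegral_le_integral i3 (Eventually.of_forall fun _ => norm_nonneg _)).trans hle
  have b2 : ∫ t in Icc a b, ‖mol (κ n) h t - h t‖ ≤ ε / 4 := by
    calc ∫ t in Icc a b, ‖mol (κ n) h t - h t‖
        ≤ ∫ _ in Icc a b, ε / 4 / (volume.real (Icc a b) + 1) := by
          refine setIntegral_mono_on i2.integrableOn (integrable_const _) measurableSet_Icc
            fun t _ => ?_
          refine hk.norm_mol_sub_le hint.aestronglyMeasurable (by positivity) fun s hs => ?_
          rw [← dist_eq_norm]
          exact (hu (lt_trans hs (hN n hn.le))).le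
      _ ≤ ε / 4 := by
          rw [setIntegral_const, smul_eq_mul, mul_div_assoc', div_le_iff₀ hM]
          nlinarith
  have b4 := setIntegral_mono (s := Icc a b) i4.integrableOn
    ((i1.add i2).add i3).integrableOn key
  have e5 : ∫ t in Icc a b, (((fun t => ‖mol (κ n) (g - h) t‖) + fun t => ‖mol (κ n) h t - h t‖) +
      fun t => ‖g t - h t‖) t = (∫ t in Icc a b, ‖mol (κ n) (g - h) t‖) +
      (∫ t in Icc a b, ‖mol (κ n) h t - h t‖) + ∫ t in Icc a b, ‖g t - h t‖ := by
    rw [integral_add' (i1.add i2).integrableOn i3.integrableOn,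
      integral_add' i1.integrableOn i2.integrableOn]
  rw [e5] at b4
  rw [dist_zero_right, Real.norm_of_nonneg (integral_nonneg fun _ => norm_nonneg _)]
  linarith

/-- Integration by parts in s over the window [t - δ, t + δ]. The boundary terms vanish because the
kernel is supported in the open ball of radius δ, and the window lies in (a, b), where the indicator
is invisible. -/
theorem mol_deriv [CompleteSpace G] {g' : ℝ → G} {a b t : ℝ} (hδ : 0 < δ) (hk : ContDiff ℝ 1 k)
    (hs : Function.support k ⊆ Metric.ball 0 δ)
    (hab : Icc (t - δ) (t + δ) ⊆ Ioo a b) (hg : ∀ s ∈ Ioo a b, HasDerivAt g (g' s) s)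
    (hg' : ContinuousOn g' (Ioo a b)) :
    mol (deriv k) ((Icc a b).indicator g) t = mol k ((Icc a b).indicator g') t := by
  have hts : tsupport k ⊆ Metric.closedBall 0 δ :=
    closure_minimal (hs.trans Metric.ball_subset_closedBall) Metric.isClosed_closedBall
  have z1 : ∀ s ∉ Icc (t - δ) (t + δ), k (t - s) = 0 := fun s hs' => by
    by_contra h
    have := hs (Function.mem_support.2 h)
    rw [mem_ball_zero_iff, Real.norm_eq_abs, abs_lt] at this
    exact hs' ⟨by linarith, by linarith⟩
  have z2 : ∀ s ∉ Icc (t - δ) (t + δ), deriv k (t - s) = 0 := fun s hs' => by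
    by_contra h
    have := hts (support_deriv_subset (Function.mem_support.2 h))
    rw [mem_closedBall_zero_iff, Real.norm_eq_abs, abs_le] at this
    exact hs' ⟨by linarith, by linarith⟩
  have red : ∀ (l : ℝ → ℝ) (w : ℝ → G), (∀ s ∉ Icc (t - δ) (t + δ), l (t - s) = 0) →
      mol l ((Icc a b).indicator w) t = ∫ s in (t - δ)..(t + δ), l (t - s) • w s := by
    intro l w hl
    rw [mol_apply, intervalIntegral.integral_of_le (by linarith), ← integral_Icc_eq_integral_Ioc,
      ← setIntegral_eq_integral_of_forall_compl_eq_zero (s := Icc (t - δ) (t + δ))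
        (fun s hs' => by rw [hl s hs', zero_smul])]
    refine setIntegral_congr_fun measurableSet_Icc fun s hs' => ?_
    simp only [indicator_of_mem (Ioo_subset_Icc_self (hab hs'))]
  rw [red _ g z2, red _ g' z1]
  have hu : uIcc (t - δ) (t + δ) ⊆ Ioo a b := by rwa [uIcc_of_le (by linarith)]
  have hgc : ContinuousOn g (Ioo a b) := fun s hs' => (hg s hs').continuousAt.continuousWithinAt
  have c1 : IntervalIntegrable (fun s => deriv k (t - s) • g s) volume (t - δ) (t + δ) :=
    (ContinuousOn.smul (((hk.continuous_deriv (by simp)).comp (by fun_prop)).continuousOn)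
      (hgc.mono hu)).intervalIntegrable
  have c2 : IntervalIntegrable (fun s => k (t - s) • g' s) volume (t - δ) (t + δ) :=
    (ContinuousOn.smul ((hk.continuous.comp (by fun_prop)).continuousOn)
      (hg'.mono hu)).intervalIntegrable
  have key := intervalIntegral.integral_eq_sub_of_hasDerivAt (a := t - δ) (b := t + δ)
    (f := fun s => k (t - s) • g s) (f' := fun s => k (t - s) • g' s - deriv k (t - s) • g s)
    (fun s hs' => by
      have h1 : HasDerivAt (fun s => k (t - s)) (-deriv k (t - s)) s := by
        exact HasDerivAt.comp_const_sub t s (hk.differentiable (by simp) (t - s)).hasDerivAt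
      have h2 := h1.smul (hg s (hu hs'))
      exact h2.congr_deriv (by rw [neg_smul, ← sub_eq_add_neg])) (c2.sub c1)
  have e1 : k (t - (t - δ)) = 0 := by
    by_contra h
    have := hs (Function.mem_support.2 h)
    rw [mem_ball_zero_iff, Real.norm_eq_abs, abs_lt] at this
    linarith
  have e2 : k (t - (t + δ)) = 0 := by
    by_contra h
    have := hs (Function.mem_support.2 h)
    rw [mem_ball_zero_iff, Real.norm_eq_abs, abs_lt] at this
    linarith
  rw [intervalIntegral.integral_sub c2 c1, e1, e2, zero_smul, zero_smul, sub_self,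
    sub_eq_zero] at key
  exact key.symm

end Mollify

end

/-! ### The wave equation satisfied by the mollified solution. -/

section

variable {Ω : Set E3} {t₀ : ℝ} {u : ℝ → H10 Ω} {ut : ℝ → L2 Ω}

namespace MemX

theorem ae_memLp (h : MemX Ω t₀ u ut) {b : ℝ} (hb : b ∈ Ico 0 t₀) :
    ∀ᵐ t ∂volume.restrict (Icc 0 b), MemLp (toL2 (u t)) 10 (volume.restrict Ω) :=
  ae_memLp_ten ((continuous_toL2.comp_continuousOn h.continuousOn).mono
    (Icc_subset_Ico_right hb.2)) (h.lintegral_lt_top b hb)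

theorem integrableOn_fifth (h : MemX Ω t₀ u ut) {b : ℝ} (hb : b ∈ Ico 0 t₀) :
    IntegrableOn (fun t => fifth (toL2 (u t))) (Icc 0 b) :=
  NLW.integrableOn_fifth ((continuous_toL2.comp_continuousOn h.continuousOn).mono
    (Icc_subset_Ico_right hb.2)) (h.lintegral_lt_top b hb)

theorem hasDerivAt (h : MemX Ω t₀ u ut) {t : ℝ} (ht : t ∈ Ioo 0 t₀) :
    HasDerivAt (fun s => toL2 (u s)) (ut t) t :=
  (h.hasDerivWithinAt t (Ioo_subset_Ico_self ht)).hasDerivAt (Ico_mem_nhds ht.1 ht.2)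

end MemX

theorem Represents.inner_toL2 {v : H10 Ω} {φ : E3 → ℝ} (hv : Represents v φ) (w : L2 Ω) :
    ∫ x in Ω, w x * φ x = inner ℝ (toL2 v) w := by
  rw [L2.inner_def]
  refine integral_congr_ae ?_
  filter_upwards [hv.coe] with x hx
  simp [hx]

theorem Represents.integral_mul_laplacian {v : H10 Ω} {φ : E3 → ℝ}
    (hv : Represents v φ) (w : H10 Ω) :
    ∫ x in Ω, toL2 w x * Laplacian.laplacian φ x = - inner ℝ (gradH v) (gradH w) := by
  rw [NLW.integral_mul_laplacian hv.isTest w, L2.inner_def]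
  congr 1
  refine integral_congr_ae ?_
  filter_upwards [hv.grad] with x hx
  rw [hx, real_inner_comm]

theorem continuous_laplacian {φ : E3 → ℝ} (h : ContDiff ℝ ∞ φ) :
    Continuous (Laplacian.laplacian φ) := by
  have := continuous_dv_fderiv ((contDiff_gradient h).of_le (m := 1) (by norm_cast))
  exact this.congr (dv_fderiv_gradient h)

theorem laplacian_eq_zero_of_notMem {φ : E3 → ℝ} {x : E3}
    (hx : x ∉ tsupport φ) : Laplacian.laplacian φ x = 0 := by
  have : φ =ᶠ[𝓝 x] fun _ => 0 := notMem_tsupport_iff_eventuallyEq.1 hx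
  rw [(InnerProductSpace.laplacian_congr_nhds this).eq_of_nhds]
  simp

theorem IsTest.memLp_laplacian {φ : E3 → ℝ} (h : IsTest Ω φ) :
    MemLp (Laplacian.laplacian φ) 2 (volume.restrict Ω) :=
  MemLp.restrict Ω ((continuous_laplacian h.contDiff).memLp_of_hasCompactSupport
    (HasCompactSupport.intro h.compact fun _ hx => laplacian_eq_zero_of_notMem hx))

/-- The integrand of the weak formulation for a test function in separated variables. -/
theorem integral_separated {v w : H10 Ω} {φ : E3 → ℝ} (hv : Represents v φ)
    (hw : MemLp (toL2 w) 10 (volume.restrict Ω)) (c d : ℝ) :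
    ∫ x in Ω, (toL2 w x * (d * φ x - c * Laplacian.laplacian φ x)
        + toL2 w x ^ 5 * (c * φ x)) =
      d * inner ℝ (toL2 v) (toL2 w) + c * inner ℝ (gradH v) (gradH w)
        + c * inner ℝ (toL2 v) (fifth (toL2 w)) := by
  have i1 : Integrable (fun x => toL2 w x * φ x) (volume.restrict Ω) :=
    (Lp.memLp (toL2 w)).integrable_mul (hv.isTest.memLp 2)
  have i2 : Integrable (fun x => toL2 w x * Laplacian.laplacian φ x) (volume.restrict Ω) :=
    (Lp.memLp (toL2 w)).integrable_mul hv.isTest.memLp_laplacian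
  have i3 : Integrable (fun x => fifth (toL2 w) x * φ x) (volume.restrict Ω) :=
    (Lp.memLp (fifth (toL2 w))).integrable_mul (hv.isTest.memLp 2)
  rw [← hv.inner_toL2, ← hv.inner_toL2, ← neg_neg (inner ℝ (gradH v) (gradH w)),
    ← hv.integral_mul_laplacian]
  have i12 := (i1.const_mul d).add (i2.const_mul (-c))
  calc _ = ∫ x in Ω, (((fun x => d * (toL2 w x * φ x)) +
          fun x => -c * (toL2 w x * Laplacian.laplacian φ x)) +
          fun x => c * (fifth (toL2 w) x * φ x)) x := by
        refine integral_congr_ae ?_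
        filter_upwards [fifth_coe hw] with x hx
        simp only [Pi.add_apply, hx]
        ring
    _ = _ := by
        rw [integral_add' i12 (i3.const_mul c), integral_add' (i1.const_mul d) (i2.const_mul (-c)),
          integral_const_mul, integral_const_mul, integral_const_mul]
        ring

theorem tsupport_separated_subset {k : ℝ → ℝ} {φ : E3 → ℝ} {δ t : ℝ}
    (hs : Function.support k ⊆ Metric.ball 0 δ) :
    tsupport (fun p : ℝ × E3 => k (t - p.1) * φ p.2) ⊆ Icc (t - δ) (t + δ) ×ˢ tsupport φ := by
  refine closure_minimal (fun p hp => ?_) (isClosed_Icc.prod (isClosed_tsupport φ))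
  have h1 : k (t - p.1) ≠ 0 := fun h => hp (by simp [h])
  have h2 : φ p.2 ≠ 0 := fun h => hp (by simp [h])
  have := hs (Function.mem_support.2 h1)
  rw [mem_ball_zero_iff, Real.norm_eq_abs, abs_lt] at this
  exact ⟨⟨by linarith, by linarith⟩, subset_tsupport φ (Function.mem_support.2 h2)⟩

theorem iteratedDeriv_two_comp_sub {k : ℝ → ℝ} (hk : ContDiff ℝ ∞ k) (t s c : ℝ) :
    iteratedDeriv 2 (fun r => k (t - r) * c) s = deriv (deriv k) (t - s) * c := by
  have h1 : deriv (fun r => k (t - r) * c) = fun r => deriv k (t - r) * (-c) := by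
    funext r
    have := (HasDerivAt.comp_const_sub t r
      (hk.differentiable (by simp) (t - r)).hasDerivAt).mul_const c
    rw [this.deriv]
    ring
  have hk' : ContDiff ℝ ∞ (deriv k) := hk.deriv' (n := ∞)
  rw [iteratedDeriv_succ, iteratedDeriv_one, h1]
  have := (HasDerivAt.comp_const_sub t s
      (hk'.differentiable (by simp) (t - s)).hasDerivAt).mul_const (-c)
  rw [this.deriv]
  ring

theorem MemX.integrable_indicator (h : MemX Ω t₀ u ut) {a b : ℝ} (ha : 0 ≤ a) (hb : b < t₀) :
    Integrable ((Icc a b).indicator u) := by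
  have : IntegrableOn u (Icc a b) := ContinuousOn.integrableOn_compact isCompact_Icc
    (h.continuousOn.mono fun t ht => ⟨ha.trans ht.1, ht.2.trans_lt hb⟩)
  exact this.integrable_indicator measurableSet_Icc

theorem MemX.integrable_indicator_fifth (h : MemX Ω t₀ u ut) {a b : ℝ} (ha : 0 ≤ a) (hab : a ≤ b)
    (hb : b < t₀) : Integrable ((Icc a b).indicator fun t => fifth (toL2 (u t))) := by
  rw [integrable_indicator_iff measurableSet_Icc]
  exact (h.integrableOn_fifth ⟨ha.trans hab, hb⟩).mono_set (Icc_subset_Icc_left ha)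

/-- The wave equation for functions mollified in time. -/
theorem mollified_equation (h : MemX Ω t₀ u ut) (heq : SatisfiesNLW Ω t₀ u) {a b t δ : ℝ}
    (ha : 0 < a) (hb : b < t₀) {k : ℝ → ℝ} (hδ : 0 < δ) (hk : IsKernel k δ)
    (hab : Icc (t - δ) (t + δ) ⊆ Icc a b) (v : H10 Ω) :
    inner ℝ (toL2 v) (toL2 (mol (deriv (deriv k)) ((Icc a b).indicator u) t)) +
      inner ℝ (gradH v) (gradH (mol k ((Icc a b).indicator u) t)) +
      inner ℝ (toL2 v) (mol k ((Icc a b).indicator fun t => fifth (toL2 (u t))) t) = 0 := by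
  have hk1 : ContDiff ℝ ∞ (deriv k) := hk.contDiff.deriv' (n := ∞)
  have hk2 : ContDiff ℝ ∞ (deriv (deriv k)) := hk1.deriv' (n := ∞)
  have hab' : a ≤ b := by
    have := hab (left_mem_Icc.2 (by linarith))
    exact this.1.trans this.2
  have hiu := h.integrable_indicator ha.le hb
  have hif := h.integrable_indicator_fifth ha.le hab' hb
  revert v
  -- All three pairings are continuous in v, so v may be assumed to come from a test function φ.
  apply H10.induction
  · exact isClosed_eq (((continuous_toL2.inner continuous_const).add
      (continuous_gradH.inner continuous_const)).add
      (continuous_toL2.inner continuous_const)) continuous_const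
  intro v φ hv
  have hφ := hv.isTest
  have m1 := map_mol ((innerSL ℝ (toL2 v)).comp (toL2L Ω)) hk2.continuous hk.compact.deriv.deriv
    hiu t
  have m2 := map_mol ((innerSL ℝ (gradH v)).comp (gradL Ω)) hk.contDiff.continuous hk.compact
    hiu t
  have m3 := map_mol (innerSL ℝ (toL2 v)) hk.contDiff.continuous hk.compact hif t
  simp only [ContinuousLinearMap.comp_apply, toL2L_apply, gradL_apply, innerSL_apply_apply]
    at m1 m2 m3
  have i1 := integrable_mol hk2.continuous hk.compact.deriv.deriv
    (((innerSL ℝ (toL2 v)).comp (toL2L Ω)).integrable_comp hiu) t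
  have i2 := integrable_mol hk.contDiff.continuous hk.compact
    (((innerSL ℝ (gradH v)).comp (gradL Ω)).integrable_comp hiu) t
  have i3 := integrable_mol hk.contDiff.continuous hk.compact
    ((innerSL ℝ (toL2 v)).integrable_comp hif) t
  simp only [ContinuousLinearMap.comp_apply, toL2L_apply, gradL_apply, innerSL_apply_apply]
    at i1 i2 i3
  have i12 : Integrable fun s =>
      deriv (deriv k) (t - s) • inner ℝ (toL2 v) (toL2 ((Icc a b).indicator u s)) +
        k (t - s) • inner ℝ (gradH v) (gradH ((Icc a b).indicator u s)) := i1.add i2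
  rw [m1, m2, m3, mol_apply, mol_apply, mol_apply, ← integral_add i1 i2, ← integral_add i12 i3]
  have hts : tsupport k ⊆ Metric.closedBall 0 δ :=
    closure_minimal (hk.support.trans Metric.ball_subset_closedBall) Metric.isClosed_closedBall
  have hts1 : tsupport (deriv k) ⊆ Metric.closedBall 0 δ :=
    (closure_minimal support_deriv_subset (isClosed_tsupport k)).trans hts
  have hz : ∀ s ∉ Icc a b, t - s ∉ Metric.closedBall (0 : ℝ) δ := fun s hs hs' => by
    rw [mem_closedBall_zero_iff, Real.norm_eq_abs, abs_le] at hs'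
    exact hs (hab ⟨by linarith, by linarith⟩)
  have z1 : ∀ s ∉ Icc a b, k (t - s) = 0 := fun s hs =>
    image_eq_zero_of_notMem_tsupport fun h' => hz s hs (hts h')
  have z2 : ∀ s ∉ Icc a b, deriv (deriv k) (t - s) = 0 := fun s hs => by
    by_contra h'
    exact hz s hs (hts1 (support_deriv_subset (Function.mem_support.2 h')))
  have hsub : Icc a b ⊆ Ioo 0 t₀ := fun s hs => ⟨ha.trans_le hs.1, hs.2.trans_lt hb⟩
  have hsupp := tsupport_separated_subset (φ := φ) (t := t) hk.support
  -- The distributional equation is tested with k(t - s) φ(x) in the variables (s, x): its integrand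
  -- is the convolution integrand. Two derivatives in s of k(t - s) give k'' with a positive sign.
  have main := heq (fun p => k (t - p.1) * φ p.2)
    ((hk.contDiff.comp (contDiff_const.sub contDiff_fst)).mul (hφ.contDiff.comp contDiff_snd))
    ((isCompact_Icc.prod hφ.compact).of_isClosed_subset (isClosed_tsupport _) hsupp)
    (hsupp.trans (prod_mono (hab.trans hsub) hφ.subset))
  rw [← setIntegral_eq_integral_of_forall_compl_eq_zero (s := Ioo 0 t₀)]
  · refine Eq.trans ?_ main
    -- For almost every s the function u(s) is in L¹⁰, so that its fifth power may be integrated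
    -- against φ.
    refine setIntegral_congr_ae (measurableSet_Ioo : MeasurableSet (Ioo 0 t₀)) ?_
    have hae := h.ae_memLp ⟨ha.le.trans hab', hb⟩
    rw [ae_restrict_iff' measurableSet_Icc] at hae
    filter_upwards [hae] with s hs _
    have hlap : ∀ x, Laplacian.laplacian (fun y => k (t - s) * φ y) x =
        k (t - s) * Laplacian.laplacian φ x := fun x =>
      InnerProductSpace.laplacian_smul (k (t - s))
        ((hφ.contDiff.of_le (by norm_cast)).contDiffAt)
    simp only [iteratedDeriv_two_comp_sub hk.contDiff, hlap]
    by_cases hsab : s ∈ Icc a b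
    · rw [integral_separated hv (hs ⟨ha.le.trans hsab.1, hsab.2⟩)]
      simp only [indicator_of_mem hsab, smul_eq_mul]
    · simp [z1 s hsab, z2 s hsab]
  · intro s hs
    have hsab : s ∉ Icc a b := fun h' => hs (hsub h')
    simp [z1 s hsab, z2 s hsab]

end

/-! ### Time-dependent quadratic forms and passage to the limit in differential inequalities. -/

section

section Forms

set_option linter.unusedSectionVars false

variable {G E F H : Type*} [NormedAddCommGroup G] [NormedSpace ℝ G]
  [NormedAddCommGroup E] [InnerProductSpace ℝ E] [NormedAddCommGroup F] [InnerProductSpace ℝ F]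
  [NormedAddCommGroup H] [InnerProductSpace ℝ H]

/-- Continuous time-dependent functions with quadratic growth. -/
structure IsForm (J : Set ℝ) (r : ℝ → G → ℝ) : Prop where
  cont : ContinuousOn (Function.uncurry r) (J ×ˢ univ)
  bound : ∃ C, 0 ≤ C ∧ ∀ t ∈ J, ∀ x, |r t x| ≤ C * ‖x‖ ^ 2

namespace IsForm

variable {J : Set ℝ} {r r' : ℝ → G → ℝ}

theorem add (h : IsForm J r) (h' : IsForm J r') : IsForm J fun t x => r t x + r' t x := by
  refine ⟨h.cont.add h'.cont, ?_⟩
  obtain ⟨C, hC, hb⟩ := h.bound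
  obtain ⟨D, hD, hb'⟩ := h'.bound
  exact ⟨C + D, by positivity, fun t ht x => (abs_add_le _ _).trans
    (by linarith [hb t ht x, hb' t ht x])⟩

theorem const_mul (h : IsForm J r) (c : ℝ) : IsForm J fun t x => c * r t x := by
  refine ⟨continuousOn_const.mul h.cont, ?_⟩
  obtain ⟨C, hC, hb⟩ := h.bound
  refine ⟨|c| * C, by positivity, fun t ht x => ?_⟩
  rw [abs_mul, mul_assoc]
  exact mul_le_mul_of_nonneg_left (hb t ht x) (abs_nonneg c)

theorem sub (h : IsForm J r) (h' : IsForm J r') : IsForm J fun t x => r t x - r' t x := by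
  simpa [sub_eq_add_neg] using h.add (h'.const_mul (-1))

theorem div_const (h : IsForm J r) (c : ℝ) : IsForm J fun t x => r t x / c := by
  simpa [div_eq_inv_mul] using h.const_mul c⁻¹

theorem inner_clm (hJ : IsCompact J) {A : ℝ → CLM E F} (hA : ContinuousOn A J) (L : CLM G E)
    (L' : CLM G F) : IsForm J fun t x => inner ℝ (A t (L x)) (L' x) := by
  constructor
  · have h1 : ContinuousOn (fun p : ℝ × G => A p.1) (J ×ˢ univ) :=
      hA.comp continuousOn_fst fun p hp => hp.1
    exact (h1.clm_apply (L.continuous.comp continuous_snd).continuousOn).inner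
      (L'.continuous.comp continuous_snd).continuousOn
  · obtain ⟨C, hC⟩ := hJ.exists_bound_of_continuousOn hA
    have hC' : ∀ t ∈ J, ‖A t‖ ≤ |C| := fun t ht => (hC t ht).trans (le_abs_self C)
    refine ⟨|C| * ‖L‖ * ‖L'‖, by positivity, fun t ht x => ?_⟩
    calc |inner ℝ (A t (L x)) (L' x)| ≤ ‖A t (L x)‖ * ‖L' x‖ := abs_real_inner_le_norm _ _
      _ ≤ (|C| * (‖L‖ * ‖x‖)) * (‖L'‖ * ‖x‖) := by
          gcongr
          · exact ((A t).le_of_opNorm_le (hC' t ht) _).trans (by gcongr; exact L.le_opNorm x)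
          · exact L'.le_opNorm x
      _ = |C| * ‖L‖ * ‖L'‖ * ‖x‖ ^ 2 := by ring

theorem continuousOn_comp (h : IsForm J r) {x : ℝ → G} (hx : ContinuousOn x J) :
    ContinuousOn (fun t => r t (x t)) J :=
  h.cont.comp (continuousOn_id.prodMk hx) fun _ ht => ⟨ht, mem_univ _⟩

theorem continuous_apply (h : IsForm J r) {t : ℝ} (ht : t ∈ J) : Continuous (r t) := by
  rw [← continuousOn_univ]
  exact h.cont.comp (f := fun x => (t, x)) (by fun_prop) fun x _ => ⟨ht, mem_univ _⟩

end IsForm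

theorem integrableOn_inner {S T : ℝ} {f y : ℝ → H} (hf : IntegrableOn f (Icc S T))
    (hy : ContinuousOn y (Icc S T)) : IntegrableOn (fun t => inner ℝ (f t) (y t)) (Icc S T) := by
  obtain ⟨C, hC⟩ := isCompact_Icc.exists_bound_of_continuousOn hy
  refine Integrable.mono' (g := fun t => ‖f t‖ * C) (hf.norm.mul_const C)
    (hf.aestronglyMeasurable.inner (hy.aestronglyMeasurable measurableSet_Icc)) ?_
  filter_upwards [ae_restrict_mem measurableSet_Icc] with t ht
  exact (norm_inner_le_norm _ _).trans (mul_le_mul_of_nonneg_left (hC t ht) (norm_nonneg _))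

theorem tendsto_integral_inner {S T : ℝ} {f : ℝ → H} {fn : ℕ → ℝ → H} {y : ℝ → H}
    {yn : ℕ → ℝ → H} {C : ℝ} (hf : IntegrableOn f (Icc S T))
    (hfn : ∀ n, IntegrableOn (fn n) (Icc S T))
    (hyn : ∀ n, ContinuousOn (yn n) (Icc S T)) (hC : ∀ n, ∀ t ∈ Icc S T, ‖yn n t‖ ≤ C)
    (hlim : ∀ t ∈ Icc S T, Tendsto (fun n => yn n t) atTop (𝓝 (y t)))
    (hL1 : Tendsto (fun n => ∫ t in Icc S T, ‖fn n t - f t‖) atTop (𝓝 0)) :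
    Tendsto (fun n => ∫ t in Icc S T, inner ℝ (fn n t) (yn n t)) atTop
      (𝓝 (∫ t in Icc S T, inner ℝ (f t) (y t))) := by
  have h1 : Tendsto (fun n => ∫ t in Icc S T, inner ℝ (f t) (yn n t)) atTop
      (𝓝 (∫ t in Icc S T, inner ℝ (f t) (y t))) := by
    refine tendsto_integral_of_dominated_convergence (fun t => ‖f t‖ * C)
      (fun n => (integrableOn_inner hf (hyn n)).aestronglyMeasurable) (hf.norm.mul_const C)
      (fun n => ?_) ?_
    · filter_upwards [ae_restrict_mem measurableSet_Icc] with t ht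
      exact (norm_inner_le_norm _ _).trans (mul_le_mul_of_nonneg_left (hC n t ht) (norm_nonneg _))
    · filter_upwards [ae_restrict_mem measurableSet_Icc] with t ht
      exact tendsto_const_nhds.inner (hlim t ht)
  have h2 : Tendsto (fun n => ∫ t in Icc S T, inner ℝ (fn n t - f t) (yn n t)) atTop (𝓝 0) := by
    refine squeeze_zero_norm (a := fun n => (∫ t in Icc S T, ‖fn n t - f t‖) * C) (fun n => ?_)
      (by simpa using hL1.mul_const C)
    rw [← integral_mul_const]
    refine norm_integral_le_of_norm_le (((hfn n).sub hf).norm.mul_const C) ?_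
    filter_upwards [ae_restrict_mem measurableSet_Icc] with t ht
    exact (norm_inner_le_norm _ _).trans (mul_le_mul_of_nonneg_left (hC n t ht) (norm_nonneg _))
  have h3 := h2.add h1
  rw [zero_add] at h3
  refine h3.congr fun n => ?_
  rw [← integral_add (f := fun t => inner ℝ (fn n t - f t) (yn n t))
    (integrableOn_inner ((hfn n).sub hf) (hyn n)) (integrableOn_inner hf (hyn n))]
  refine integral_congr_ae (Eventually.of_forall fun t => ?_)
  simp only [inner_sub_left, sub_add_cancel]

theorem IsForm.tendsto_integral {S T : ℝ} {r : ℝ → G → ℝ} (hr : IsForm (Icc S T) r) {x : ℝ → G}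
    {xn : ℕ → ℝ → G} {C : ℝ} (hxn : ∀ n, ContinuousOn (xn n) (Icc S T))
    (hC : ∀ n, ∀ t ∈ Icc S T, ‖xn n t‖ ≤ C)
    (hlim : ∀ t ∈ Icc S T, Tendsto (fun n => xn n t) atTop (𝓝 (x t))) :
    Tendsto (fun n => ∫ t in Icc S T, r t (xn n t)) atTop (𝓝 (∫ t in Icc S T, r t (x t))) := by
  obtain ⟨D, hD, hb⟩ := hr.bound
  refine tendsto_integral_of_dominated_convergence (fun _ => D * C ^ 2)
    (fun n => (hr.continuousOn_comp (hxn n)).aestronglyMeasurable measurableSet_Icc)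
    (integrable_const _) (fun n => ?_) ?_
  · filter_upwards [ae_restrict_mem measurableSet_Icc] with t ht
    refine (hb t ht _).trans ?_
    have := hC n t ht
    gcongr
  · filter_upwards [ae_restrict_mem measurableSet_Icc] with t ht
    exact ((hr.continuous_apply ht).tendsto _).comp (hlim t ht)

/-- The differential inequality is integrated for each approximant and then passed to the limit. The
states converge pointwise and boundedly, which suffices for forms of quadratic growth. The sources
converge only in L¹ in time, which suffices because they are paired with uniformly bounded vectors.
-/
theorem le_integral_of_approx {S T : ℝ} (hST : S ≤ T) {e r : ℝ → G → ℝ} {Z : ℝ → CLM G H}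
    (he : IsForm (Icc S T) e) (hr : IsForm (Icc S T) r) (hZ : ContinuousOn Z (Icc S T))
    {x : ℝ → G} {xn : ℕ → ℝ → G} {f : ℝ → H} {fn : ℕ → ℝ → H} {C : ℝ}
    (hxn : ∀ n, ContinuousOn (xn n) (Icc S T))
    (hC : ∀ n, ∀ t ∈ Icc S T, ‖xn n t‖ ≤ C)
    (hlim : ∀ t ∈ Icc S T, Tendsto (fun n => xn n t) atTop (𝓝 (x t)))
    (hf : IntegrableOn f (Icc S T)) (hfn : ∀ n, IntegrableOn (fn n) (Icc S T))
    (hL1 : Tendsto (fun n => ∫ t in Icc S T, ‖fn n t - f t‖) atTop (𝓝 0))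
    (hd : ∀ n, ∀ t ∈ Icc S T, ∃ d, HasDerivAt (fun t => e t (xn n t)) d t ∧
      d ≤ r t (xn n t) - inner ℝ (fn n t) (Z t (xn n t))) :
    e T (x T) - e S (x S) ≤ (∫ t in Icc S T, r t (x t)) -
      ∫ t in Icc S T, inner ℝ (f t) (Z t (x t)) := by
  obtain ⟨D, hD⟩ := isCompact_Icc.exists_bound_of_continuousOn hZ
  have l1 : Tendsto (fun n => e T (xn n T) - e S (xn n S)) atTop (𝓝 (e T (x T) - e S (x S))) :=
    (((he.continuous_apply (right_mem_Icc.2 hST)).tendsto _).comp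
      (hlim T (right_mem_Icc.2 hST))).sub
      (((he.continuous_apply (left_mem_Icc.2 hST)).tendsto _).comp (hlim S (left_mem_Icc.2 hST)))
  have hyn : ∀ n, ContinuousOn (fun t => Z t (xn n t)) (Icc S T) := fun n => hZ.clm_apply (hxn n)
  have l2 := hr.tendsto_integral hxn hC hlim
  have l3 := tendsto_integral_inner (yn := fun n t => Z t (xn n t)) (C := |D| * C) hf hfn hyn (fun n t ht => by
      refine ((Z t).le_of_opNorm_le ((hD t ht).trans (le_abs_self D)) _).trans ?_
      exact mul_le_mul_of_nonneg_left (hC n t ht) (abs_nonneg D))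
    (fun t ht => ((Z t).continuous.tendsto _).comp (hlim t ht)) hL1
  refine le_of_tendsto_of_tendsto' l1 (l2.sub l3) fun n => ?_
  choose! d hd1 hd2 using hd n
  have i1 : IntegrableOn (fun t => r t (xn n t)) (Icc S T) :=
    (hr.continuousOn_comp (hxn n)).integrableOn_compact isCompact_Icc
  have i2 := integrableOn_inner (hfn n) (hyn n)
  have key := intervalIntegral.sub_le_integral_of_hasDeriv_right_of_le hST
    (g := fun t => e t (xn n t)) (g' := d)
    (φ := fun t => r t (xn n t) - inner ℝ (fn n t) (Z t (xn n t)))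
    (fun t ht => (hd1 t ht).continuousAt.continuousWithinAt)
    (fun t ht => (hd1 t (Ioo_subset_Icc_self ht)).hasDerivWithinAt) (i1.sub i2)
    (fun t ht => hd2 t (Ioo_subset_Icc_self ht))
  rwa [intervalIntegral.integral_of_le hST, ← integral_Icc_eq_integral_Ioc,
    integral_sub i1 i2] at key

theorem hasDerivAt_inner_clm {A : ℝ → CLM E F} {A' : CLM E F} {x : ℝ → E} {x' : E} {y : ℝ → F}
    {y' : F} {t : ℝ} (hA : HasDerivAt A A' t) (hx : HasDerivAt x x' t) (hy : HasDerivAt y y' t) :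
    HasDerivAt (fun s => inner ℝ (A s (x s)) (y s))
      (inner ℝ (A t (x t)) y' + (inner ℝ (A' (x t)) (y t) + inner ℝ (A t x') (y t))) t := by
  rw [← inner_add_left]
  exact (hA.clm_apply hx).inner ℝ hy

end Forms

end

/-! ### Multipliers, their quadratic energies and rates of change. -/

section

variable {Ω : Set E3}

/-- The data of a multiplier `a ∂ₜu + X · ∇u + b u`, with the time derivatives of its
coefficients. -/
structure Multiplier where
  a : ℝ → E3 → ℝ
  a' : ℝ → E3 → ℝ
  b : ℝ → E3 → ℝ
  b' : ℝ → E3 → ℝ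
  X : ℝ → E3 → E3
  X' : ℝ → E3 → E3

/-- Admissible multipliers: smooth coefficients, and a pushing vector field. -/
structure IsMultiplier (Ω : Set E3) (I : Set ℝ) (m : Multiplier) : Prop where
  smooth_a : ∀ t ∈ I, ContDiff ℝ ∞ (m.a t)
  smooth_b : ∀ t ∈ I, ContDiff ℝ ∞ (m.b t)
  pushing : ∀ t ∈ I, IsPushing Ω (m.X t)
  hasDerivAt_a : ∀ t ∈ I, ∀ x, HasDerivAt (fun s => m.a s x) (m.a' t x) t
  hasDerivAt_b : ∀ t ∈ I, ∀ x, HasDerivAt (fun s => m.b s x) (m.b' t x) t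
  hasDerivAt_X : ∀ t ∈ I, ∀ x, HasDerivAt (fun s => m.X s x) (m.X' t x) t
  cont_a' : ContinuousOn (Function.uncurry m.a') (I ×ˢ univ)
  cont_b' : ContinuousOn (Function.uncurry m.b') (I ×ˢ univ)
  cont_X' : ContinuousOn (Function.uncurry m.X') (I ×ˢ univ)
  cont_gradient_a : ContinuousOn (Function.uncurry fun t => gradient (m.a t)) (I ×ˢ univ)
  cont_gradient_b : ContinuousOn (Function.uncurry fun t => gradient (m.b t)) (I ×ˢ univ)
  cont_fderiv : ContinuousOn (Function.uncurry fun t => fderiv ℝ (m.X t)) (I ×ˢ univ)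

namespace Multiplier

/-- The quadratic part of the energy attached to a multiplier. -/
def energy (m : Multiplier) (Ω : Set E3) (t : ℝ) (z : H10 Ω × L2 Ω) : ℝ :=
  (inner ℝ (smulOp Ω ℝ 2 (m.a t) z.2) z.2 +
    inner ℝ (smulOp Ω E3 2 (m.a t) (gradH z.1)) (gradH z.1)) / 2 +
  inner ℝ (dotOp Ω (m.X t) (gradH z.1)) z.2 + inner ℝ (smulOp Ω ℝ 2 (m.b t) (toL2 z.1)) z.2

/-- The quadratic part of the rate of change of the energy. -/
def rate (m : Multiplier) (Ω : Set E3) (t : ℝ) (z : H10 Ω × L2 Ω) : ℝ :=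
  (inner ℝ (smulOp Ω ℝ 2 (m.a' t) z.2) z.2 +
    inner ℝ (smulOp Ω E3 2 (m.a' t) (gradH z.1)) (gradH z.1)) / 2 -
  inner ℝ (dotOp Ω (gradient (m.a t)) (gradH z.1)) z.2 +
  inner ℝ (dotOp Ω (m.X' t) (gradH z.1)) z.2 -
  inner ℝ (smulOp Ω ℝ 2 (fun x => dv (fderiv ℝ (m.X t) x)) z.2) z.2 / 2 +
  inner ℝ (smulOp Ω E3 2 (fun x => dv (fderiv ℝ (m.X t) x)) (gradH z.1)) (gradH z.1) / 2 -
  inner ℝ (adjOp Ω (m.X t) (gradH z.1)) (gradH z.1) +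
  inner ℝ (smulOp Ω ℝ 2 (m.b' t) (toL2 z.1)) z.2 +
  inner ℝ (smulOp Ω ℝ 2 (m.b t) z.2) z.2 -
  inner ℝ (smulOp Ω E3 2 (m.b t) (gradH z.1)) (gradH z.1) -
  inner ℝ (dotOp Ω (gradient (m.b t)) (gradH z.1)) (toL2 z.1)

/-- The multiplier, as an operator. -/
def flux (m : Multiplier) (Ω : Set E3) (t : ℝ) : CLM (H10 Ω × L2 Ω) (L2 Ω) :=
  (smulOp Ω ℝ 2 (m.a t)).comp (ContinuousLinearMap.snd ℝ (H10 Ω) (L2 Ω)) +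
  (dotOp Ω (m.X t)).comp ((gradL Ω).comp (ContinuousLinearMap.fst ℝ (H10 Ω) (L2 Ω))) +
  (smulOp Ω ℝ 2 (m.b t)).comp ((toL2L Ω).comp (ContinuousLinearMap.fst ℝ (H10 Ω) (L2 Ω)))

theorem flux_apply (m : Multiplier) (t : ℝ) (z : H10 Ω × L2 Ω) :
    m.flux Ω t z = smulOp Ω ℝ 2 (m.a t) z.2 + dotOp Ω (m.X t) (gradH z.1) +
      smulOp Ω ℝ 2 (m.b t) (toL2 z.1) := rfl

end Multiplier

theorem inner_smulOp_comm {E : Type*} [NormedAddCommGroup E] [InnerProductSpace ℝ E]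
    (hΩ : Bornology.IsBounded Ω) (ho : IsOpen Ω) [FiniteDimensional ℝ E] {b : E3 → ℝ}
    (hb : Continuous b) (v w : Lp E 2 (volume.restrict Ω)) :
    inner ℝ (smulOp Ω E 2 b v) w = inner ℝ (smulOp Ω E 2 b w) v := by
  have h := memLp_top_of_continuous hΩ ho.measurableSet (continuous_smul_id (E := E) hb)
  rw [inner_mulOp h, inner_mulOp h]
  refine integral_congr_ae (Eventually.of_forall fun x => ?_)
  simp [inner_smul_left, real_inner_comm]

theorem inner_spanOp (hΩ : Bornology.IsBounded Ω) (ho : IsOpen Ω) {Y : E3 → E3}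
    (hY : Continuous Y) (ξ : L2Vec Ω) (q : L2 Ω) :
    inner ℝ (spanOp Ω Y q) ξ = inner ℝ (dotOp Ω Y ξ) q := by
  rw [inner_mulOp (memLp_top_of_continuous hΩ ho.measurableSet (continuous_toSpanSingleton hY)),
    inner_mulOp (memLp_top_of_continuous hΩ ho.measurableSet (continuous_innerSL hY))]
  refine integral_congr_ae (Eventually.of_forall fun x => ?_)
  simp [inner_smul_left]

theorem isPrimitive_id : IsPrimitive (fun r => r ^ 2 / 2) (fun r => r) 1 where
  deriv r := by
    have := ((hasDerivAt_id r).pow 2).div_const 2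
    simpa using this
  lip := LipschitzWith.id
  map_zero := rfl
  prim_zero := by norm_num

/-- The case G(r) = r²/2 of the integration by parts formula. -/
theorem inner_dotOp_self (hΩ : Bornology.IsBounded Ω) (ho : IsOpen Ω) {X : E3 → E3}
    (hX : ContDiff ℝ 1 X) (v : H10 Ω) :
    inner ℝ (dotOp Ω X (gradH v)) (toL2 v) =
      - (inner ℝ (smulOp Ω ℝ 2 (fun x => dv (fderiv ℝ X x)) (toL2 v)) (toL2 v) / 2) := by
  have h := isPrimitive_id.inner_dotOp hΩ ho hX v
  have e : isPrimitive_id.comp (toL2 v) = toL2 v :=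
    Lp.ext (isPrimitive_id.comp_coe (toL2 v))
  rw [e] at h
  rw [h, inner_mulOp (memLp_top_of_continuous hΩ ho.measurableSet
    (continuous_smul_id (continuous_dv_fderiv hX))), potential, ← integral_div]
  congr 1
  refine integral_congr_ae (Eventually.of_forall fun x => ?_)
  simp
  ring

theorem continuousOn_smulOp (hΩ : Bornology.IsBounded Ω) (ho : IsOpen Ω) {I : Set ℝ}
    {b : ℝ → E3 → ℝ} (hb : ContinuousOn (Function.uncurry b) (I ×ˢ univ)) {E : Type*}
    [NormedAddCommGroup E] [InnerProductSpace ℝ E] [FiniteDimensional ℝ E] :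
    ContinuousOn (fun t => smulOp Ω E 2 (b t)) I :=
  continuousOn_mulOp hΩ ho.measurableSet (A := fun t x => b t x • ContinuousLinearMap.id ℝ E)
    (hb.smul continuousOn_const)

theorem continuousOn_dotOp (hΩ : Bornology.IsBounded Ω) (ho : IsOpen Ω) {I : Set ℝ}
    {Y : ℝ → E3 → E3} (hY : ContinuousOn (Function.uncurry Y) (I ×ˢ univ)) :
    ContinuousOn (fun t => dotOp Ω (Y t)) I :=
  continuousOn_mulOp hΩ ho.measurableSet (A := fun t x => innerSL ℝ (Y t x))
    ((innerSL ℝ (E := E3)).continuous.comp_continuousOn hY)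

theorem hasDerivAt_dotOp (hΩ : Bornology.IsBounded Ω) (ho : IsOpen Ω) {I : Set ℝ} (hI : IsOpen I)
    {Y Y' : ℝ → E3 → E3} (hY : ∀ t ∈ I, Continuous (Y t))
    (hd : ∀ t ∈ I, ∀ x, HasDerivAt (fun s => Y s x) (Y' t x) t)
    (hY' : ContinuousOn (Function.uncurry Y') (I ×ˢ univ)) {t : ℝ} (ht : t ∈ I) :
    HasDerivAt (fun t => dotOp Ω (Y t)) (dotOp Ω (Y' t)) t :=
  hasDerivAt_mulOp hΩ ho.measurableSet hI (A := fun t x => innerSL ℝ (Y t x))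
    (A' := fun t x => innerSL ℝ (Y' t x)) (fun t ht => continuous_innerSL (hY t ht))
    (fun t ht x => (innerSL ℝ (E := E3)).hasFDerivAt.comp_hasDerivAt t (hd t ht x))
    ((innerSL ℝ (E := E3)).continuous.comp_continuousOn hY') ht

theorem continuousOn_adjOp (hΩ : Bornology.IsBounded Ω) (ho : IsOpen Ω) {I : Set ℝ}
    {Y : ℝ → E3 → E3}
    (hY : ContinuousOn (Function.uncurry fun t => fderiv ℝ (Y t)) (I ×ˢ univ)) :
    ContinuousOn (fun t => adjOp Ω (Y t)) I :=
  continuousOn_mulOp hΩ ho.measurableSet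
    (A := fun t x => ContinuousLinearMap.adjoint (fderiv ℝ (Y t) x))
    ((ContinuousLinearMap.adjoint (𝕜 := ℝ) (E := E3) (F := E3)).continuous.comp_continuousOn hY)

namespace IsMultiplier

variable {I J : Set ℝ} {m : Multiplier}

theorem continuousOn_smulOp_a (h : IsMultiplier Ω I m) (hΩ : Bornology.IsBounded Ω)
    (ho : IsOpen Ω) (hI : IsOpen I) {E : Type*} [NormedAddCommGroup E] [InnerProductSpace ℝ E]
    [FiniteDimensional ℝ E] : ContinuousOn (fun t => smulOp Ω E 2 (m.a t)) I := fun t ht => by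
  have := hasDerivAt_smulOp (E := E) (p := 2) (a := m.a) (a' := m.a') hΩ ho hI
    (fun t ht => (h.smooth_a t ht).continuous) h.hasDerivAt_a h.cont_a' ht
  exact this.continuousAt.continuousWithinAt

theorem continuousOn_smulOp_b (h : IsMultiplier Ω I m) (hΩ : Bornology.IsBounded Ω)
    (ho : IsOpen Ω) (hI : IsOpen I) {E : Type*} [NormedAddCommGroup E] [InnerProductSpace ℝ E]
    [FiniteDimensional ℝ E] : ContinuousOn (fun t => smulOp Ω E 2 (m.b t)) I := fun t ht => by
  have := hasDerivAt_smulOp (E := E) (p := 2) (a := m.b) (a' := m.b') hΩ ho hI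
    (fun t ht => (h.smooth_b t ht).continuous) h.hasDerivAt_b h.cont_b' ht
  exact this.continuousAt.continuousWithinAt

theorem continuousOn_dv (h : IsMultiplier Ω I m) :
    ContinuousOn (Function.uncurry fun t x => dv (fderiv ℝ (m.X t) x)) (I ×ˢ univ) :=
  continuous_dv.comp_continuousOn h.cont_fderiv

theorem continuousOn_dotOp_X (h : IsMultiplier Ω I m) (hΩ : Bornology.IsBounded Ω)
    (ho : IsOpen Ω) (hI : IsOpen I) : ContinuousOn (fun t => dotOp Ω (m.X t)) I := fun _ ht =>
  (hasDerivAt_dotOp hΩ ho hI (fun t ht => (h.pushing t ht).smooth.continuous) h.hasDerivAt_X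
    h.cont_X' ht).continuousAt.continuousWithinAt

theorem isForm_energy (h : IsMultiplier Ω I m) (hΩ : Bornology.IsBounded Ω) (ho : IsOpen Ω)
    (hI : IsOpen I) (hJ : IsCompact J) (hJI : J ⊆ I) : IsForm J (m.energy Ω) := by
  let L1 := ContinuousLinearMap.snd ℝ (H10 Ω) (L2 Ω)
  let L2 := (toL2L Ω).comp (ContinuousLinearMap.fst ℝ (H10 Ω) (NLW.L2 Ω))
  let L3 := (gradL Ω).comp (ContinuousLinearMap.fst ℝ (H10 Ω) (NLW.L2 Ω))
  have f1 := IsForm.inner_clm hJ ((h.continuousOn_smulOp_a hΩ ho hI (E := ℝ)).mono hJI) L1 L1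
  have f2 := IsForm.inner_clm hJ ((h.continuousOn_smulOp_a hΩ ho hI (E := E3)).mono hJI) L3 L3
  have f3 := IsForm.inner_clm hJ ((h.continuousOn_dotOp_X hΩ ho hI).mono hJI) L3 L1
  have f4 := IsForm.inner_clm hJ ((h.continuousOn_smulOp_b hΩ ho hI (E := ℝ)).mono hJI) L2 L1
  exact (((f1.add f2).div_const 2).add f3).add f4

theorem isForm_rate (h : IsMultiplier Ω I m) (hΩ : Bornology.IsBounded Ω) (ho : IsOpen Ω)
    (hI : IsOpen I) (hJ : IsCompact J) (hJI : J ⊆ I) : IsForm J (m.rate Ω) := by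
  let L1 := ContinuousLinearMap.snd ℝ (H10 Ω) (L2 Ω)
  let L2 := (toL2L Ω).comp (ContinuousLinearMap.fst ℝ (H10 Ω) (NLW.L2 Ω))
  let L3 := (gradL Ω).comp (ContinuousLinearMap.fst ℝ (H10 Ω) (NLW.L2 Ω))
  have f1 := IsForm.inner_clm hJ ((continuousOn_smulOp hΩ ho h.cont_a' (E := ℝ)).mono hJI) L1 L1
  have f2 := IsForm.inner_clm hJ ((continuousOn_smulOp hΩ ho h.cont_a' (E := E3)).mono hJI) L3 L3
  have f3 := IsForm.inner_clm hJ ((continuousOn_dotOp hΩ ho h.cont_gradient_a).mono hJI) L3 L1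
  have f4 := IsForm.inner_clm hJ ((continuousOn_dotOp hΩ ho h.cont_X').mono hJI) L3 L1
  have f5 := IsForm.inner_clm hJ
    ((continuousOn_smulOp hΩ ho h.continuousOn_dv (E := ℝ)).mono hJI) L1 L1
  have f6 := IsForm.inner_clm hJ
    ((continuousOn_smulOp hΩ ho h.continuousOn_dv (E := E3)).mono hJI) L3 L3
  have f7 := IsForm.inner_clm hJ ((continuousOn_adjOp hΩ ho h.cont_fderiv).mono hJI) L3 L3
  have f8 := IsForm.inner_clm hJ ((continuousOn_smulOp hΩ ho h.cont_b' (E := ℝ)).mono hJI) L2 L1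
  have f9 := IsForm.inner_clm hJ ((h.continuousOn_smulOp_b hΩ ho hI (E := ℝ)).mono hJI) L1 L1
  have f10 := IsForm.inner_clm hJ ((h.continuousOn_smulOp_b hΩ ho hI (E := E3)).mono hJI) L3 L3
  have f11 := IsForm.inner_clm hJ ((continuousOn_dotOp hΩ ho h.cont_gradient_b).mono hJI) L3 L2
  exact (((((((((f1.add f2).div_const 2).sub f3).add f4).sub (f5.div_const 2)).add
    (f6.div_const 2)).sub f7).add f8).add f9).sub f10 |>.sub f11

theorem continuousOn_flux (h : IsMultiplier Ω I m) (hΩ : Bornology.IsBounded Ω) (ho : IsOpen Ω)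
    (hI : IsOpen I) : ContinuousOn (m.flux Ω) I :=
  (((h.continuousOn_smulOp_a hΩ ho hI).clm_comp continuousOn_const).add
    ((h.continuousOn_dotOp_X hΩ ho hI).clm_comp continuousOn_const)).add
    ((h.continuousOn_smulOp_b hΩ ho hI).clm_comp continuousOn_const)

end IsMultiplier

end

/-! ### Differentiation of the multiplier energy along regular curves. -/

section

variable {Ω : Set E3} {I : Set ℝ} {m : Multiplier} {t₀ : ℝ} {u : ℝ → H10 Ω} {ut : ℝ → L2 Ω}

/-- The weak equation tested with a q and with b v; the product rule for the gradient of the test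
function produces the terms in ∇a and ∇b. -/
theorem IsMultiplier.flux_identity (h : IsMultiplier Ω I m) (hΩ : Bornology.IsBounded Ω)
    (ho : IsOpen Ω) {t : ℝ} (ht : t ∈ I) {v q : H10 Ω} {g : L2 Ω}
    (heq : ∀ ζ : H10 Ω, inner ℝ (gradH ζ) (gradH v) = - inner ℝ (toL2 ζ) g) :
    inner ℝ (smulOp Ω E3 2 (m.a t) (gradH v)) (gradH q) +
        inner ℝ (dotOp Ω (gradient (m.a t)) (gradH v)) (toL2 q) =
      - inner ℝ (smulOp Ω ℝ 2 (m.a t) (toL2 q)) g ∧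
    inner ℝ (smulOp Ω E3 2 (m.b t) (gradH v)) (gradH v) +
        inner ℝ (dotOp Ω (gradient (m.b t)) (gradH v)) (toL2 v) =
      - inner ℝ (smulOp Ω ℝ 2 (m.b t) (toL2 v)) g := by
  have key : ∀ {b : E3 → ℝ} (hb : ContDiff ℝ ∞ b) (w : H10 Ω),
      inner ℝ (smulOp Ω E3 2 b (gradH v)) (gradH w) +
        inner ℝ (dotOp Ω (gradient b) (gradH v)) (toL2 w) =
      - inner ℝ (smulOp Ω ℝ 2 b (toL2 w)) g := by
    intro b hb w
    obtain ⟨ζ, hζ1, hζ2⟩ := exists_smul_mem hΩ ho hb w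
    have := heq ζ
    rw [hζ1, hζ2, inner_add_left, inner_spanOp hΩ ho
      (continuous_gradient (hb.of_le (by norm_cast))),
      inner_smulOp_comm hΩ ho hb.continuous] at this
    exact this
  exact ⟨key (h.smooth_a t ht) q, key (h.smooth_b t ht) v⟩

theorem IsMultiplier.hasDerivAt_energy (h : IsMultiplier Ω I m) (hΩ : Bornology.IsBounded Ω)
    (ho : IsOpen Ω) (hI : IsOpen I) {t : ℝ} (ht : t ∈ I) {v q : ℝ → H10 Ω} {p : L2 Ω}
    (hv : HasDerivAt v (q t) t) (hq : HasDerivAt (fun s => toL2 (q s)) p t) :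
    HasDerivAt (fun s => m.energy Ω s (v s, toL2 (q s)))
      (((inner ℝ (smulOp Ω ℝ 2 (m.a t) (toL2 (q t))) p +
        (inner ℝ (smulOp Ω ℝ 2 (m.a' t) (toL2 (q t))) (toL2 (q t)) +
          inner ℝ (smulOp Ω ℝ 2 (m.a t) p) (toL2 (q t)))) +
        (inner ℝ (smulOp Ω E3 2 (m.a t) (gradH (v t))) (gradH (q t)) +
        (inner ℝ (smulOp Ω E3 2 (m.a' t) (gradH (v t))) (gradH (v t)) +
          inner ℝ (smulOp Ω E3 2 (m.a t) (gradH (q t))) (gradH (v t))))) / 2 +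
        (inner ℝ (dotOp Ω (m.X t) (gradH (v t))) p +
          (inner ℝ (dotOp Ω (m.X' t) (gradH (v t))) (toL2 (q t)) +
          inner ℝ (dotOp Ω (m.X t) (gradH (q t))) (toL2 (q t)))) +
        (inner ℝ (smulOp Ω ℝ 2 (m.b t) (toL2 (v t))) p +
          (inner ℝ (smulOp Ω ℝ 2 (m.b' t) (toL2 (v t))) (toL2 (q t)) +
          inner ℝ (smulOp Ω ℝ 2 (m.b t) (toL2 (q t))) (toL2 (q t))))) t := by
  have dA := hasDerivAt_smulOp (E := ℝ) (p := 2) (a := m.a) (a' := m.a') hΩ ho hI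
    (fun t ht => (h.smooth_a t ht).continuous) h.hasDerivAt_a h.cont_a' ht
  have dA3 := hasDerivAt_smulOp (E := E3) (p := 2) (a := m.a) (a' := m.a') hΩ ho hI
    (fun t ht => (h.smooth_a t ht).continuous) h.hasDerivAt_a h.cont_a' ht
  have dB := hasDerivAt_smulOp (E := ℝ) (p := 2) (a := m.b) (a' := m.b') hΩ ho hI
    (fun t ht => (h.smooth_b t ht).continuous) h.hasDerivAt_b h.cont_b' ht
  have dX := hasDerivAt_dotOp hΩ ho hI (fun t ht => (h.pushing t ht).smooth.continuous)
    h.hasDerivAt_X h.cont_X' ht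
  have hg : HasDerivAt (fun s => gradH (v s)) (gradH (q t)) t :=
    (gradL Ω).hasFDerivAt.comp_hasDerivAt t hv
  have h2 : HasDerivAt (fun s => toL2 (v s)) (toL2 (q t)) t :=
    (toL2L Ω).hasFDerivAt.comp_hasDerivAt t hv
  exact ((((hasDerivAt_inner_clm dA hq hq).add (hasDerivAt_inner_clm dA3 hg hg)).div_const 2).add
    (hasDerivAt_inner_clm dX hg hq)).add (hasDerivAt_inner_clm dB h2 hq)

-- Here q = ∂ₜv lies in H¹₀(Ω), which permits testing with a q; that is what mollification in time
-- provides. The a and b terms, and the kinetic term ∫ (X·∇q) q, are exact identities; the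
-- inequality comes only from `rellich`, applied with g = p + f = Δv.
set_option maxHeartbeats 1000000 in
theorem IsMultiplier.exists_hasDerivAt (h : IsMultiplier Ω I m) (hΩ : Bornology.IsBounded Ω)
    (ho : IsOpen Ω) (hI : IsOpen I) {t : ℝ} (ht : t ∈ I) {v q : ℝ → H10 Ω} {p f : L2 Ω}
    (hv : HasDerivAt v (q t) t) (hq : HasDerivAt (fun s => toL2 (q s)) p t)
    (heq : ∀ ζ : H10 Ω, inner ℝ (gradH ζ) (gradH (v t)) = - inner ℝ (toL2 ζ) (p + f)) :
    ∃ d, HasDerivAt (fun s => m.energy Ω s (v s, toL2 (q s))) d t ∧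
      d ≤ m.rate Ω t (v t, toL2 (q t)) - inner ℝ f (m.flux Ω t (v t, toL2 (q t))) := by
  refine ⟨_, h.hasDerivAt_energy hΩ ho hI ht hv hq, ?_⟩
  obtain ⟨e1, e2⟩ := h.flux_identity hΩ ho ht (q := q t) heq
  have e3 := rellich hΩ ho (h.pushing t ht) (v := v t) (g := p + f) fun ζ => by
    rw [real_inner_comm, heq, real_inner_comm]
  have e4 := inner_dotOp_self hΩ ho (h.pushing t ht).contDiff_one (q t)
  have e5 := inner_smulOp_comm hΩ ho (h.smooth_a t ht).continuous p (toL2 (q t))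
  have e6 := inner_smulOp_comm hΩ ho (h.smooth_a t ht).continuous (gradH (q t)) (gradH (v t))
  rw [real_inner_comm, real_inner_comm (adjOp Ω (m.X t) (gradH (v t)))] at e3
  rw [inner_add_right] at e1 e2 e3
  rw [Multiplier.flux_apply, inner_add_right, inner_add_right, real_inner_comm _ f,
    real_inner_comm _ f, real_inner_comm _ f]
  simp only [Multiplier.rate]
  linarith

end

/-! ### The multiplier inequality for the solution, nonlinear work left explicit. -/

section

variable {Ω : Set E3} {I : Set ℝ} {m : Multiplier} {t₀ : ℝ} {u : ℝ → H10 Ω} {ut : ℝ → L2 Ω}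

theorem continuousAt_indicator_Icc {G : Type*} [NormedAddCommGroup G] {g : ℝ → G} {a b t : ℝ}
    {J : Set ℝ} (hg : ContinuousOn g J) (hJ : Ioo a b ⊆ J) (ht : t ∈ Ioo a b) :
    ContinuousAt ((Icc a b).indicator g) t := by
  have hn := Ioo_mem_nhds ht.1 ht.2
  refine (hg.continuousAt (mem_of_superset hn hJ)).congr ?_
  filter_upwards [hn] with s hs
  rw [indicator_of_mem (Ioo_subset_Icc_self hs)]

theorem exists_indicator_bound {G : Type*} [NormedAddCommGroup G] {g : ℝ → G} {a b : ℝ}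
    (hg : ContinuousOn g (Icc a b)) : ∃ C, 0 ≤ C ∧ ∀ s, ‖(Icc a b).indicator g s‖ ≤ C := by
  obtain ⟨C, hC⟩ := isCompact_Icc.exists_bound_of_continuousOn hg
  refine ⟨|C|, abs_nonneg C, fun s => ?_⟩
  by_cases hs : s ∈ Icc a b
  · rw [indicator_of_mem hs]
    exact (hC s hs).trans (le_abs_self C)
  · rw [indicator_of_notMem hs, norm_zero]
    exact abs_nonneg C

theorem MemX.toL2_mol_deriv (hX : MemX Ω t₀ u ut) {a b t δ : ℝ} (ha : 0 < a) (hb : b < t₀)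
    {k : ℝ → ℝ} (hδ : 0 < δ) (hk : IsKernel k δ) (hab : Icc (t - δ) (t + δ) ⊆ Ioo a b) :
    toL2 (mol (deriv k) ((Icc a b).indicator u) t) = mol k ((Icc a b).indicator ut) t := by
  have hk1 : ContDiff ℝ ∞ (deriv k) := hk.contDiff.deriv' (n := ∞)
  have h1 := map_mol (toL2L Ω) hk1.continuous hk.compact.deriv
    (hX.integrable_indicator ha.le hb) t
  have e : (fun s => toL2L Ω ((Icc a b).indicator u s)) =
      (Icc a b).indicator fun s => toL2 (u s) := by
    funext s
    by_cases hs : s ∈ Icc a b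
    · rw [indicator_of_mem hs, indicator_of_mem hs, toL2L_apply]
    · rw [indicator_of_notMem hs, indicator_of_notMem hs, map_zero]
  rw [e, toL2L_apply] at h1
  rw [h1]
  have hsub : Ioo a b ⊆ Ioo 0 t₀ := Ioo_subset_Ioo ha.le hb.le
  exact mol_deriv hδ (hk.contDiff.of_le (by norm_cast)) hk.support hab
    (fun s hs => hX.hasDerivAt (hsub hs))
    (hX.continuousOn_deriv.mono (hsub.trans Ioo_subset_Ico_self))

set_option maxHeartbeats 1000000 in
/-- The multiplier inequality, with the nonlinear term left as it is. -/
theorem IsMultiplier.energy_sub_le (h : IsMultiplier Ω I m) (hΩ : Bornology.IsBounded Ω)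
    (ho : IsOpen Ω) (hI : IsOpen I) (hX : MemX Ω t₀ u ut) (heq : SatisfiesNLW Ω t₀ u)
    {S T : ℝ} (hS : 0 < S) (hT : T < t₀) (hST : S ≤ T) (hJ : Icc S T ⊆ I) :
    m.energy Ω T (u T, ut T) - m.energy Ω S (u S, ut S) ≤
      (∫ t in Icc S T, m.rate Ω t (u t, ut t)) -
        ∫ t in Icc S T, inner ℝ (fifth (toL2 (u t))) (m.flux Ω t (u t, ut t)) := by
  set a := S / 2 with hadef
  set b := (T + t₀) / 2 with hbdef
  have ha : 0 < a := by linarith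
  have hb : b < t₀ := by linarith
  have hab : a ≤ b := by linarith
  -- Since S - a = a, the number min a (b - T) is the distance from [S, T] to the ends of [a, b].
  -- Dividing it by n + 2, which exceeds 1 already at n = 0, keeps the mollification windows
  -- strictly inside (a, b).
  have hr : 0 < min a (b - T) := lt_min ha (by linarith)
  have hδ0 : ∀ n : ℕ, 0 < min a (b - T) / ((n : ℝ) + 2) := fun n => by positivity
  choose κ hκ using fun n : ℕ => exists_isKernel (hδ0 n)
  have hδ : Tendsto (fun n : ℕ => min a (b - T) / ((n : ℝ) + 2)) atTop (𝓝 0) :=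
    (tendsto_atTop_add_const_right _ _ tendsto_natCast_atTop_atTop).const_div_atTop _
  have hball : ∀ n : ℕ, ∀ t ∈ Icc S T, Icc (t - min a (b - T) / ((n : ℝ) + 2))
      (t + min a (b - T) / ((n : ℝ) + 2)) ⊆ Ioo a b := fun n t ht s hs => by
    have h1 : min a (b - T) / ((n : ℝ) + 2) < min a (b - T) :=
      div_lt_self hr (by linarith [(n.cast_nonneg : (0 : ℝ) ≤ n)])
    have h2 := min_le_left a (b - T)
    have h3 := min_le_right a (b - T)
    exact ⟨by linarith [hs.1, ht.1], by linarith [hs.2, ht.2]⟩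
  have hsub : Icc a b ⊆ Ico 0 t₀ := fun s hs => ⟨ha.le.trans hs.1, hs.2.trans_lt hb⟩
  have hIoo : Ioo a b ⊆ Ico 0 t₀ := Ioo_subset_Icc_self.trans hsub
  have hST' : Icc S T ⊆ Ioo a b := fun s hs => ⟨by linarith [hs.1], by linarith [hs.2]⟩
  have hiu := hX.integrable_indicator ha.le hb
  have hif := hX.integrable_indicator_fifth ha.le hab hb
  have hit : AEStronglyMeasurable ((Icc a b).indicator ut) volume :=
    (((hX.continuousOn_deriv.mono hsub).integrableOn_compact
      isCompact_Icc).integrable_indicator measurableSet_Icc).aestronglyMeasurable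
  obtain ⟨C₁, hC₁, hb₁⟩ := exists_indicator_bound (hX.continuousOn.mono hsub)
  obtain ⟨C₂, hC₂, hb₂⟩ := exists_indicator_bound (hX.continuousOn_deriv.mono hsub)
  have hk1 : ∀ n, ContDiff ℝ ∞ (deriv (κ n)) := fun n => (hκ n).contDiff.deriv' (n := ∞)
  have hv : ∀ n t, HasDerivAt (mol (κ n) ((Icc a b).indicator u))
      (mol (deriv (κ n)) ((Icc a b).indicator u) t) t := fun n t =>
    hasDerivAt_mol ((hκ n).contDiff.of_le (by norm_cast)) (hκ n).compact hiu t
  have hq : ∀ n t, HasDerivAt (mol (deriv (κ n)) ((Icc a b).indicator u))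
      (mol (deriv (deriv (κ n))) ((Icc a b).indicator u) t) t := fun n t =>
    hasDerivAt_mol ((hk1 n).of_le (by norm_cast)) (hκ n).compact.deriv hiu t
  have hq2 : ∀ n t, HasDerivAt (fun s => toL2 (mol (deriv (κ n)) ((Icc a b).indicator u) s))
      (toL2 (mol (deriv (deriv (κ n))) ((Icc a b).indicator u) t)) t := fun n t =>
    (toL2L Ω).hasFDerivAt.comp_hasDerivAt t (hq n t)
  -- The time derivative of the mollified u, a priori only a curve in H¹₀(Ω), is identified in L²
  -- with the mollified ∂ₜu, so it converges to ∂ₜu pointwise.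
  have ht2 : ∀ n, ∀ t ∈ Icc S T, toL2 (mol (deriv (κ n)) ((Icc a b).indicator u) t) =
      mol (κ n) ((Icc a b).indicator ut) t := fun n t ht =>
    hX.toL2_mol_deriv ha hb (hδ0 n) (hκ n) (hball n t ht)
  have main := le_integral_of_approx hST
    (h.isForm_energy hΩ ho hI isCompact_Icc hJ) (h.isForm_rate hΩ ho hI isCompact_Icc hJ)
    ((h.continuousOn_flux hΩ ho hI).mono hJ) (x := fun t => (u t, ut t))
    (xn := fun n t => (mol (κ n) ((Icc a b).indicator u) t,
      toL2 (mol (deriv (κ n)) ((Icc a b).indicator u) t)))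
    (f := (Icc a b).indicator fun t => fifth (toL2 (u t)))
    (fn := fun n => mol (κ n) ((Icc a b).indicator fun t => fifth (toL2 (u t))))
    (C := max C₁ C₂)
    (fun n t _ => ((hv n t).continuousAt.prodMk (hq2 n t).continuousAt).continuousWithinAt)
    (fun n t ht => by
      rw [ht2 n t ht]
      refine max_le_max ?_ ?_
      · have := (hκ n).norm_mol_sub_le hiu.aestronglyMeasurable hC₁ (c := 0) (t := t)
          fun s _ => by rw [sub_zero]; exact hb₁ s
        rwa [sub_zero] at this
      · have := (hκ n).norm_mol_sub_le hit hC₂ (c := 0) (t := t)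
          fun s _ => by rw [sub_zero]; exact hb₂ s
        rwa [sub_zero] at this)
    (fun t ht => by
      have l1 := tendsto_mol hκ hδ hiu.aestronglyMeasurable
        (continuousAt_indicator_Icc hX.continuousOn hIoo (hST' ht))
      have l2 := tendsto_mol hκ hδ hit
        (continuousAt_indicator_Icc hX.continuousOn_deriv hIoo (hST' ht))
      rw [indicator_of_mem (Ioo_subset_Icc_self (hST' ht))] at l1 l2
      refine (l1.prodMk_nhds l2).congr fun n => ?_
      rw [ht2 n t ht])
    hif.integrableOn (fun n => ((hκ n).integrable.integrable_convolution _ hif).integrableOn)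
    (tendsto_integral_norm_mol_sub hκ hδ hif S T)
    (fun n t ht => by
      refine h.exists_hasDerivAt hΩ ho hI (hJ ht) (hv n t) (hq2 n t) fun ζ => ?_
      have := mollified_equation hX heq ha hb (hδ0 n) (hκ n)
        ((hball n t ht).trans Ioo_subset_Icc_self) ζ
      rw [inner_add_right]
      linarith)
  refine main.trans (le_of_eq ?_)
  congr 1
  refine setIntegral_congr_fun measurableSet_Icc fun t ht => ?_
  simp only [indicator_of_mem (Ioo_subset_Icc_self (hST' ht))]

end

/-! ### The sextic potential energy and the removal of the truncation. -/

section

variable {Ω : Set E3} {I : Set ℝ} {m : Multiplier} {t₀ : ℝ} {u : ℝ → H10 Ω} {ut : ℝ → L2 Ω}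

theorem exists_sixth_bound (Ω : Set E3) : ∃ C, 0 ≤ C ∧ ∀ v : H10 Ω,
    IntegrableOn (fun x => toL2 v x ^ 6) Ω ∧ ∫ x in Ω, toL2 v x ^ 6 ≤ C * ‖gradH v‖ ^ 6 := by
  obtain ⟨C, hC⟩ := sobolev Ω
  refine ⟨C ^ 6, by positivity, fun v => ?_⟩
  have h1 : eLpNorm (toL2 v) 6 (volume.restrict Ω) ≤ ENNReal.ofReal (C * ‖gradH v‖) := by
    refine (hC v).trans (le_of_eq ?_)
    rw [ENNReal.ofReal_mul C.coe_nonneg, ENNReal.ofReal_coe_nnreal, ofReal_norm, Lp.enorm_def]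
  have hmem : MemLp (toL2 v) 6 (volume.restrict Ω) :=
    ⟨Lp.aestronglyMeasurable _, h1.trans_lt ENNReal.ofReal_lt_top⟩
  have e : ∀ x, ‖toL2 v x‖ ^ 6 = toL2 v x ^ 6 := fun x => by
    rw [Real.norm_eq_abs]
    exact Even.pow_abs ⟨3, rfl⟩ _
  have hint : Integrable (fun x => toL2 v x ^ 6) (volume.restrict Ω) :=
    (MemLp.integrable_norm_pow (p := 6) (by exact_mod_cast hmem) (by norm_num)).congr
      (Eventually.of_forall e)
  refine ⟨hint, ?_⟩
  rw [integral_eq_lintegral_of_nonneg_ae (Eventually.of_forall fun x => by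
    simp only [← e]; positivity) hint.aestronglyMeasurable]
  refine ENNReal.toReal_le_of_le_ofReal (by positivity) ?_
  rw [← mul_pow, ENNReal.ofReal_pow (by positivity)]
  refine le_trans (le_of_eq ?_) (pow_le_pow_left' h1 6)
  rw [eLpNorm_eq_lintegral_rpow_enorm_toReal (by norm_num) (by norm_num), ← ENNReal.rpow_natCast,
    ← ENNReal.rpow_mul]
  norm_num
  refine lintegral_congr fun x => ?_
  rw [← e, ENNReal.ofReal_pow (norm_nonneg _), ofReal_norm]

/-- The potential energy `∫ c u⁶ / 6`. -/
abbrev pot (Ω : Set E3) (c : E3 → ℝ) (w : L2 Ω) : ℝ := potential Ω (fun r => r ^ 6 / 6) c w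

theorem integrable_mul_sixth (hΩ : Bornology.IsBounded Ω) (ho : IsOpen Ω) {c : E3 → ℝ}
    (hc : Continuous c) (v : H10 Ω) :
    IntegrableOn (fun x => c x * (toL2 v x ^ 6 / 6)) Ω := by
  obtain ⟨C, hC, h⟩ := exists_sixth_bound Ω
  obtain ⟨B, hB, hb⟩ := exists_bound_of_continuous hΩ hc
  refine Integrable.bdd_mul (c := B) ((h v).1.div_const 6) hc.aestronglyMeasurable ?_
  filter_upwards [ae_restrict_mem ho.measurableSet] with x hx using hb x (subset_closure hx)

theorem abs_potential_sext_le (ho : IsOpen Ω) {c : E3 → ℝ} {B : ℝ}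
    (hb : ∀ x ∈ Ω, |c x| ≤ B) (N : ℕ) (v : H10 Ω) :
    |potential Ω (sext N) c (toL2 v)| ≤ B * ∫ x in Ω, toL2 v x ^ 6 := by
  obtain ⟨C, hC, h⟩ := exists_sixth_bound Ω
  rw [← integral_const_mul, ← Real.norm_eq_abs, potential]
  refine norm_integral_le_of_norm_le ((h v).1.const_mul B) ?_
  filter_upwards [ae_restrict_mem ho.measurableSet] with x hx
  have h6 : 0 ≤ toL2 v x ^ 6 := by positivity
  rw [norm_mul, Real.norm_eq_abs, Real.norm_eq_abs]
  have := abs_sext_le N (toL2 v x)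
  have := hb x hx
  exact mul_le_mul this (by linarith) (abs_nonneg _) ((abs_nonneg _).trans this)

theorem tendsto_potential_sext (hΩ : Bornology.IsBounded Ω) (ho : IsOpen Ω) {c : E3 → ℝ}
    (hc : Continuous c) (v : H10 Ω) :
    Tendsto (fun N => potential Ω (sext N) c (toL2 v)) atTop (𝓝 (pot Ω c (toL2 v))) := by
  refine tendsto_integral_of_dominated_convergence (fun x => ‖c x * (toL2 v x ^ 6 / 6)‖)
    (fun N => ((isPrimitive_quint N).integrable hΩ ho hc (toL2 v)).aestronglyMeasurable)
    (integrable_mul_sixth hΩ ho hc v).norm (fun N => Eventually.of_forall fun x => ?_)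
    (Eventually.of_forall fun x => (tendsto_sext _).const_mul _)
  have h6 : 0 ≤ toL2 v x ^ 6 := by positivity
  rw [norm_mul, norm_mul]
  refine mul_le_mul_of_nonneg_left ?_ (norm_nonneg _)
  rw [Real.norm_eq_abs, Real.norm_of_nonneg (by positivity)]
  exact abs_sext_le N _

/-- Formally u⁵ X·∇u = X·∇(u⁶/6). The identity holds for each truncation and both sides converge,
the left by the L¹⁰ bound, the right by the L⁶ bound. -/
theorem inner_fifth_dotOp (hΩ : Bornology.IsBounded Ω) (ho : IsOpen Ω) {X : E3 → E3}
    (hX : ContDiff ℝ 1 X) {v : H10 Ω} (hv : MemLp (toL2 v) 10 (volume.restrict Ω)) :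
    inner ℝ (fifth (toL2 v)) (dotOp Ω X (gradH v)) =
      - pot Ω (fun x => dv (fderiv ℝ X x)) (toL2 v) := by
  have l1 := ((tendsto_comp_quint hv).inner (𝕜 := ℝ)
    (tendsto_const_nhds (x := dotOp Ω X (gradH v))))
  have l2 := (tendsto_potential_sext hΩ ho (continuous_dv_fderiv hX) v).neg
  refine tendsto_nhds_unique l1 (l2.congr fun N => ?_)
  rw [real_inner_comm, (isPrimitive_quint N).inner_dotOp hΩ ho hX v]

theorem inner_fifth_smulOp (hΩ : Bornology.IsBounded Ω) (ho : IsOpen Ω) {b : E3 → ℝ}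
    (hb : Continuous b) {v : H10 Ω} (hv : MemLp (toL2 v) 10 (volume.restrict Ω)) :
    inner ℝ (fifth (toL2 v)) (smulOp Ω ℝ 2 b (toL2 v)) = 6 * pot Ω b (toL2 v) := by
  rw [real_inner_comm, inner_mulOp (memLp_top_of_continuous hΩ ho.measurableSet
    (continuous_smul_id hb)), pot, potential, ← integral_const_mul]
  refine integral_congr_ae ?_
  filter_upwards [fifth_coe hv] with x hx
  simp [hx]
  ring

theorem norm_comp_quint_le {w : L2 Ω} (hw : MemLp w 10 (volume.restrict Ω)) (N : ℕ) :
    ‖(isPrimitive_quint N).comp w‖ ≤ ‖fifth w‖ := by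
  refine Lp.norm_le_norm_of_ae_le ?_
  filter_upwards [(isPrimitive_quint N).comp_coe w, fifth_coe hw] with x h1 h2
  rw [h1, h2, norm_pow, Real.norm_eq_abs, Real.norm_eq_abs]
  exact abs_quint_le N _

theorem exists_uniform_bound (hΩ : Bornology.IsBounded Ω) {J : Set ℝ} (hJ : IsCompact J)
    {W : Type*} [NormedAddCommGroup W] {c : ℝ → E3 → W}
    (hc : ContinuousOn (Function.uncurry c) (J ×ˢ univ)) :
    ∃ B, 0 ≤ B ∧ ∀ t ∈ J, ∀ x ∈ Ω, ‖c t x‖ ≤ B := by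
  obtain ⟨B, hB⟩ := (hJ.prod hΩ.isCompact_closure).exists_bound_of_continuousOn
    (hc.mono (prod_mono le_rfl (subset_univ _)))
  exact ⟨|B|, abs_nonneg B, fun t ht x hx =>
    (hB (t, x) ⟨ht, subset_closure hx⟩).trans (le_abs_self B)⟩

theorem continuousOn_potential (hΩ : Bornology.IsBounded Ω) (ho : IsOpen Ω) {G g : ℝ → ℝ}
    {K : NNReal} (h : IsPrimitive G g K) {J : Set ℝ} {c : ℝ → E3 → ℝ}
    (hc : ContinuousOn (Function.uncurry c) (J ×ˢ univ)) {w : ℝ → L2 Ω} (hw : ContinuousOn w J) :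
    ContinuousOn (fun t => potential Ω G (c t) (w t)) J := by
  have h1 : ContinuousOn (fun t => smulOp Ω ℝ 1 (c t)) J :=
    continuousOn_mulOp hΩ ho.measurableSet (A := fun t x => c t x • ContinuousLinearMap.id ℝ ℝ)
      (hc.smul continuousOn_const)
  have h2 : Continuous (h.toL1 : L2 Ω → Lp ℝ 1 (volume.restrict Ω)) :=
    continuous_iff_continuousAt.2 fun w => (h.hasFDerivAt_toL1 w).continuousAt
  refine ((intCLM _).continuous.comp_continuousOn
    (h1.clm_apply (h2.comp_continuousOn hw))).congr fun t ht => ?_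
  exact h.potential_eq hΩ ho (continuous_slice hc ht) (w t)

theorem MemX.exists_bound_sixth (hX : MemX Ω t₀ u ut) {J : Set ℝ} (hJ : IsCompact J)
    (hJ' : J ⊆ Ico 0 t₀) : ∃ B, 0 ≤ B ∧ ∀ t ∈ J, ∫ x in Ω, toL2 (u t) x ^ 6 ≤ B := by
  obtain ⟨C, hC, h⟩ := exists_sixth_bound Ω
  obtain ⟨B, hB⟩ := hJ.exists_bound_of_continuousOn
    (continuous_gradH.comp_continuousOn (hX.continuousOn.mono hJ'))
  refine ⟨C * |B| ^ 6, by positivity, fun t ht => (h (u t)).2.trans ?_⟩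
  have := (hB t ht).trans (le_abs_self B)
  simp only [Function.comp_apply] at this
  gcongr

/-- Sobolev and continuity into H¹₀(Ω) bound ∫ u⁶ uniformly on compact time sets. This dominates all
truncations at once, and measurability in time is inherited from them. -/
theorem MemX.integral_potential (hX : MemX Ω t₀ u ut) (hΩ : Bornology.IsBounded Ω)
    (ho : IsOpen Ω) {J : Set ℝ} (hJ : IsCompact J) (hJ' : J ⊆ Ico 0 t₀) {c : ℝ → E3 → ℝ}
    (hc : ContinuousOn (Function.uncurry c) (J ×ˢ univ)) :
    IntegrableOn (fun t => pot Ω (c t) (toL2 (u t))) J ∧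
    Tendsto (fun N => ∫ t in J, potential Ω (sext N) (c t) (toL2 (u t))) atTop
      (𝓝 (∫ t in J, pot Ω (c t) (toL2 (u t)))) := by
  obtain ⟨B, hB, hb⟩ := exists_uniform_bound hΩ hJ hc
  obtain ⟨D, hD, hd⟩ := hX.exists_bound_sixth hJ hJ'
  have hm : ∀ N, AEStronglyMeasurable (fun t => potential Ω (sext N) (c t) (toL2 (u t)))
      (volume.restrict J) := fun N =>
    (continuousOn_potential hΩ ho (isPrimitive_quint N) hc
      (continuous_toL2.comp_continuousOn (hX.continuousOn.mono hJ'))).aestronglyMeasurable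
      hJ.measurableSet
  have hle : ∀ N, ∀ t ∈ J, ‖potential Ω (sext N) (c t) (toL2 (u t))‖ ≤ B * D := fun N t ht =>
    (abs_potential_sext_le ho (hb t ht) N (u t)).trans (mul_le_mul_of_nonneg_left (hd t ht) hB)
  have hlim : ∀ t ∈ J, Tendsto (fun N => potential Ω (sext N) (c t) (toL2 (u t))) atTop
      (𝓝 (pot Ω (c t) (toL2 (u t)))) := fun t ht =>
    tendsto_potential_sext hΩ ho (continuous_slice hc ht) (u t)
  have hfin : IsFiniteMeasure (volume.restrict J) :=
    ⟨by rw [Measure.restrict_apply_univ]; exact hJ.measure_lt_top⟩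
  constructor
  · refine Integrable.mono' (integrable_const (B * D)) (aestronglyMeasurable_of_tendsto_ae atTop hm
      ?_) ?_
    · filter_upwards [ae_restrict_mem hJ.measurableSet] with t ht using hlim t ht
    · filter_upwards [ae_restrict_mem hJ.measurableSet] with t ht
      exact le_of_tendsto' (hlim t ht).norm fun N => hle N t ht
  · refine tendsto_integral_of_dominated_convergence (fun _ => B * D) hm (integrable_const _)
      (fun N => ?_) ?_
    · filter_upwards [ae_restrict_mem hJ.measurableSet] with t ht using hle N t ht
    · filter_upwards [ae_restrict_mem hJ.measurableSet] with t ht using hlim t ht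

end

/-! ### The full multiplier inequality, potential energy included. -/

section

variable {Ω : Set E3} {I : Set ℝ} {m : Multiplier} {t₀ : ℝ} {u : ℝ → H10 Ω} {ut : ℝ → L2 Ω}

namespace Multiplier

/-- The energy attached to a multiplier. -/
def total (m : Multiplier) (Ω : Set E3) (t : ℝ) (z : H10 Ω × L2 Ω) : ℝ :=
  m.energy Ω t z + pot Ω (m.a t) (toL2 z.1)

/-- The upper bound for the rate of change of the energy. -/
def totalRate (m : Multiplier) (Ω : Set E3) (t : ℝ) (z : H10 Ω × L2 Ω) : ℝ :=
  m.rate Ω t z + pot Ω (m.a' t) (toL2 z.1) +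
    pot Ω (fun x => dv (fderiv ℝ (m.X t) x)) (toL2 z.1) - 6 * pot Ω (m.b t) (toL2 z.1)

end Multiplier

theorem MemX.ae_memLp_Icc (hX : MemX Ω t₀ u ut) {S T : ℝ} (hS : 0 < S) (hT : T < t₀)
    (hST : S ≤ T) :
    ∀ᵐ t ∂volume.restrict (Icc S T), MemLp (toL2 (u t)) 10 (volume.restrict Ω) :=
  ae_restrict_of_ae_restrict_of_subset (Icc_subset_Icc_left hS.le)
    (hX.ae_memLp ⟨hS.le.trans hST, hT⟩)

/-- Energy balance for ∫ a u⁶/6, proved on u itself and not on a mollification: the truncated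
potential is differentiable on L², where u is C¹ in time. Then N → ∞, with ‖u⁵‖ times a bounded
factor as dominating function. -/
theorem IsMultiplier.pot_sub (h : IsMultiplier Ω I m) (hΩ : Bornology.IsBounded Ω)
    (ho : IsOpen Ω) (hI : IsOpen I) (hX : MemX Ω t₀ u ut)
    {S T : ℝ} (hS : 0 < S) (hT : T < t₀) (hST : S ≤ T) (hJ : Icc S T ⊆ I) :
    pot Ω (m.a T) (toL2 (u T)) - pot Ω (m.a S) (toL2 (u S)) =
      (∫ t in Icc S T, pot Ω (m.a' t) (toL2 (u t))) +
        ∫ t in Icc S T, inner ℝ (fifth (toL2 (u t))) (smulOp Ω ℝ 2 (m.a t) (ut t)) := by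
  have hIco : Icc S T ⊆ Ico 0 t₀ := fun s hs => ⟨hS.le.trans hs.1, hs.2.trans_lt hT⟩
  have hIoo : Icc S T ⊆ Ioo 0 t₀ := fun s hs => ⟨hS.trans_le hs.1, hs.2.trans_lt hT⟩
  have ha' := h.cont_a'.mono (prod_mono hJ (subset_univ univ))
  have hu : ContinuousOn (fun t => toL2 (u t)) (Icc S T) :=
    continuous_toL2.comp_continuousOn (hX.continuousOn.mono hIco)
  have hy : ContinuousOn (fun t => smulOp Ω ℝ 2 (m.a t) (ut t)) (Icc S T) :=
    ((h.continuousOn_smulOp_a hΩ ho hI).mono hJ).clm_apply (hX.continuousOn_deriv.mono hIco)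
  have hf : IntegrableOn (fun t => fifth (toL2 (u t))) (Icc S T) :=
    (hX.integrableOn_fifth ⟨hS.le.trans hST, hT⟩).mono_set (Icc_subset_Icc_left hS.le)
  have hcomp : ∀ N, ContinuousOn (fun t => (isPrimitive_quint N).comp (toL2 (u t))) (Icc S T) :=
    fun N => (isPrimitive_quint N).continuous_comp.comp_continuousOn hu
  have step : ∀ N, potential Ω (sext N) (m.a T) (toL2 (u T)) -
      potential Ω (sext N) (m.a S) (toL2 (u S)) =
      (∫ t in Icc S T, potential Ω (sext N) (m.a' t) (toL2 (u t))) +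
        ∫ t in Icc S T, inner ℝ ((isPrimitive_quint N).comp (toL2 (u t)))
          (smulOp Ω ℝ 2 (m.a t) (ut t)) := by
    intro N
    have c1 := continuousOn_potential hΩ ho (isPrimitive_quint N) ha' hu
    have c2 : ContinuousOn (fun t => inner ℝ ((isPrimitive_quint N).comp (toL2 (u t)))
      (smulOp Ω ℝ 2 (m.a t) (ut t))) (Icc S T) := (hcomp N).inner hy
    rw [← integral_add (c1.integrableOn_compact isCompact_Icc)
      (c2.integrableOn_compact isCompact_Icc), integral_Icc_eq_integral_Ioc,
      ← intervalIntegral.integral_of_le hST]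
    refine (intervalIntegral.integral_eq_sub_of_hasDerivAt
      (f := fun t => potential Ω (sext N) (m.a t) (toL2 (u t))) (fun t ht => ?_) ?_).symm
    · rw [uIcc_of_le hST] at ht
      have := (isPrimitive_quint N).hasDerivAt_potential hΩ ho hI
        (fun t ht => (h.smooth_a t ht).continuous) h.hasDerivAt_a h.cont_a' (hJ ht)
        (hX.hasDerivAt (hIoo ht))
      rw [inner_smulOp_comm hΩ ho (h.smooth_a t (hJ ht)).continuous, real_inner_comm] at this
      exact this
    · refine ContinuousOn.intervalIntegrable ?_
      rw [uIcc_of_le hST]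
      exact c1.add c2
  have l1 := (tendsto_potential_sext hΩ ho (h.smooth_a T (hJ (right_mem_Icc.2 hST))).continuous
    (u T)).sub (tendsto_potential_sext hΩ ho (h.smooth_a S (hJ (left_mem_Icc.2 hST))).continuous
    (u S))
  have l2 := (hX.integral_potential hΩ ho isCompact_Icc hIco ha').2
  have l3 : Tendsto (fun N => ∫ t in Icc S T, inner ℝ ((isPrimitive_quint N).comp (toL2 (u t)))
      (smulOp Ω ℝ 2 (m.a t) (ut t))) atTop
      (𝓝 (∫ t in Icc S T, inner ℝ (fifth (toL2 (u t))) (smulOp Ω ℝ 2 (m.a t) (ut t)))) := by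
    obtain ⟨C, hC⟩ := isCompact_Icc.exists_bound_of_continuousOn hy
    refine tendsto_integral_of_dominated_convergence (fun t => ‖fifth (toL2 (u t))‖ * C)
      (fun N => ((hcomp N).inner hy).aestronglyMeasurable measurableSet_Icc)
      (hf.norm.mul_const C) (fun N => ?_) ?_
    · filter_upwards [ae_restrict_mem measurableSet_Icc, hX.ae_memLp_Icc hS hT hST] with t ht hm
      exact (norm_inner_le_norm _ _).trans (mul_le_mul (norm_comp_quint_le hm N) (hC t ht)
        (norm_nonneg _) (norm_nonneg _))
    · filter_upwards [hX.ae_memLp_Icc hS hT hST] with t hm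
      exact (tendsto_comp_quint hm).inner tendsto_const_nhds
  exact tendsto_nhds_unique l1 ((l2.add l3).congr fun N => (step N).symm)

set_option maxHeartbeats 1000000 in
/-- The multiplier inequality. -/
theorem IsMultiplier.total_sub_le (h : IsMultiplier Ω I m) (hΩ : Bornology.IsBounded Ω)
    (ho : IsOpen Ω) (hI : IsOpen I) (hX : MemX Ω t₀ u ut) (heq : SatisfiesNLW Ω t₀ u)
    {S T : ℝ} (hS : 0 < S) (hT : T < t₀) (hST : S ≤ T) (hJ : Icc S T ⊆ I) :
    IntegrableOn (fun t => m.totalRate Ω t (u t, ut t)) (Icc S T) ∧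
    m.total Ω T (u T, ut T) - m.total Ω S (u S, ut S) ≤
      ∫ t in Icc S T, m.totalRate Ω t (u t, ut t) := by
  have hIco : Icc S T ⊆ Ico 0 t₀ := fun s hs => ⟨hS.le.trans hs.1, hs.2.trans_lt hT⟩
  have hz : ContinuousOn (fun t => (u t, ut t)) (Icc S T) :=
    (hX.continuousOn.mono hIco).prodMk (hX.continuousOn_deriv.mono hIco)
  have hf : IntegrableOn (fun t => fifth (toL2 (u t))) (Icc S T) :=
    (hX.integrableOn_fifth ⟨hS.le.trans hST, hT⟩).mono_set (Icc_subset_Icc_left hS.le)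
  have hy : ContinuousOn (fun t => smulOp Ω ℝ 2 (m.a t) (ut t)) (Icc S T) :=
    ((h.continuousOn_smulOp_a hΩ ho hI).mono hJ).clm_apply (hX.continuousOn_deriv.mono hIco)
  have i1 : IntegrableOn (fun t => m.rate Ω t (u t, ut t)) (Icc S T) :=
    ((h.isForm_rate hΩ ho hI isCompact_Icc hJ).continuousOn_comp hz).integrableOn_compact
      isCompact_Icc
  have i2 := integrableOn_inner hf
    (((h.continuousOn_flux hΩ ho hI).mono hJ).clm_apply hz)
  -- The work of u⁵ against a ∂ₜu occurs with opposite signs in the two balances and cancels; what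
  -- remains of the flux is integrated by parts pointwise in time.
  have i3 := integrableOn_inner hf hy
  have i4 := (hX.integral_potential hΩ ho isCompact_Icc hIco
    (h.cont_a'.mono (prod_mono hJ (subset_univ univ)))).1
  have e : (fun t => m.rate Ω t (u t, ut t) - inner ℝ (fifth (toL2 (u t)))
      (m.flux Ω t (u t, ut t)) + pot Ω (m.a' t) (toL2 (u t)) +
      inner ℝ (fifth (toL2 (u t))) (smulOp Ω ℝ 2 (m.a t) (ut t)))
      =ᵐ[volume.restrict (Icc S T)] fun t => m.totalRate Ω t (u t, ut t) := by
    filter_upwards [ae_restrict_mem measurableSet_Icc, hX.ae_memLp_Icc hS hT hST] with t ht hm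
    rw [Multiplier.flux_apply, inner_add_right, inner_add_right,
      inner_fifth_dotOp hΩ ho (h.pushing t (hJ ht)).contDiff_one hm,
      inner_fifth_smulOp hΩ ho (h.smooth_b t (hJ ht)).continuous hm, Multiplier.totalRate]
    ring
  have i5 := ((i1.sub i2).add i4).add i3
  refine ⟨i5.congr e, ?_⟩
  rw [← integral_congr_ae e, integral_add (f := fun t => m.rate Ω t (u t, ut t) -
      inner ℝ (fifth (toL2 (u t))) (m.flux Ω t (u t, ut t)) + pot Ω (m.a' t) (toL2 (u t)))
      ((i1.sub i2).add i4) i3, integral_add (f := fun t => m.rate Ω t (u t, ut t) -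
      inner ℝ (fifth (toL2 (u t))) (m.flux Ω t (u t, ut t))) (i1.sub i2) i4,
    integral_sub (f := fun t => m.rate Ω t (u t, ut t)) i1 i2]
  have h1 := h.energy_sub_le hΩ ho hI hX heq hS hT hST hJ
  have h2 := h.pot_sub hΩ ho hI hX hS hT hST hJ
  simp only [Multiplier.total]
  linarith

end

/-! ### Densities: energies and rates as integrals over Ω, so that later estimates become pointwise.
-/

section

variable {Ω : Set E3}

/-- `F` is integrable on `Ω` with integral `r`. -/
def HasInt (Ω : Set E3) (F : E3 → ℝ) (r : ℝ) : Prop := IntegrableOn F Ω ∧ ∫ x in Ω, F x = r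

namespace HasInt

variable {F F' : E3 → ℝ} {r r' : ℝ}

theorem add (h : HasInt Ω F r) (h' : HasInt Ω F' r') : HasInt Ω (fun x => F x + F' x) (r + r') :=
  ⟨h.1.add h'.1, by rw [integral_add h.1 h'.1, h.2, h'.2]⟩

theorem sub (h : HasInt Ω F r) (h' : HasInt Ω F' r') : HasInt Ω (fun x => F x - F' x) (r - r') :=
  ⟨h.1.sub h'.1, by rw [integral_sub h.1 h'.1, h.2, h'.2]⟩

theorem const_mul (h : HasInt Ω F r) (c : ℝ) : HasInt Ω (fun x => c * F x) (c * r) :=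
  ⟨h.1.const_mul c, by rw [integral_const_mul, h.2]⟩

theorem div_const (h : HasInt Ω F r) (c : ℝ) : HasInt Ω (fun x => F x / c) (r / c) :=
  ⟨h.1.div_const c, by rw [integral_div, h.2]⟩

theorem congr (h : HasInt Ω F r) (e : ∀ x, F x = F' x) : HasInt Ω F' r := by
  rwa [show F' = F from funext fun x => (e x).symm]

end HasInt

theorem hasInt_smulOp {E : Type*} [NormedAddCommGroup E] [InnerProductSpace ℝ E]
    [FiniteDimensional ℝ E] (hΩ : Bornology.IsBounded Ω) (ho : IsOpen Ω) {c : E3 → ℝ}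
    (hc : Continuous c) (v w : Lp E 2 (volume.restrict Ω)) :
    HasInt Ω (fun x => c x * inner ℝ (v x) (w x)) (inner ℝ (smulOp Ω E 2 c v) w) := by
  have hm := memLp_top_of_continuous hΩ ho.measurableSet (continuous_smul_id (E := E) hc)
  have h1 := integrable_inner_mulOp hm v w
  rw [inner_mulOp hm]
  simp only [_root_.smul_apply, ContinuousLinearMap.id_apply, inner_smul_left] at h1 ⊢
  exact ⟨h1, rfl⟩

theorem hasInt_dotOp (hΩ : Bornology.IsBounded Ω) (ho : IsOpen Ω) {Y : E3 → E3}
    (hY : Continuous Y) (v : L2Vec Ω) (w : L2 Ω) :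
    HasInt Ω (fun x => inner ℝ (Y x) (v x) * w x) (inner ℝ (dotOp Ω Y v) w) := by
  have hm := memLp_top_of_continuous hΩ ho.measurableSet (continuous_innerSL hY)
  have h1 := integrable_inner_mulOp hm v w
  rw [inner_mulOp hm]
  have e : ∀ x, inner ℝ ((innerSL ℝ (Y x)) (v x)) (w x) = inner ℝ (Y x) (v x) * w x := fun x => by
    simp [mul_comm]
  simp only [e] at h1 ⊢
  exact ⟨h1, rfl⟩

theorem hasInt_adjOp (hΩ : Bornology.IsBounded Ω) (ho : IsOpen Ω) {X : E3 → E3}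
    (hX : ContDiff ℝ 1 X) (v : L2Vec Ω) :
    HasInt Ω (fun x => inner ℝ (v x) (fderiv ℝ X x (v x))) (inner ℝ (adjOp Ω X v) v) := by
  have hm := memLp_top_of_continuous hΩ ho.measurableSet (continuous_adjoint_fderiv hX)
  have h1 := integrable_inner_mulOp hm v v
  rw [inner_mulOp hm]
  simp only [ContinuousLinearMap.adjoint_inner_left] at h1 ⊢
  exact ⟨h1, rfl⟩

theorem hasInt_pot (hΩ : Bornology.IsBounded Ω) (ho : IsOpen Ω) {c : E3 → ℝ}
    (hc : Continuous c) (v : H10 Ω) :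
    HasInt Ω (fun x => c x * (toL2 v x ^ 6 / 6)) (pot Ω c (toL2 v)) :=
  ⟨integrable_mul_sixth hΩ ho hc v, rfl⟩

/-- The energy density. -/
def edens (z : H10 Ω × L2 Ω) (x : E3) : ℝ :=
  (z.2 x ^ 2 + ‖gradH z.1 x‖ ^ 2) / 2 + toL2 z.1 x ^ 6 / 6

theorem edens_nonneg (z : H10 Ω × L2 Ω) (x : E3) : 0 ≤ edens z x := by
  unfold edens
  positivity

namespace Multiplier

def density (m : Multiplier) (t : ℝ) (z : H10 Ω × L2 Ω) (x : E3) : ℝ :=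
  m.a t x * edens z x + inner ℝ (m.X t x) (gradH z.1 x) * z.2 x + m.b t x * toL2 z.1 x * z.2 x

/-- The terms are grouped for pointwise estimates: div X multiplies minus the Lagrangian density,
and b multiplies the equipartition defect. -/
def rateDensity (m : Multiplier) (t : ℝ) (z : H10 Ω × L2 Ω) (x : E3) : ℝ :=
  m.a' t x * edens z x - inner ℝ (gradient (m.a t) x) (gradH z.1 x) * z.2 x +
    inner ℝ (m.X' t x) (gradH z.1 x) * z.2 x +
    dv (fderiv ℝ (m.X t) x) * ((‖gradH z.1 x‖ ^ 2 - z.2 x ^ 2) / 2 + toL2 z.1 x ^ 6 / 6) -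
    inner ℝ (gradH z.1 x) (fderiv ℝ (m.X t) x (gradH z.1 x)) +
    m.b' t x * toL2 z.1 x * z.2 x +
    m.b t x * (z.2 x ^ 2 - ‖gradH z.1 x‖ ^ 2 - toL2 z.1 x ^ 6) -
    inner ℝ (gradient (m.b t) x) (gradH z.1 x) * toL2 z.1 x

end Multiplier

namespace IsMultiplier

variable {I : Set ℝ} {m : Multiplier} {t : ℝ}

theorem hasInt_total (h : IsMultiplier Ω I m) (hΩ : Bornology.IsBounded Ω) (ho : IsOpen Ω)
    (ht : t ∈ I) (z : H10 Ω × L2 Ω) : HasInt Ω (m.density t z) (m.total Ω t z) := by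
  have ca := (h.smooth_a t ht).continuous
  have cb := (h.smooth_b t ht).continuous
  have cX := (h.pushing t ht).smooth.continuous
  refine ((((((hasInt_smulOp hΩ ho ca z.2 z.2).add (hasInt_smulOp hΩ ho ca (gradH z.1)
    (gradH z.1))).div_const 2).add (hasInt_dotOp hΩ ho cX (gradH z.1) z.2)).add
    (hasInt_smulOp hΩ ho cb (toL2 z.1) z.2)).add (hasInt_pot hΩ ho ca z.1)).congr fun x => ?_
  simp only [Multiplier.density, edens, real_inner_self_eq_norm_sq, RCLike.inner_apply, conj_trivial]
  ring

theorem hasInt_totalRate (h : IsMultiplier Ω I m) (hΩ : Bornology.IsBounded Ω) (ho : IsOpen Ω)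
    (ht : t ∈ I) (z : H10 Ω × L2 Ω) : HasInt Ω (m.rateDensity t z) (m.totalRate Ω t z) := by
  have ca' := continuous_slice h.cont_a' ht
  have cb' := continuous_slice h.cont_b' ht
  have cX' := continuous_slice h.cont_X' ht
  have cga := continuous_slice h.cont_gradient_a ht
  have cgb := continuous_slice h.cont_gradient_b ht
  have cb := (h.smooth_b t ht).continuous
  have cX := (h.pushing t ht).contDiff_one
  have cd := continuous_dv_fderiv cX
  have k1 := ((hasInt_smulOp hΩ ho ca' z.2 z.2).add
    (hasInt_smulOp hΩ ho ca' (gradH z.1) (gradH z.1))).div_const 2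
  have k2 := (k1.sub (hasInt_dotOp hΩ ho cga (gradH z.1) z.2)).add
    (hasInt_dotOp hΩ ho cX' (gradH z.1) z.2)
  have k3 := (k2.sub ((hasInt_smulOp hΩ ho cd z.2 z.2).div_const 2)).add
    ((hasInt_smulOp hΩ ho cd (gradH z.1) (gradH z.1)).div_const 2)
  have k4 := ((k3.sub (hasInt_adjOp hΩ ho cX (gradH z.1))).add
    (hasInt_smulOp hΩ ho cb' (toL2 z.1) z.2)).add (hasInt_smulOp hΩ ho cb z.2 z.2)
  have k5 := (k4.sub (hasInt_smulOp hΩ ho cb (gradH z.1) (gradH z.1))).sub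
    (hasInt_dotOp hΩ ho cgb (gradH z.1) (toL2 z.1))
  have k6 := ((k5.add (hasInt_pot hΩ ho ca' z.1)).add (hasInt_pot hΩ ho cd z.1)).sub
    ((hasInt_pot hΩ ho cb z.1).const_mul 6)
  refine k6.congr fun x => ?_
  simp only [Multiplier.rateDensity, edens, real_inner_self_eq_norm_sq, RCLike.inner_apply, conj_trivial]
  ring

end IsMultiplier

theorem integrableOn_edens (hΩ : Bornology.IsBounded Ω) (ho : IsOpen Ω) (z : H10 Ω × L2 Ω) :
    IntegrableOn (edens z) Ω := by
  refine ((((hasInt_smulOp hΩ ho (continuous_const (y := (1 : ℝ))) z.2 z.2).add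
    (hasInt_smulOp hΩ ho (continuous_const (y := (1 : ℝ))) (gradH z.1) (gradH z.1))).div_const
    2).add (hasInt_pot hΩ ho (continuous_const (y := (1 : ℝ))) z.1)).congr (fun x => ?_) |>.1
  simp only [edens, real_inner_self_eq_norm_sq, Real.norm_eq_abs, sq_abs]
  ring

end

/-! ### An almost radial pushing field near x₀. -/

section

variable {Ω : Set E3}

/-- A perturbation of the radial field which is transversal to the boundary. -/
def inward (x₀ w : E3) (x : E3) : E3 := (x - x₀) - ‖x - x₀‖ ^ 2 • w

theorem norm_inward_le {x₀ w x : E3} (h : ‖x - x₀‖ * ‖w‖ ≤ 1) :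
    ‖inward x₀ w x‖ ≤ 2 * ‖x - x₀‖ := by
  refine (norm_sub_le _ _).trans ?_
  rw [norm_smul, norm_pow, norm_norm]
  nlinarith [norm_nonneg (x - x₀)]

theorem norm_shift_inward_le {x₀ w x : E3} (h : ‖x - x₀‖ * ‖w‖ ≤ 1) {σ : ℝ}
    (hσ : σ ∈ Icc (0 : ℝ) 1) : ‖x - σ • inward x₀ w x - x₀‖ ≤ ‖x - x₀‖ := by
  have e : x - σ • inward x₀ w x - x₀ = (1 - σ) • (x - x₀) + (σ * ‖x - x₀‖ ^ 2) • w := by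
    simp only [inward, smul_sub, sub_smul, one_smul, mul_smul]
    abel
  rw [e]
  refine (norm_add_le _ _).trans ?_
  rw [norm_smul, norm_smul, Real.norm_of_nonneg (by linarith [hσ.2]),
    Real.norm_of_nonneg (mul_nonneg hσ.1 (sq_nonneg _))]
  have := mul_le_mul_of_nonneg_left h (mul_nonneg hσ.1 (norm_nonneg (x - x₀)))
  nlinarith

theorem taylor_bound_on {φ : E3 → ℝ} {B : Set E3} (hB : Convex ℝ B) (ho : IsOpen B)
    (hφ : DifferentiableOn ℝ φ B) {K : NNReal} (hK : LipschitzOnWith K (fderiv ℝ φ) B) {a b : E3}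
    (ha : a ∈ B) (hb : b ∈ B) :
    |φ b - φ a - fderiv ℝ φ a (b - a)| ≤ K * ‖b - a‖ ^ 2 := by
  have hseg : segment ℝ a b ⊆ B := hB.segment_subset ha hb
  have key := (convex_segment a b).norm_image_sub_le_of_norm_hasFDerivWithin_le
    (f := fun y => φ y - fderiv ℝ φ a y) (f' := fun y => fderiv ℝ φ y - fderiv ℝ φ a)
    (C := K * ‖b - a‖) (x := a) (y := b)
    (fun y hy => (((hφ.differentiableAt (ho.mem_nhds (hseg hy))).hasFDerivAt).sub
      (fderiv ℝ φ a).hasFDerivAt).hasFDerivWithinAt)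
    (fun y hy => by
      refine (hK.norm_sub_le (hseg hy) ha).trans (mul_le_mul_of_nonneg_left ?_ K.2)
      obtain ⟨θ, ⟨h0, h1⟩, rfl⟩ := segment_eq_image' ℝ a b ▸ hy
      rw [add_sub_cancel_left, norm_smul, Real.norm_of_nonneg h0]
      nlinarith [norm_nonneg (b - a)]) (left_mem_segment ℝ _ _) (right_mem_segment ℝ _ _)
  rw [Real.norm_eq_abs, mul_assoc, ← sq] at key
  refine le_trans (le_of_eq ?_) key
  congr 1
  rw [map_sub]
  ring

/-- At a boundary point near x₀, x - x₀ is tangential up to O(|x - x₀|²), so subtracting a large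
multiple of |x - x₀|² times the outward normal direction makes the field point inward while changing
it only to second order. -/
theorem inward_boundary (hΩ : IsSmoothBoundedDomain Ω) {x₀ : E3} (hx₀ : x₀ ∈ frontier Ω) :
    ∃ (w : E3) (r : ℝ), 0 < r ∧ r * ‖w‖ ≤ 1 ∧ ∀ y ∉ Ω, ‖y - x₀‖ < r →
      ∀ σ ∈ Icc (0 : ℝ) 1, y - σ • inward x₀ w y ∉ Ω := by
  obtain ⟨U, ρ, hU, hxU, hρ, hne, hiff⟩ := hΩ.smooth_boundary x₀ hx₀
  have hat : ContDiffAt ℝ ∞ ρ x₀ := hρ.contDiffAt (hU.mem_nhds hxU)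
  obtain ⟨K, s, hs, hK⟩ := (hat.fderiv_right (m := 1) (by norm_cast)).exists_lipschitzOnWith
  set n := gradient ρ x₀ with hn
  have hDn : fderiv ℝ ρ x₀ n = ‖n‖ ^ 2 := by
    rw [← inner_gradient_left, ← hn, real_inner_self_eq_norm_sq]
  have hn0 : n ≠ 0 := fun h => hne (by
    have : InnerProductSpace.toDual ℝ E3 n = fderiv ℝ ρ x₀ := by simp [hn, gradient]
    rw [← this, h, map_zero])
  have hN : 0 < ‖n‖ ^ 2 := by positivity
  have hcont : ContinuousAt (fun y => fderiv ℝ ρ y n) x₀ :=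
    (hat.fderiv_right (m := 1) (by norm_cast)).continuousAt.clm_apply continuousAt_const
  have hev : ∀ᶠ y in 𝓝 x₀, ‖n‖ ^ 2 / 2 < fderiv ℝ ρ y n :=
    hcont.eventually_const_lt (by simp only [hDn]; linarith)
  obtain ⟨r₀, hr₀, hball⟩ := Metric.mem_nhds_iff.1
    (inter_mem (inter_mem hs (hU.mem_nhds hxU)) hev)
  have hρ0 : ρ x₀ = 0 := by
    refine le_antisymm ?_ ?_
    -- A frontier point is a limit of points of Ω, where ρ < 0, so ρ cannot be positive there; it is
    -- nonnegative because x₀ is not in the open set Ω.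
    · by_contra! hpos
      have hmem : {y | 0 < ρ y} ∩ U ∈ 𝓝 x₀ :=
        inter_mem (hat.continuousAt.eventually_const_lt hpos) (hU.mem_nhds hxU)
      obtain ⟨y, hy, hyΩ⟩ := mem_closure_iff_nhds.1 (frontier_subset_closure hx₀) _ hmem
      exact lt_asymm hy.1 ((hiff y hy.2).1 hyΩ)
    · have : x₀ ∉ Ω := fun h => (hΩ.isOpen.frontier_eq ▸ hx₀).2 h
      exact not_lt.1 fun h => this ((hiff x₀ hxU).2 h)
  -- Near x₀ the derivative of ρ along n is at least ‖n‖²/2, so this choice yields 5K: one K for the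
  -- Taylor remainder from y to x₀, and 4K for the remainder of the shift, as |Y| ≤ 2|y - x₀|.
  set C := 10 * (K : ℝ) / ‖n‖ ^ 2 with hC
  have hC0 : 0 ≤ C := by positivity
  set w := C • n with hw
  refine ⟨w, min r₀ (1 / (‖w‖ + 1)), lt_min hr₀ (by positivity), ?_, ?_⟩
  · calc min r₀ (1 / (‖w‖ + 1)) * ‖w‖ ≤ 1 / (‖w‖ + 1) * ‖w‖ :=
        mul_le_mul_of_nonneg_right (min_le_right _ _) (norm_nonneg _)
      _ ≤ 1 := by
        rw [one_div_mul_eq_div, div_le_one (by positivity)]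
        linarith
  intro y hy hyr σ hσ
  have hy1 : ‖y - x₀‖ < r₀ := hyr.trans_le (min_le_left _ _)
  have hy2 : ‖y - x₀‖ * ‖w‖ ≤ 1 := by
    have h1 : ‖y - x₀‖ < 1 / (‖w‖ + 1) := hyr.trans_le (min_le_right _ _)
    rw [lt_div_iff₀ (by positivity)] at h1
    nlinarith [norm_nonneg (y - x₀)]
  have hyB : y ∈ Metric.ball x₀ r₀ := by rwa [mem_ball_iff_norm]
  have hy'B : y - σ • inward x₀ w y ∈ Metric.ball x₀ r₀ := by
    rw [mem_ball_iff_norm]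
    exact (norm_shift_inward_le hy2 hσ).trans_lt hy1
  have hdiff : DifferentiableOn ℝ ρ (Metric.ball x₀ r₀) :=
    (hρ.differentiableOn (by simp)).mono fun z hz => (hball hz).1.2
  have hLip : LipschitzOnWith K (fderiv ℝ ρ) (Metric.ball x₀ r₀) :=
    hK.mono fun z hz => (hball hz).1.1
  have t1 := taylor_bound_on (convex_ball x₀ r₀) Metric.isOpen_ball hdiff hLip hyB hy'B
  have t2 := taylor_bound_on (convex_ball x₀ r₀) Metric.isOpen_ball hdiff hLip hyB
    (Metric.mem_ball_self hr₀)
  have hDy : ‖n‖ ^ 2 / 2 < fderiv ℝ ρ y n := (hball hyB).2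
  have hρy : 0 ≤ ρ y := not_lt.1 fun h => hy ((hiff y (hball hyB).1.2).2 h)
  intro hmem
  have hneg := (hiff _ (hball hy'B).1.2).1 hmem
  have e1 : y - σ • inward x₀ w y - y = -(σ • inward x₀ w y) := by abel
  have e2 : x₀ - y = -(y - x₀) := by abel
  have e3 : fderiv ℝ ρ y (inward x₀ w y) =
      fderiv ℝ ρ y (y - x₀) - ‖y - x₀‖ ^ 2 * (C * fderiv ℝ ρ y n) := by
    simp [inward, hw]
  rw [e1, map_neg, map_smul, smul_eq_mul, e3, norm_neg, norm_smul, Real.norm_of_nonneg hσ.1] at t1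
  rw [e2, map_neg, norm_neg, hρ0] at t2
  have h1 := (abs_le.1 t1).1
  have h2 := (abs_le.1 t2).2
  have h3 : (σ * ‖inward x₀ w y‖) ^ 2 ≤ σ * (4 * ‖y - x₀‖ ^ 2) := by
    have h4 := norm_inward_le hy2
    have h5 : ‖inward x₀ w y‖ ^ 2 ≤ (2 * ‖y - x₀‖) ^ 2 := by gcongr
    rw [mul_pow]
    have h6 : σ ^ 2 ≤ σ := by nlinarith [hσ.1, hσ.2]
    nlinarith [sq_nonneg ‖inward x₀ w y‖, hσ.1]
  have h7 : 5 * K ≤ C * fderiv ℝ ρ y n := by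
    have : C * (‖n‖ ^ 2 / 2) = 5 * K := by
      rw [hC]
      field_simp
      ring
    rw [← this]
    exact mul_le_mul_of_nonneg_left hDy.le hC0
  have hK0 : (0 : ℝ) ≤ K := K.2
  have h8 : σ * (‖y - x₀‖ ^ 2 * (5 * K)) ≤ σ * (‖y - x₀‖ ^ 2 * (C * fderiv ℝ ρ y n)) := by
    have := hσ.1
    gcongr
  have h9 := mul_le_mul_of_nonneg_left h3 hK0
  have h10 : σ * (fderiv ℝ ρ y (y - x₀)) ≤ σ * (ρ y + K * ‖y - x₀‖ ^ 2) :=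
    mul_le_mul_of_nonneg_left (by linarith) hσ.1
  have h11 : 0 ≤ (1 - σ) * ρ y := mul_nonneg (by linarith [hσ.2]) hρy
  -- In sum ρ(y - σY) ≥ (1 - σ)ρ(y) ≥ 0, which contradicts membership in Ω.
  nlinarith

theorem exists_inward (hΩ : IsSmoothBoundedDomain Ω) {x₀ : E3} (hx₀ : x₀ ∈ closure Ω) :
    ∃ (w : E3) (r : ℝ), 0 < r ∧ r * ‖w‖ ≤ 1 ∧ ∀ y ∉ Ω, ‖y - x₀‖ < r →
      ∀ σ ∈ Icc (0 : ℝ) 1, y - σ • inward x₀ w y ∉ Ω := by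
  by_cases h : x₀ ∈ Ω
  · obtain ⟨r, hr, hb⟩ := Metric.isOpen_iff.1 hΩ.isOpen x₀ h
    -- For an interior point the radial field works on a ball contained in Ω, where the condition is
    -- vacuous.
    exact ⟨0, r, hr, by simp, fun y hy hyr => absurd (hb (by rwa [mem_ball_iff_norm])) hy⟩
  · exact inward_boundary hΩ (by rw [hΩ.isOpen.frontier_eq]; exact ⟨hx₀, h⟩)

theorem contDiff_inward (x₀ w : E3) : ContDiff ℝ ∞ (inward x₀ w) := by
  unfold inward
  exact (contDiff_id.sub contDiff_const).sub
    (((contDiff_id.sub contDiff_const).norm_sq ℝ).smul contDiff_const)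

/-- A cut-off with values in [0, 1] only reparametrizes σ as σψ(y), and outside the ball of radius r
the field vanishes. -/
theorem isPushing_smul_inward {x₀ w : E3} {r : ℝ}
    (h : ∀ y ∉ Ω, ‖y - x₀‖ < r → ∀ σ ∈ Icc (0 : ℝ) 1, y - σ • inward x₀ w y ∉ Ω) {ψ : E3 → ℝ}
    (hψ : ContDiff ℝ ∞ ψ) (hc : HasCompactSupport ψ) (h01 : ∀ x, ψ x ∈ Icc (0 : ℝ) 1)
    (hs : ∀ x, r ≤ ‖x - x₀‖ → ψ x = 0) : IsPushing Ω fun x => ψ x • inward x₀ w x := by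
  refine ⟨hψ.smul (contDiff_inward x₀ w), hc.smul_right, fun σ hσ y hy => ?_⟩
  by_cases hr : r ≤ ‖y - x₀‖
  · simpa [shift, hs y hr] using hy
  · have := h y hy (not_le.1 hr) (σ * ψ y)
      ⟨mul_nonneg hσ.1 (h01 y).1, mul_le_one₀ hσ.2 (h01 y).1 (h01 y).2⟩
    rwa [shift, smul_smul]

end

/-! ### Energies weighted by functions of |x - x₀|/(t₀ - t). -/

section

variable {Ω : Set E3} {t₀ t : ℝ} {x₀ : E3} {Θ : ℝ → ℝ}

/-- The squared ratio of the distance to `x₀` and the time left until `t₀`. -/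
def sim (t₀ : ℝ) (x₀ : E3) (t : ℝ) (x : E3) : ℝ := ‖x - x₀‖ ^ 2 / (t₀ - t) ^ 2

theorem sim_nonneg (t₀ : ℝ) (x₀ : E3) (t : ℝ) (x : E3) : 0 ≤ sim t₀ x₀ t x := by
  unfold sim
  positivity

theorem sq_norm_eq (ht : t < t₀) (x : E3) :
    ‖x - x₀‖ ^ 2 = sim t₀ x₀ t x * (t₀ - t) ^ 2 := by
  have : t₀ - t ≠ 0 := by linarith
  unfold sim
  field_simp

theorem norm_eq_sqrt_sim (ht : t < t₀) (x : E3) :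
    ‖x - x₀‖ = √(sim t₀ x₀ t x) * (t₀ - t) := by
  have h : 0 < t₀ - t := by linarith
  rw [sim, Real.sqrt_div (sq_nonneg _), Real.sqrt_sq (norm_nonneg _), Real.sqrt_sq h.le]
  field_simp

theorem hasDerivAt_sim (ht : t < t₀) (x : E3) :
    HasDerivAt (fun s => sim t₀ x₀ s x) (2 * sim t₀ x₀ t x / (t₀ - t)) t := by
  have h : t₀ - t ≠ 0 := by linarith
  have h1 : HasDerivAt (fun s => (t₀ - s) ^ 2) (-(2 * (t₀ - t))) t := by
    have := HasDerivAt.comp_const_sub t₀ t (hasDerivAt_pow 2 (t₀ - t))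
    simpa using this
  have h2 := (hasDerivAt_const t (‖x - x₀‖ ^ 2)).div h1 (by positivity)
  refine h2.congr_deriv ?_
  unfold sim
  field_simp
  ring

theorem contDiff_sim (t₀ : ℝ) (x₀ : E3) (t : ℝ) : ContDiff ℝ ∞ (sim t₀ x₀ t) := by
  unfold sim
  exact ((contDiff_id.sub contDiff_const).norm_sq ℝ).div_const _

theorem continuousOn_sim (t₀ : ℝ) (x₀ : E3) :
    ContinuousOn (Function.uncurry (sim t₀ x₀)) (Iio t₀ ×ˢ univ) := by
  unfold sim
  refine ContinuousOn.div (by fun_prop) (by fun_prop) fun p hp => ?_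
  have : p.1 < t₀ := hp.1
  exact pow_ne_zero 2 (by linarith)

theorem hasGradientAt_sim (t₀ : ℝ) (x₀ : E3) (t : ℝ) (x : E3) :
    HasGradientAt (sim t₀ x₀ t) ((2 / (t₀ - t) ^ 2) • (x - x₀)) x := by
  rw [hasGradientAt_iff_hasFDerivAt]
  have h1 : HasFDerivAt (fun y => ‖y - x₀‖ ^ 2) (2 • innerSL ℝ (x - x₀)) x := by
    simpa using ((hasFDerivAt_id x).sub_const x₀).norm_sq
  have h2 := h1.mul_const ((t₀ - t) ^ 2)⁻¹
  refine (h2.congr_fderiv ?_).congr_of_eventuallyEq (Eventually.of_forall fun y => ?_)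
  · ext ξ
    simp only [_root_.smul_apply, innerSL_apply_apply, InnerProductSpace.toDual_apply_apply,
      inner_smul_left, smul_eq_mul, conj_trivial, nsmul_eq_mul]
    push_cast
    ring
  · simp only [sim, div_eq_mul_inv]

theorem hasDerivAt_cut (hΘ : ContDiff ℝ ∞ Θ) (ht : t < t₀) (x : E3) :
    HasDerivAt (fun s => Θ (sim t₀ x₀ s x))
      (deriv Θ (sim t₀ x₀ t x) * (2 * sim t₀ x₀ t x / (t₀ - t))) t :=
  ((hΘ.differentiable (by simp) _).hasDerivAt).comp t (hasDerivAt_sim ht x)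

theorem gradient_cut (hΘ : ContDiff ℝ ∞ Θ) (t₀ : ℝ) (x₀ : E3) (t : ℝ) (x : E3) :
    gradient (fun y => Θ (sim t₀ x₀ t y)) x =
      (deriv Θ (sim t₀ x₀ t x) * (2 / (t₀ - t) ^ 2)) • (x - x₀) := by
  refine HasGradientAt.gradient ?_
  rw [hasGradientAt_iff_hasFDerivAt]
  have h1 := ((hΘ.differentiable (by simp) (sim t₀ x₀ t x)).hasDerivAt).comp_hasFDerivAt x
    (hasGradientAt_sim t₀ x₀ t x).hasFDerivAt
  refine h1.congr_fderiv ?_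
  ext ξ
  simp
  ring

theorem continuous_deriv_profile (hΘ : ContDiff ℝ ∞ Θ) : Continuous (deriv Θ) :=
  hΘ.continuous_deriv (by simp)

theorem continuousOn_cut_deriv (hΘ : ContDiff ℝ ∞ Θ) (t₀ : ℝ) (x₀ : E3) :
    ContinuousOn (Function.uncurry fun t x => deriv Θ (sim t₀ x₀ t x) *
      (2 * sim t₀ x₀ t x / (t₀ - t))) (Iio t₀ ×ˢ univ) := by
  refine ((continuous_deriv_profile hΘ).comp_continuousOn (continuousOn_sim t₀ x₀)).mul
    (((continuousOn_sim t₀ x₀).const_mul 2).div (by fun_prop) fun p hp => ?_)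
  have : p.1 < t₀ := hp.1
  linarith

theorem continuousOn_cut_gradient (hΘ : ContDiff ℝ ∞ Θ) (t₀ : ℝ) (x₀ : E3) :
    ContinuousOn (Function.uncurry fun t x => gradient (fun y => Θ (sim t₀ x₀ t y)) x)
      (Iio t₀ ×ˢ univ) := by
  simp only [gradient_cut hΘ]
  refine (((continuous_deriv_profile hΘ).comp_continuousOn (continuousOn_sim t₀ x₀)).mul
    (ContinuousOn.div continuousOn_const (by fun_prop) fun p hp => ?_)).smul (by fun_prop)
  have : p.1 < t₀ := hp.1
  exact pow_ne_zero 2 (by linarith)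

/-- Nonincreasing smooth profiles which are constant on `(-∞, 1]`. -/
structure IsProfile (Θ : ℝ → ℝ) : Prop where
  smooth : ContDiff ℝ ∞ Θ
  nonneg : ∀ s, 0 ≤ Θ s
  le_one : ∀ s, Θ s ≤ 1
  deriv_nonpos : ∀ s, deriv Θ s ≤ 0
  deriv_eq_zero : ∀ s ≤ 1, deriv Θ s = 0

/-- The multiplier `Θ ∂ₜu`. -/
def coneMultiplier (t₀ : ℝ) (x₀ : E3) (Θ : ℝ → ℝ) : Multiplier where
  a t x := Θ (sim t₀ x₀ t x)
  a' t x := deriv Θ (sim t₀ x₀ t x) * (2 * sim t₀ x₀ t x / (t₀ - t))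
  b _ _ := 0
  b' _ _ := 0
  X _ _ := 0
  X' _ _ := 0

theorem isPushing_zero (Ω : Set E3) : IsPushing Ω fun _ => (0 : E3) where
  smooth := contDiff_const
  compact := HasCompactSupport.zero
  push σ _ y hy := by simpa [shift] using hy

theorem Ioo_prod_subset (t₀ : ℝ) : Ioo 0 t₀ ×ˢ (univ : Set E3) ⊆ Iio t₀ ×ˢ univ :=
  prod_mono Ioo_subset_Iio_self le_rfl

theorem isMultiplier_cone (Ω : Set E3) (t₀ : ℝ) (x₀ : E3) (hΘ : IsProfile Θ) :
    IsMultiplier Ω (Ioo 0 t₀) (coneMultiplier t₀ x₀ Θ) where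
  smooth_a t _ := hΘ.smooth.comp (contDiff_sim t₀ x₀ t)
  smooth_b _ _ := contDiff_const
  pushing _ _ := isPushing_zero Ω
  hasDerivAt_a _ ht x := hasDerivAt_cut hΘ.smooth ht.2 x
  hasDerivAt_b t _ _ := hasDerivAt_const t _
  hasDerivAt_X t _ _ := hasDerivAt_const t _
  cont_a' := (continuousOn_cut_deriv hΘ.smooth t₀ x₀).mono (Ioo_prod_subset t₀)
  cont_b' := continuousOn_const
  cont_X' := continuousOn_const
  cont_gradient_a := (continuousOn_cut_gradient hΘ.smooth t₀ x₀).mono (Ioo_prod_subset t₀)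
  cont_gradient_b := by
    have : (fun t => gradient ((coneMultiplier t₀ x₀ Θ).b t)) = fun _ _ => 0 := by
      funext t x
      simp [coneMultiplier, gradient]
    rw [this]
    exact continuousOn_const
  cont_fderiv := by
    have : (fun t => fderiv ℝ ((coneMultiplier t₀ x₀ Θ).X t)) = fun _ _ => 0 := by
      funext t x
      simp [coneMultiplier]
    rw [this]
    exact continuousOn_const

theorem abs_mul_le_edens (z : H10 Ω × L2 Ω) (x : E3) : |z.2 x| * ‖gradH z.1 x‖ ≤ edens z x := by
  have h6 : 0 ≤ toL2 z.1 x ^ 6 / 6 := by positivity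
  have h := sq_abs (z.2 x)
  unfold edens
  nlinarith [sq_nonneg (|z.2 x| - ‖gradH z.1 x‖)]

/-- The weight decreases in time at rate 2s|Θ'|/τ, while the energy flux through its level sets is
at most 2√s|Θ'|/τ times the energy density, as |∂ₜu||∇u| ≤ e. The difference is a loss exactly where
s > 1. -/
theorem cone_rateDensity_le (hΘ : IsProfile Θ) (ht : t < t₀) (z : H10 Ω × L2 Ω) (x : E3) :
    (coneMultiplier t₀ x₀ Θ).rateDensity t z x ≤ 2 / (t₀ - t) * (deriv Θ (sim t₀ x₀ t x) *
      (sim t₀ x₀ t x - √(sim t₀ x₀ t x))) * edens z x := by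
  have hτ : 0 < t₀ - t := by linarith
  have hd : 0 ≤ -deriv Θ (sim t₀ x₀ t x) := by linarith [hΘ.deriv_nonpos (sim t₀ x₀ t x)]
  have h0 : gradient (fun _ : E3 => (0 : ℝ)) x = 0 := by simp [gradient]
  have h1 : fderiv ℝ (fun _ : E3 => (0 : E3)) x = 0 := by simp
  simp only [Multiplier.rateDensity, coneMultiplier, gradient_cut hΘ.smooth, h0, inner_zero_left,
    h1, dv, inner_smul_left, conj_trivial]
  simp only [zero_mul, _root_.zero_apply, PiLp.zero_apply, Finset.sum_const_zero,
    inner_zero_right, add_zero, sub_zero]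
  have key : inner ℝ (x - x₀) (gradH z.1 x) * z.2 x ≤
      √(sim t₀ x₀ t x) * (t₀ - t) * edens z x := by
    rw [← norm_eq_sqrt_sim ht]
    calc inner ℝ (x - x₀) (gradH z.1 x) * z.2 x
        ≤ |inner ℝ (x - x₀) (gradH z.1 x)| * |z.2 x| := by rw [← abs_mul]; exact le_abs_self _
      _ ≤ ‖x - x₀‖ * ‖gradH z.1 x‖ * |z.2 x| := by
          gcongr
          exact abs_real_inner_le_norm _ _
      _ = ‖x - x₀‖ * (|z.2 x| * ‖gradH z.1 x‖) := by ring
      _ ≤ ‖x - x₀‖ * edens z x := by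
          gcongr
          exact abs_mul_le_edens z x
  have h2 := mul_le_mul_of_nonneg_left key
    (mul_nonneg hd (by positivity : 0 ≤ 2 / (t₀ - t) ^ 2))
  have e : -deriv Θ (sim t₀ x₀ t x) * (2 / (t₀ - t) ^ 2) *
      (√(sim t₀ x₀ t x) * (t₀ - t) * edens z x) =
      -deriv Θ (sim t₀ x₀ t x) * (2 / (t₀ - t)) * √(sim t₀ x₀ t x) * edens z x := by
    field_simp
  rw [e] at h2
  have e2 : 2 * sim t₀ x₀ t x / (t₀ - t) = 2 / (t₀ - t) * sim t₀ x₀ t x := by ring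
  rw [e2]
  linarith

theorem IsProfile.coeff_nonpos (hΘ : IsProfile Θ) {s : ℝ} (hs : 0 ≤ s) :
    deriv Θ s * (s - √s) ≤ 0 := by
  rcases le_total s 1 with h | h
  · rw [hΘ.deriv_eq_zero s h, zero_mul]
  · refine mul_nonpos_of_nonpos_of_nonneg (hΘ.deriv_nonpos s) ?_
    rw [sub_nonneg, Real.sqrt_le_left hs]
    nlinarith

variable {u : ℝ → H10 Ω} {ut : ℝ → L2 Ω}

/-- The energy weighted by a profile. -/
def coneEnergy (Ω : Set E3) (t₀ : ℝ) (x₀ : E3) (Θ : ℝ → ℝ) (u : ℝ → H10 Ω) (ut : ℝ → L2 Ω)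
    (t : ℝ) : ℝ := ∫ x in Ω, Θ (sim t₀ x₀ t x) * edens (u t, ut t) x

theorem cone_hasInt (hΩ : IsSmoothBoundedDomain Ω) (hΘ : IsProfile Θ) (ht : t ∈ Ioo 0 t₀) :
    HasInt Ω (fun x => Θ (sim t₀ x₀ t x) * edens (u t, ut t) x)
      ((coneMultiplier t₀ x₀ Θ).total Ω t (u t, ut t)) := by
  refine ((isMultiplier_cone Ω t₀ x₀ hΘ).hasInt_total hΩ.isBounded hΩ.isOpen ht (u t, ut t)).congr
    fun x => ?_
  simp [Multiplier.density, coneMultiplier]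

theorem coneEnergy_nonneg (hΘ : IsProfile Θ) : 0 ≤ coneEnergy Ω t₀ x₀ Θ u ut t :=
  integral_nonneg fun _ => mul_nonneg (hΘ.nonneg _) (edens_nonneg _ _)

theorem coneEnergy_sub_le (hΩ : IsSmoothBoundedDomain Ω) (hΘ : IsProfile Θ)
    (hX : MemX Ω t₀ u ut) (heq : SatisfiesNLW Ω t₀ u) {S T c : ℝ} (hS : 0 < S) (hT : T < t₀)
    (hST : S ≤ T)
    (hc : ∀ t ∈ Icc S T, ∀ r, HasInt Ω ((coneMultiplier t₀ x₀ Θ).rateDensity t (u t, ut t)) r →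
      r ≤ c) :
    coneEnergy Ω t₀ x₀ Θ u ut T - coneEnergy Ω t₀ x₀ Θ u ut S ≤ c * (T - S) := by
  have h := isMultiplier_cone Ω t₀ x₀ hΘ
  have hJ : Icc S T ⊆ Ioo 0 t₀ := fun s hs => ⟨hS.trans_le hs.1, hs.2.trans_lt hT⟩
  obtain ⟨hi, hle⟩ := h.total_sub_le hΩ.isBounded hΩ.isOpen isOpen_Ioo hX heq hS hT hST hJ
  rw [coneEnergy, coneEnergy, (cone_hasInt hΩ hΘ (hJ (right_mem_Icc.2 hST))).2,
    (cone_hasInt hΩ hΘ (hJ (left_mem_Icc.2 hST))).2]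
  refine hle.trans ?_
  calc ∫ t in Icc S T, (coneMultiplier t₀ x₀ Θ).totalRate Ω t (u t, ut t)
      ≤ ∫ _ in Icc S T, c := setIntegral_mono_on hi (integrable_const _) measurableSet_Icc
        fun t ht => hc t ht _ (h.hasInt_totalRate hΩ.isBounded hΩ.isOpen (hJ ht) _)
    _ = c * (T - S) := by
        rw [setIntegral_const, Real.volume_real_Icc_of_le hST, smul_eq_mul, mul_comm]

theorem antitoneOn_coneEnergy (hΩ : IsSmoothBoundedDomain Ω) (hΘ : IsProfile Θ)
    (hX : MemX Ω t₀ u ut) (heq : SatisfiesNLW Ω t₀ u) :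
    AntitoneOn (coneEnergy Ω t₀ x₀ Θ u ut) (Ioo 0 t₀) := by
  intro S hS T hT hST
  have := coneEnergy_sub_le (x₀ := x₀) hΩ hΘ hX heq hS.1 hT.2 hST (c := 0) fun t ht r hr => by
    rw [← hr.2]
    refine integral_nonpos fun x => (cone_rateDensity_le hΘ (ht.2.trans_lt hT.2) _ x).trans ?_
    refine mul_nonpos_of_nonpos_of_nonneg (mul_nonpos_of_nonneg_of_nonpos ?_
      (hΘ.coeff_nonpos (sim_nonneg _ _ _ _))) (edens_nonneg _ _)
    have : 0 < t₀ - t := by linarith [ht.2, hT.2]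
    positivity
  linarith

/-- A nonincreasing function bounded below by 0 has a left limit at t₀. -/
theorem exists_tendsto_coneEnergy (hΩ : IsSmoothBoundedDomain Ω) (hΘ : IsProfile Θ) (ht₀ : 0 < t₀)
    (hX : MemX Ω t₀ u ut) (heq : SatisfiesNLW Ω t₀ u) :
    ∃ L, Tendsto (coneEnergy Ω t₀ x₀ Θ u ut) (𝓝[<] t₀) (𝓝 L) := by
  have hm := (antitoneOn_coneEnergy (x₀ := x₀) hΩ hΘ hX heq).neg
  have := hm.tendsto_nhdsWithin_Ioo_left (nonempty_Ioo.2 ht₀) (by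
    refine ⟨0, ?_⟩
    rintro _ ⟨t, _, rfl⟩
    exact neg_nonpos.2 (coneEnergy_nonneg hΘ))
  exact ⟨_, by simpa using this.neg⟩

end

/-! ### Vanishing of the energy in rings outside the light cone. -/

section

variable {Ω : Set E3} {t₀ t : ℝ} {x₀ : E3} {u : ℝ → H10 Ω} {ut : ℝ → L2 Ω}

/-- A smooth cut-off function, equal to `1` on `(-∞, c]` and to `0` on `[d, ∞)`. -/
def step (c d s : ℝ) : ℝ := Real.smoothTransition ((d - s) / (d - c))

theorem step_eq_one {c d s : ℝ} (h : c < d) (hs : s ≤ c) : step c d s = 1 :=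
  Real.smoothTransition.one_of_one_le ((one_le_div (by linarith)).2 (by linarith))

theorem step_eq_zero {c d s : ℝ} (h : c < d) (hs : d ≤ s) : step c d s = 0 :=
  Real.smoothTransition.zero_of_nonpos
    (div_nonpos_of_nonpos_of_nonneg (by linarith) (by linarith))

theorem step_nonneg (c d s : ℝ) : 0 ≤ step c d s := Real.smoothTransition.nonneg _

theorem step_le_one (c d s : ℝ) : step c d s ≤ 1 := Real.smoothTransition.le_one _

theorem contDiff_step (c d : ℝ) : ContDiff ℝ ∞ (step c d) :=
  Real.smoothTransition.contDiff.comp (by fun_prop)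

theorem deriv_eq_zero_of_Iio {f : ℝ → ℝ} (hf : ContDiff ℝ ∞ f) {c v : ℝ}
    (h : ∀ s ≤ c, f s = v) {s : ℝ} (hs : s ≤ c) : deriv f s = 0 := by
  have h1 : EqOn (deriv f) 0 (Iio c) := fun y hy => by
    have : f =ᶠ[𝓝 y] fun _ => v := by
      filter_upwards [Iio_mem_nhds hy] with a ha using h a ha.le
    simpa using this.deriv_eq
  have h2 := h1.closure (hf.continuous_deriv (by simp)) continuous_const
  rw [closure_Iio] at h2
  exact h2 hs

theorem isProfile_step {c d : ℝ} (hc : 1 ≤ c) (h : c < d) : IsProfile (step c d) where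
  smooth := contDiff_step c d
  nonneg := step_nonneg c d
  le_one := step_le_one c d
  deriv_nonpos s := by
    refine Antitone.deriv_nonpos (fun x y hxy => Real.smoothTransition.monotone ?_)
    have : 0 < d - c := by linarith
    gcongr
  deriv_eq_zero s hs := deriv_eq_zero_of_Iio (contDiff_step c d) (c := c)
    (fun s hs => step_eq_one h hs) (hs.trans hc)

theorem isProfile_one : IsProfile fun _ => 1 where
  smooth := contDiff_const
  nonneg _ := zero_le_one
  le_one _ := le_rfl
  deriv_nonpos _ := by simp
  deriv_eq_zero _ _ := by simp

theorem hasDerivAt_expNegInvGlue (x : ℝ) :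
    HasDerivAt expNegInvGlue (x⁻¹ ^ 2 * expNegInvGlue x) x := by
  have := expNegInvGlue.hasDerivAt_polynomial_eval_inv_mul (1 : Polynomial ℝ) x
  simpa using this

/-- A profile which is strictly decreasing on `[1, ∞)`. -/
def strictProfile (s : ℝ) : ℝ := 1 - expNegInvGlue (s - 1)

theorem deriv_strictProfile (s : ℝ) :
    deriv strictProfile s = -((s - 1)⁻¹ ^ 2 * expNegInvGlue (s - 1)) := by
  have := ((hasDerivAt_expNegInvGlue (s - 1)).comp_sub_const s 1).const_sub 1
  exact this.deriv

theorem isProfile_strictProfile : IsProfile strictProfile where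
  smooth := contDiff_const.sub (expNegInvGlue.contDiff.comp (by fun_prop))
  nonneg s := by
    unfold strictProfile expNegInvGlue
    split_ifs with h
    · norm_num
    · have : Real.exp (-(s - 1)⁻¹) ≤ 1 :=
        Real.exp_le_one_iff.2 (neg_nonpos.2 (inv_nonneg.2 (not_le.1 h).le))
      linarith
  le_one s := by
    have := expNegInvGlue.nonneg (s - 1)
    unfold strictProfile
    linarith
  deriv_nonpos s := by
    have := expNegInvGlue.nonneg (s - 1)
    rw [deriv_strictProfile]
    exact neg_nonpos.2 (by positivity)
  deriv_eq_zero s hs := by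
    rw [deriv_strictProfile, expNegInvGlue.zero_of_nonpos (by linarith)]
    simp

/-- From (√s - 1)² ≥ 0 comes s - √s ≥ (s - 1)/2, and expNegInvGlue is monotone, so both factors are
bounded below on [c, d]. -/
theorem exists_strictProfile_le {c d : ℝ} (hc : 1 < c) (hcd : c < d) : ∃ k > 0, ∀ s ∈ Icc c d,
    deriv strictProfile s * (s - √s) ≤ -k := by
  have hg : 0 < expNegInvGlue (c - 1) := expNegInvGlue.pos_of_pos (by linarith)
  have hd : 0 < d - 1 := by linarith
  have hc' : 0 < c - 1 := by linarith
  refine ⟨(d - 1)⁻¹ ^ 2 * expNegInvGlue (c - 1) * ((c - 1) / 2), by positivity, fun s hs => ?_⟩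
  have hs1 : 0 < s - 1 := by linarith [hs.1]
  have hs0 : 0 ≤ s := by linarith
  have h1 : (c - 1) / 2 ≤ s - √s := by
    have := Real.sq_sqrt hs0
    nlinarith [sq_nonneg (√s - 1), hs.1]
  have h2 : (d - 1)⁻¹ ^ 2 * expNegInvGlue (c - 1) ≤ (s - 1)⁻¹ ^ 2 * expNegInvGlue (s - 1) := by
    have h3 := expNegInvGlue.monotone (show c - 1 ≤ s - 1 by linarith [hs.1])
    have h4 : s - 1 ≤ d - 1 := by linarith [hs.2]
    gcongr
  rw [deriv_strictProfile, neg_mul, neg_le_neg_iff]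
  exact mul_le_mul h2 h1 (by positivity) (by have := expNegInvGlue.nonneg (s - 1); positivity)

theorem left_nhds_eventually_mem (ht₀ : 0 < t₀) : ∀ᶠ t in 𝓝[<] t₀, t ∈ Ioo 0 t₀ :=
  Ioo_mem_nhdsLT ht₀

theorem hasInt_ring (hΩ : IsSmoothBoundedDomain Ω) {Θ Θ' : ℝ → ℝ} (hΘ : IsProfile Θ)
    (hΘ' : IsProfile Θ') (ht : t ∈ Ioo 0 t₀) :
    HasInt Ω (fun x => (Θ (sim t₀ x₀ t x) - Θ' (sim t₀ x₀ t x)) * edens (u t, ut t) x)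
      (coneEnergy Ω t₀ x₀ Θ u ut t - coneEnergy Ω t₀ x₀ Θ' u ut t) := by
  have h := cone_hasInt (u := u) (ut := ut) (x₀ := x₀) hΩ hΘ ht
  have h' := cone_hasInt (u := u) (ut := ut) (x₀ := x₀) hΩ hΘ' ht
  rw [coneEnergy, coneEnergy, h.2, h'.2]
  exact (h.sub h').congr fun x => by ring

/-- The energy at a positive relative distance outside the backward light cone vanishes in the
limit `t → t₀`. -/
theorem tendsto_ring (hΩ : IsSmoothBoundedDomain Ω) (ht₀ : 0 < t₀)
    (hX : MemX Ω t₀ u ut) (heq : SatisfiesNLW Ω t₀ u) {c d : ℝ} (hc : 1 < c) (hcd : c < d)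
    (hd : d ≤ 3) :
    Tendsto (fun t => coneEnergy Ω t₀ x₀ (step 3 4) u ut t - coneEnergy Ω t₀ x₀ (step c d) u ut t)
      (𝓝[<] t₀) (𝓝 0) := by
  have p2 : IsProfile (step 3 4) := isProfile_step (by norm_num) (by norm_num)
  have p1 : IsProfile (step c d) := isProfile_step hc.le hcd
  obtain ⟨L1, hL1⟩ := exists_tendsto_coneEnergy (x₀ := x₀) hΩ p1 ht₀ hX heq
  obtain ⟨L2, hL2⟩ := exists_tendsto_coneEnergy (x₀ := x₀) hΩ p2 ht₀ hX heq
  obtain ⟨L3, hL3⟩ := exists_tendsto_coneEnergy (x₀ := x₀) hΩ isProfile_strictProfile ht₀ hX heq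
  have hw0 : ∀ s, 0 ≤ step 3 4 s - step c d s := fun s => by
    rcases le_total s 3 with h | h
    · rw [step_eq_one (by norm_num) h]
      linarith [step_le_one c d s]
    · rw [step_eq_zero hcd (hd.trans h)]
      linarith [step_nonneg 3 4 s]
  have hL := hL2.sub hL1
  have hL0 : 0 ≤ L2 - L1 := by
    refine ge_of_tendsto hL ?_
    filter_upwards [left_nhds_eventually_mem ht₀] with t ht
    rw [← (hasInt_ring hΩ p2 p1 ht).2]
    exact integral_nonneg fun x => mul_nonneg (hw0 _) (edens_nonneg _ _)
  rcases hL0.eq_or_lt with h | hpos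
  · rwa [← h] at hL
  -- Suppose the ring energy has a positive limit; the strictly decreasing profile then loses energy
  -- at a nonintegrable rate.
  exfalso
  obtain ⟨k, hk, hkle⟩ := exists_strictProfile_le hc (show c < 4 by linarith)
  have hev : ∀ᶠ t in 𝓝[<] t₀, (L2 - L1) / 2 ≤
      coneEnergy Ω t₀ x₀ (step 3 4) u ut t - coneEnergy Ω t₀ x₀ (step c d) u ut t :=
    (hL.eventually_const_lt (by linarith : (L2 - L1) / 2 < L2 - L1)).mono fun _ h => h.le
  obtain ⟨a, ha, hmem⟩ := (mem_nhdsLT_iff_exists_Ioo_subset).1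
    (hev.and (left_nhds_eventually_mem ht₀))
  -- The ring weight is supported in [c, 4], where the strict profile has loss coefficient at least
  -- k. The factor 2 of the rate offsets the lower bound (L2 - L1)/2 of the ring energy.
  have hrate : ∀ t ∈ Ioo a t₀, ∀ r, HasInt Ω ((coneMultiplier t₀ x₀ strictProfile).rateDensity t
      (u t, ut t)) r → r ≤ -(k * (L2 - L1)) / (t₀ - t) := by
    intro t ht r hr
    obtain ⟨h1, h2⟩ := hmem ht
    have hτ : 0 < t₀ - t := by linarith [ht.2]
    have h3 := (hasInt_ring (u := u) (ut := ut) (x₀ := x₀) hΩ p2 p1 h2).const_mul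
      (-(2 / (t₀ - t) * k))
    have h4 : r ≤ -(2 / (t₀ - t) * k) * (coneEnergy Ω t₀ x₀ (step 3 4) u ut t -
        coneEnergy Ω t₀ x₀ (step c d) u ut t) := by
      rw [← hr.2, ← h3.2]
      refine integral_mono hr.1 h3.1 fun x => ?_
      refine (cone_rateDensity_le isProfile_strictProfile ht.2 _ x).trans ?_
      rw [← mul_assoc (-_)]
      refine mul_le_mul_of_nonneg_right ?_ (edens_nonneg _ _)
      have hs := sim_nonneg t₀ x₀ t x
      generalize sim t₀ x₀ t x = s at hs
      rw [neg_mul, mul_assoc, ← mul_neg]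
      refine mul_le_mul_of_nonneg_left ?_ (by positivity)
      have hneg := isProfile_strictProfile.coeff_nonpos hs
      by_cases hsc : s ∈ Icc c 4
      · have := hkle s hsc
        have : step 3 4 s - step c d s ≤ 1 := by
          linarith [step_le_one 3 4 s, step_nonneg c d s]
        nlinarith
      · have : step 3 4 s - step c d s = 0 := by
          rcases lt_or_ge s c with h | h
          · rw [step_eq_one (by norm_num) (by linarith), step_eq_one hcd h.le, sub_self]
          · have h4 : 4 < s := not_le.1 fun h4 => hsc ⟨h, h4⟩
            rw [step_eq_zero (by norm_num) h4.le, step_eq_zero hcd (by linarith), sub_self]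
        rw [this]
        simpa using hneg
    refine h4.trans ?_
    have e : -(k * (L2 - L1)) / (t₀ - t) = -(2 / (t₀ - t) * k) * ((L2 - L1) / 2) := by
      field_simp
    rw [e]
    exact mul_le_mul_of_nonpos_left h1 (neg_nonpos.2 (by positivity))
  -- The interval [S, (S + t₀)/2] has length (t₀ - S)/2 and the loss rate on it is at least k(L2 -
  -- L1)/(t₀ - S), so the loss does not depend on S. As S → t₀ both end values have the same limit,
  -- a contradiction.
  have hdrop : ∀ S ∈ Ioo a t₀, coneEnergy Ω t₀ x₀ strictProfile u ut ((S + t₀) / 2) -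
      coneEnergy Ω t₀ x₀ strictProfile u ut S ≤ -(k * (L2 - L1)) / 2 := by
    intro S hS
    have hS0 : 0 < S := (hmem hS).2.1
    have hτ : 0 < t₀ - S := by linarith [hS.2]
    refine (coneEnergy_sub_le hΩ isProfile_strictProfile hX heq hS0 (by linarith : (S + t₀) / 2 < t₀)
      (by linarith) (c := -(k * (L2 - L1)) / (t₀ - S)) fun t ht r hr => ?_).trans_eq ?_
    · have ht' : t ∈ Ioo a t₀ := ⟨by linarith [ht.1, hS.1], by linarith [ht.2]⟩
      refine (hrate t ht' r hr).trans ?_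
      have : 0 < t₀ - t := by linarith [ht'.2]
      rw [neg_div, neg_div, neg_le_neg_iff]
      have := ht.1
      gcongr
    · field_simp
      ring
  have hmid : Tendsto (fun S : ℝ => (S + t₀) / 2) (𝓝[<] t₀) (𝓝[<] t₀) := by
    refine tendsto_nhdsWithin_iff.2 ⟨?_, ?_⟩
    · have : Tendsto (fun S : ℝ => (S + t₀) / 2) (𝓝 t₀) (𝓝 ((t₀ + t₀) / 2)) :=
        ((continuous_id.add continuous_const).div_const 2).tendsto t₀
      rw [add_self_div_two] at this
      exact this.mono_left nhdsWithin_le_nhds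
    · filter_upwards [self_mem_nhdsWithin] with S hS
      have : S < t₀ := hS
      simp only [mem_Iio]
      linarith
  have hlim := (hL3.comp hmid).sub hL3
  rw [sub_self] at hlim
  have := le_of_tendsto hlim (by
    filter_upwards [Ioo_mem_nhdsLT (mem_Iio.1 ha)] with S hS using hdrop S hS)
  have : 0 < k * (L2 - L1) := mul_pos hk hpos
  linarith

theorem exists_energy_bound (hΩ : IsSmoothBoundedDomain Ω) (ht₀ : 0 < t₀)
    (hX : MemX Ω t₀ u ut) (heq : SatisfiesNLW Ω t₀ u) :
    ∃ E, 0 ≤ E ∧ ∀ᶠ t in 𝓝[<] t₀, ∫ x in Ω, edens (u t, ut t) x ≤ E := by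
  obtain ⟨L, hL⟩ := exists_tendsto_coneEnergy (x₀ := 0) hΩ isProfile_one ht₀ hX heq
  refine ⟨max (L + 1) 0, le_max_right _ _, ?_⟩
  filter_upwards [hL.eventually_lt_const (lt_add_one L)] with t ht
  simp only [coneEnergy, one_mul] at ht
  exact ht.le.trans (le_max_left _ _)

end

/-! ### The scaling multiplier and its exact rate. -/

section

variable {Ω : Set E3} {t₀ t r : ℝ} {x₀ w : E3} {Θ : ℝ → ℝ}

/-- The multiplier `Θ (-(t₀ - t) ∂ₜu + Y · ∇u + u)`, where `Y` is the inward field. -/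
def scalingMultiplier (t₀ : ℝ) (x₀ w : E3) (Θ : ℝ → ℝ) : Multiplier where
  a t x := -(t₀ - t) * Θ (sim t₀ x₀ t x)
  a' t x := Θ (sim t₀ x₀ t x) - 2 * sim t₀ x₀ t x * deriv Θ (sim t₀ x₀ t x)
  b t x := Θ (sim t₀ x₀ t x)
  b' t x := deriv Θ (sim t₀ x₀ t x) * (2 * sim t₀ x₀ t x / (t₀ - t))
  X t x := Θ (sim t₀ x₀ t x) • inward x₀ w x
  X' t x := (deriv Θ (sim t₀ x₀ t x) * (2 * sim t₀ x₀ t x / (t₀ - t))) • inward x₀ w x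

/-- The differential of the inward field. -/
def inwardDeriv (x₀ w x : E3) : E3 →L[ℝ] E3 :=
  ContinuousLinearMap.id ℝ E3 - (2 • innerSL ℝ (x - x₀)).smulRight w

theorem inwardDeriv_apply (x₀ w x ξ : E3) :
    inwardDeriv x₀ w x ξ = ξ - (2 * inner ℝ (x - x₀) ξ) • w := by
  simp [inwardDeriv, inner_sub_left, two_mul]

theorem hasFDerivAt_inward (x₀ w x : E3) :
    HasFDerivAt (inward x₀ w) (inwardDeriv x₀ w x) x := by
  have h1 : HasFDerivAt (fun y => ‖y - x₀‖ ^ 2) (2 • innerSL ℝ (x - x₀)) x := by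
    simpa using ((hasFDerivAt_id x).sub_const x₀).norm_sq
  exact ((hasFDerivAt_id x).sub_const x₀).sub (h1.smul_const w)

theorem fderiv_smul_field {ψ : E3 → ℝ} {Y : E3 → E3} {A : E3 →L[ℝ] E3} {x : E3}
    (hψ : DifferentiableAt ℝ ψ x) (hY : HasFDerivAt Y A x) :
    fderiv ℝ (fun y => ψ y • Y y) x = ψ x • A + (innerSL ℝ (gradient ψ x)).smulRight (Y x) := by
  have h := (hψ.hasGradientAt.hasFDerivAt.smul hY).fderiv
  exact h

theorem dv_smul_add (c : ℝ) (A : E3 →L[ℝ] E3) (G Y : E3) :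
    dv (c • A + (innerSL ℝ G).smulRight Y) = c * dv A + inner ℝ G Y := by
  simp only [dv, _root_.add_apply, _root_.smul_apply, ContinuousLinearMap.smulRight_apply,
    innerSL_apply_apply, PiLp.add_apply, PiLp.smul_apply, smul_eq_mul, Finset.sum_add_distrib,
    ← Finset.mul_sum]
  congr 1
  simp [PiLp.inner_apply, mul_comm]

theorem dv_inwardDeriv (x₀ w x : E3) : dv (inwardDeriv x₀ w x) = 3 - 2 * inner ℝ (x - x₀) w := by
  simp only [dv, inwardDeriv_apply, PiLp.sub_apply, PiLp.smul_apply, smul_eq_mul,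
    Finset.sum_sub_distrib]
  simp [PiLp.inner_apply, Finset.mul_sum, mul_comm, mul_left_comm]

theorem differentiable_cut (hΘ : ContDiff ℝ ∞ Θ) (t₀ : ℝ) (x₀ : E3) (t : ℝ) :
    Differentiable ℝ fun y => Θ (sim t₀ x₀ t y) :=
  (hΘ.comp (contDiff_sim t₀ x₀ t)).differentiable (by simp)

theorem norm_le_of_sim_le (ht : t < t₀) {x : E3} (hs : sim t₀ x₀ t x ≤ 4) :
    ‖x - x₀‖ ≤ 2 * (t₀ - t) := by
  have h : 0 < t₀ - t := by linarith
  have := sq_norm_eq (x₀ := x₀) ht x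
  refine abs_le_of_sq_le_sq' ?_ (by positivity) |>.2
  nlinarith [sq_nonneg (t₀ - t)]

theorem hasCompactSupport_cut (hz : ∀ s, 3 ≤ s → Θ s = 0) (ht : t < t₀) :
    HasCompactSupport fun y => Θ (sim t₀ x₀ t y) := by
  refine HasCompactSupport.intro (isCompact_closedBall x₀ (2 * (t₀ - t))) fun x hx => hz _ ?_
  by_contra h
  exact hx (mem_closedBall_iff_norm.2 (norm_le_of_sim_le ht (by linarith)))

theorem gradient_const_mul {f : E3 → ℝ} {x : E3} (hf : DifferentiableAt ℝ f x) (c : ℝ) :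
    gradient (fun y => c * f y) x = c • gradient f x := by
  rw [gradient, gradient, fderiv_const_mul hf, map_smul]

/-- The cut-off lives in |x - x₀| ≤ 2τ, and t > t₀ - r/2 means 2τ < r, so the field is supported
where the pushing property of the inward field is known. -/
theorem isMultiplier_scaling (hΘ : IsProfile Θ) (hz : ∀ s, 3 ≤ s → Θ s = 0)
    (h : ∀ y ∉ Ω, ‖y - x₀‖ < r → ∀ σ ∈ Icc (0 : ℝ) 1, y - σ • inward x₀ w y ∉ Ω) :
    IsMultiplier Ω (Ioo (max 0 (t₀ - r / 2)) t₀) (scalingMultiplier t₀ x₀ w Θ) where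
  smooth_a t _ := contDiff_const.mul (hΘ.smooth.comp (contDiff_sim t₀ x₀ t))
  smooth_b t _ := hΘ.smooth.comp (contDiff_sim t₀ x₀ t)
  pushing t ht := by
    refine isPushing_smul_inward h (hΘ.smooth.comp (contDiff_sim t₀ x₀ t))
      (hasCompactSupport_cut hz ht.2) (fun x => ⟨hΘ.nonneg _, hΘ.le_one _⟩) fun x hx => hz _ ?_
    by_contra hs
    have h1 := norm_le_of_sim_le (x := x) ht.2 (by linarith)
    have := (le_max_right 0 (t₀ - r / 2)).trans_lt ht.1
    linarith
  hasDerivAt_a t ht x := by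
    have h1 : HasDerivAt (fun s => -(t₀ - s)) 1 t := by
      simpa using (hasDerivAt_id t).sub_const t₀
    have h1 := h1.mul (hasDerivAt_cut (x₀ := x₀) hΘ.smooth ht.2 x)
    refine h1.congr_deriv ?_
    have : t₀ - t ≠ 0 := by linarith [ht.2]
    simp only [scalingMultiplier]
    field_simp
    ring
  hasDerivAt_b t ht x := hasDerivAt_cut hΘ.smooth ht.2 x
  hasDerivAt_X t ht x := (hasDerivAt_cut hΘ.smooth ht.2 x).smul_const _
  cont_a' := by
    have hs := (continuousOn_sim t₀ x₀).mono (prod_mono (Ioo_subset_Iio_self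
      (a := max 0 (t₀ - r / 2))) (le_refl (univ : Set E3)))
    exact (hΘ.smooth.continuous.comp_continuousOn hs).sub ((hs.const_mul 2).mul
      ((continuous_deriv_profile hΘ.smooth).comp_continuousOn hs))
  cont_b' := (continuousOn_cut_deriv hΘ.smooth t₀ x₀).mono
    (prod_mono Ioo_subset_Iio_self le_rfl)
  cont_X' := ((continuousOn_cut_deriv hΘ.smooth t₀ x₀).mono
    (prod_mono Ioo_subset_Iio_self le_rfl)).smul
      ((contDiff_inward x₀ w).continuous.comp_continuousOn continuousOn_snd)
  cont_gradient_a := by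
    have : (fun t => gradient ((scalingMultiplier t₀ x₀ w Θ).a t)) =
        fun t x => (-(t₀ - t)) • gradient (fun y => Θ (sim t₀ x₀ t y)) x := by
      funext t x
      exact gradient_const_mul (differentiable_cut hΘ.smooth t₀ x₀ t x) _
    rw [this]
    exact ContinuousOn.smul (f := fun p : ℝ × E3 => -(t₀ - p.1)) (by fun_prop) ((continuousOn_cut_gradient hΘ.smooth t₀ x₀).mono
      (prod_mono Ioo_subset_Iio_self le_rfl))
  cont_gradient_b := (continuousOn_cut_gradient hΘ.smooth t₀ x₀).mono
    (prod_mono Ioo_subset_Iio_self le_rfl)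
  cont_fderiv := by
    have : (fun t => fderiv ℝ ((scalingMultiplier t₀ x₀ w Θ).X t)) = fun t x =>
        Θ (sim t₀ x₀ t x) • inwardDeriv x₀ w x + (innerSL ℝ (gradient (fun y =>
          Θ (sim t₀ x₀ t y)) x)).smulRight (inward x₀ w x) := by
      funext t x
      exact fderiv_smul_field (differentiable_cut hΘ.smooth t₀ x₀ t x) (hasFDerivAt_inward x₀ w x)
    rw [this, continuousOn_clm_apply]
    intro ξ
    have hs := (hΘ.smooth.continuous.comp_continuousOn (continuousOn_sim t₀ x₀)).mono
      (prod_mono (Ioo_subset_Iio_self (a := max 0 (t₀ - r / 2))) (le_refl (univ : Set E3)))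
    have hg := (continuousOn_cut_gradient hΘ.smooth t₀ x₀).mono
      (prod_mono (Ioo_subset_Iio_self (a := max 0 (t₀ - r / 2))) (le_refl (univ : Set E3)))
    have hi := (contDiff_inward x₀ w).continuous.comp_continuousOn
      (continuousOn_snd (s := Ioo (max 0 (t₀ - r / 2)) t₀ ×ˢ (univ : Set E3)))
    have hd : ContinuousOn (fun p : ℝ × E3 => inwardDeriv x₀ w p.2 ξ)
        (Ioo (max 0 (t₀ - r / 2)) t₀ ×ˢ univ) := by
      simp only [inwardDeriv_apply]
      fun_prop
    have hn := ContinuousOn.inner (𝕜 := ℝ) hg (continuousOn_const (c := ξ))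
    exact ((hs.smul hd).add (hn.smul hi)).congr fun p _ => rfl

/-- Where Θ = 1 and w = 0, the dilation field has divergence 3 and the choice b = 1 cancels the ∂ₜu²
and |∇u|² terms, leaving -u⁶/3. The other terms carry a factor w or Θ'. -/
theorem scaling_rateDensity (hΘ : IsProfile Θ) (ht : t < t₀) (z : H10 Ω × L2 Ω) (x : E3) :
    (scalingMultiplier t₀ x₀ w Θ).rateDensity t z x =
      Θ (sim t₀ x₀ t x) * (-toL2 z.1 x ^ 6 / 3 - 2 * inner ℝ (x - x₀) w *
        ((‖gradH z.1 x‖ ^ 2 - z.2 x ^ 2) / 2 + toL2 z.1 x ^ 6 / 6) +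
        2 * inner ℝ (x - x₀) (gradH z.1 x) * inner ℝ (gradH z.1 x) w) +
      deriv Θ (sim t₀ x₀ t x) * (-(2 * sim t₀ x₀ t x) * edens z x +
        2 / (t₀ - t) * inner ℝ (x - x₀) (gradH z.1 x) * z.2 x +
        2 * sim t₀ x₀ t x / (t₀ - t) * inner ℝ (inward x₀ w x) (gradH z.1 x) * z.2 x +
        2 / (t₀ - t) ^ 2 * inner ℝ (x - x₀) (inward x₀ w x) *
          ((‖gradH z.1 x‖ ^ 2 - z.2 x ^ 2) / 2 + toL2 z.1 x ^ 6 / 6) -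
        2 / (t₀ - t) ^ 2 * inner ℝ (x - x₀) (gradH z.1 x) *
          inner ℝ (inward x₀ w x) (gradH z.1 x) +
        2 * sim t₀ x₀ t x / (t₀ - t) * toL2 z.1 x * z.2 x -
        2 / (t₀ - t) ^ 2 * inner ℝ (x - x₀) (gradH z.1 x) * toL2 z.1 x) := by
  have hτ : t₀ - t ≠ 0 := by linarith
  have g := gradient_cut hΘ.smooth t₀ x₀ t x
  have ga : gradient (fun y => -(t₀ - t) * Θ (sim t₀ x₀ t y)) x =
      (-(t₀ - t)) • gradient (fun y => Θ (sim t₀ x₀ t y)) x :=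
    gradient_const_mul (differentiable_cut hΘ.smooth t₀ x₀ t x) _
  have gf := fderiv_smul_field (differentiable_cut hΘ.smooth t₀ x₀ t x) (hasFDerivAt_inward x₀ w x)
  simp only [Multiplier.rateDensity, scalingMultiplier]
  rw [ga, gf, g, dv_smul_add, dv_inwardDeriv]
  simp only [_root_.add_apply, _root_.smul_apply, ContinuousLinearMap.smulRight_apply,
    inwardDeriv_apply, innerSL_apply_apply, inner_add_right, inner_sub_right, inner_smul_right,
    inner_smul_left, conj_trivial, real_inner_self_eq_norm_sq]
  rw [real_inner_comm (inward x₀ w x) (gradH z.1 x)]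
  unfold edens
  generalize sim t₀ x₀ t x = s
  field_simp
  ring

end

/-! ### Pointwise bounds for the scaling rate. -/

section

variable {Ω : Set E3} {t₀ t : ℝ} {x₀ w : E3} {Θ : ℝ → ℝ}

theorem HasInt.le {F F' : E3 → ℝ} {r r' : ℝ} (h : HasInt Ω F r) (h' : HasInt Ω F' r')
    (hle : ∀ x, F x ≤ F' x) : r ≤ r' := by
  rw [← h.2, ← h'.2]
  exact integral_mono h.1 h'.1 hle

/-- The weight `χ` of a ring outside the backward light cone. -/
def ringWeight (c d s : ℝ) : ℝ := step 3 4 s - step c d s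

theorem continuous_ringWeight (c d : ℝ) : Continuous (ringWeight c d) :=
  (contDiff_step 3 4).continuous.sub (contDiff_step c d).continuous

theorem ringWeight_eq_one {c d s : ℝ} (hcd : c < d) (hs : s ∈ Icc d 3) : ringWeight c d s = 1 := by
  rw [ringWeight, step_eq_one (by norm_num) hs.2, step_eq_zero hcd hs.1, sub_zero]

theorem ringWeight_eq_zero {c d s : ℝ} (hcd : c < d) (hd : d ≤ 3) (hs : 4 ≤ s) :
    ringWeight c d s = 0 := by
  rw [ringWeight, step_eq_zero (by norm_num) hs, step_eq_zero hcd (by linarith), sub_zero]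

theorem ringWeight_le_one (c d s : ℝ) : ringWeight c d s ≤ 1 := by
  have := step_le_one 3 4 s
  have := step_nonneg c d s
  unfold ringWeight
  linarith

theorem ringWeight_nonneg {c d : ℝ} (hcd : c < d) (hd : d ≤ 3) (s : ℝ) : 0 ≤ ringWeight c d s := by
  unfold ringWeight
  rcases le_total s 3 with h | h
  · rw [step_eq_one (by norm_num) h]
    linarith [step_le_one c d s]
  · rw [step_eq_zero hcd (hd.trans h)]
    linarith [step_nonneg 3 4 s]

theorem isProfile_step_two_three : IsProfile (step 2 3) := isProfile_step (by norm_num) (by norm_num)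

theorem step_two_three_eq_zero {s : ℝ} (hs : 3 ≤ s) : step 2 3 s = 0 :=
  step_eq_zero (by norm_num) hs

theorem deriv_step_two_three_eq_zero {s : ℝ} (hs : 3 < s) : deriv (step 2 3) s = 0 := by
  have : step 2 3 =ᶠ[𝓝 s] fun _ => 0 := by
    filter_upwards [Ioi_mem_nhds hs] with a ha using step_two_three_eq_zero (le_of_lt ha)
  simpa using this.deriv_eq

/-- The derivative of the cut-off is supported in [2, 3], where every ring weight with d ≤ 2 equals
1. Hence K does not depend on c and d, and the ring may reach down to s close to 1. -/
theorem exists_deriv_step_bound : ∃ K, 0 ≤ K ∧ ∀ c d, c < d → d ≤ 2 → ∀ s,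
    -deriv (step 2 3) s ≤ K * ringWeight c d s := by
  obtain ⟨K, hK⟩ := (isCompact_Icc (a := (2 : ℝ)) (b := 3)).exists_bound_of_continuousOn
    (continuous_deriv_profile (contDiff_step 2 3)).continuousOn
  have hK0 : 0 ≤ K := (norm_nonneg _).trans (hK 2 (by norm_num))
  refine ⟨K, hK0, fun c d hcd hd s => ?_⟩
  by_cases hs : s ∈ Icc (2 : ℝ) 3
  · rw [ringWeight_eq_one hcd ⟨hd.trans hs.1, hs.2⟩, mul_one]
    exact (neg_le_abs _).trans (hK s hs)
  · have : deriv (step 2 3) s = 0 := by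
      rcases lt_or_ge s 2 with h | h
      · exact deriv_eq_zero_of_Iio (contDiff_step 2 3) (c := 2)
          (fun s hs => step_eq_one (by norm_num) hs) h.le
      · exact deriv_step_two_three_eq_zero (not_le.1 fun h3 => hs ⟨h, h3⟩)
    rw [this, neg_zero]
    exact mul_nonneg hK0 (ringWeight_nonneg hcd (by linarith) s)

theorem norm_inward_le_of_sim_le {r : ℝ} (hr : r * ‖w‖ ≤ 1) (ht : t < t₀) (htr : 2 * (t₀ - t) ≤ r)
    {x : E3} (hs : sim t₀ x₀ t x ≤ 3) : ‖inward x₀ w x‖ ≤ 4 * (t₀ - t) := by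
  have hz := norm_le_of_sim_le ht (show sim t₀ x₀ t x ≤ 4 by linarith)
  have h1 : ‖x - x₀‖ * ‖w‖ ≤ 1 := le_trans (by gcongr; linarith) hr
  linarith [norm_inward_le h1]

theorem abs_inner_div_le {z ξ : E3} {τ M : ℝ} (hτ : 0 < τ) (hz : ‖z‖ ≤ M * τ) :
    |inner ℝ z ξ / τ| ≤ M * ‖ξ‖ := by
  rw [abs_div, abs_of_pos hτ, div_le_iff₀ hτ]
  calc |inner ℝ z ξ| ≤ ‖z‖ * ‖ξ‖ := abs_real_inner_le_norm _ _
    _ ≤ M * τ * ‖ξ‖ := by gcongr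
    _ = M * ‖ξ‖ * τ := by ring

/-- Here A and B are the radial and inward derivatives of u divided by τ, P = u/τ, q = ∂ₜu, X =
|∇u|, and F is minus the Lagrangian density. The constant is the sum 6 + 4 + 24 + 16 + 32 + 6 + 4 of
the coefficients of e. -/
theorem boundary_terms_le {s e A B M F P q X : ℝ} (hs : s ∈ Icc (0 : ℝ) 3) (hX0 : 0 ≤ X)
    (hX : X ^ 2 + q ^ 2 ≤ 2 * e) (hA : |A| ≤ 2 * X) (hB : |B| ≤ 4 * X) (hM : |M| ≤ 8)
    (hF : |F| ≤ e) :
    -(-(2 * s) * e + 2 * A * q + 2 * s * B * q + 2 * M * F - 2 * A * B + 2 * s * P * q -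
      2 * A * P) ≤ 92 * (e + P ^ 2) := by
  have he : 0 ≤ e := (abs_nonneg F).trans hF
  have hq := sq_abs q
  have hP := sq_abs P
  have hXq : X * |q| ≤ e := by nlinarith [sq_nonneg (X - |q|)]
  have hPq : |P| * |q| ≤ P ^ 2 / 2 + e := by
    nlinarith [sq_nonneg (|P| - |q|), sq_nonneg X]
  have hXP : X * |P| ≤ P ^ 2 / 2 + e := by
    nlinarith [sq_nonneg (|P| - X), sq_nonneg q]
  have hXX : X * X ≤ 2 * e := by nlinarith [sq_nonneg q]
  have b1 : -(A * q) ≤ 2 * e := by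
    refine (neg_le_abs _).trans ?_
    rw [abs_mul]
    nlinarith [mul_le_mul_of_nonneg_right hA (abs_nonneg q)]
  have b2 : -(s * (B * q)) ≤ 12 * e := by
    have h1 : |B * q| ≤ 4 * e := by
      rw [abs_mul]
      nlinarith [mul_le_mul_of_nonneg_right hB (abs_nonneg q)]
    nlinarith [neg_le_abs (B * q), hs.1, hs.2, mul_le_mul_of_nonneg_left h1 hs.1,
      mul_le_mul_of_nonneg_left (neg_le_abs (B * q)) hs.1]
  have b3 : -(M * F) ≤ 8 * e := by
    refine (neg_le_abs _).trans ?_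
    rw [abs_mul]
    exact mul_le_mul hM hF (abs_nonneg _) (by norm_num)
  have b4 : A * B ≤ 16 * e := by
    refine (le_abs_self _).trans ?_
    rw [abs_mul]
    nlinarith [mul_le_mul hA hB (abs_nonneg _) (by positivity)]
  have b5 : -(s * (P * q)) ≤ 3 * (P ^ 2 / 2 + e) := by
    have h1 : |P * q| ≤ P ^ 2 / 2 + e := by rwa [abs_mul]
    nlinarith [hs.1, hs.2, mul_le_mul_of_nonneg_left h1 hs.1, sq_nonneg P,
      mul_le_mul_of_nonneg_left (neg_le_abs (P * q)) hs.1]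
  have b6 : A * P ≤ 2 * (P ^ 2 / 2 + e) := by
    refine (le_abs_self _).trans ?_
    rw [abs_mul]
    nlinarith [mul_le_mul_of_nonneg_right hA (abs_nonneg P)]
  have b7 : s * e ≤ 3 * e := mul_le_mul_of_nonneg_right hs.2 he
  nlinarith [sq_nonneg P]

/-- The favourable term -p⁶/3 is dropped. The errors due to w, with β = |w|, contribute 4 + 8 = 12.
-/
theorem interior_terms_le {τ e X q p m α β : ℝ} (hτ : 0 ≤ τ)
    (hX : X ^ 2 + q ^ 2 ≤ 2 * e) (hm : |m| ≤ 2 * τ * β) (hβ : 0 ≤ β) (hα : |α| ≤ 2 * τ * X * (X * β))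
    (hF : |(X ^ 2 - q ^ 2) / 2 + p ^ 6 / 6| ≤ e) :
    -p ^ 6 / 3 - 2 * m * ((X ^ 2 - q ^ 2) / 2 + p ^ 6 / 6) + 2 * α ≤ 12 * τ * β * e := by
  have h6 : 0 ≤ p ^ 6 := by positivity
  have h1 : -(m * ((X ^ 2 - q ^ 2) / 2 + p ^ 6 / 6)) ≤ 2 * τ * β * e := by
    refine (neg_le_abs _).trans ?_
    rw [abs_mul]
    exact mul_le_mul hm hF (abs_nonneg _) (by positivity)
  have h2 : α ≤ 4 * τ * β * e := by
    refine (le_abs_self _).trans (hα.trans ?_)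
    have : τ * β * X ^ 2 ≤ τ * β * (2 * e) :=
      mul_le_mul_of_nonneg_left (by nlinarith [sq_nonneg q]) (by positivity)
    nlinarith
  nlinarith

theorem edens_bounds (z : H10 Ω × L2 Ω) (x : E3) :
    ‖gradH z.1 x‖ ^ 2 + z.2 x ^ 2 ≤ 2 * edens z x ∧
    |(‖gradH z.1 x‖ ^ 2 - z.2 x ^ 2) / 2 + toL2 z.1 x ^ 6 / 6| ≤ edens z x := by
  have h6 : 0 ≤ toL2 z.1 x ^ 6 := by positivity
  unfold edens
  refine ⟨by linarith, abs_le.2 ⟨?_, ?_⟩⟩ <;>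
    nlinarith [sq_nonneg (z.2 x), sq_nonneg ‖gradH z.1 x‖]

theorem scaling_rateDensity_le {K c d r : ℝ}
    (hK : ∀ s, -deriv (step 2 3) s ≤ K * ringWeight c d s)
    (hr : r * ‖w‖ ≤ 1) (ht : t < t₀) (htr : 2 * (t₀ - t) ≤ r) (z : H10 Ω × L2 Ω) (x : E3) :
    (scalingMultiplier t₀ x₀ w (step 2 3)).rateDensity t z x ≤
      12 * (t₀ - t) * ‖w‖ * edens z x + 92 * K * (ringWeight c d (sim t₀ x₀ t x) * (edens z x +
        toL2 z.1 x ^ 2 / (t₀ - t) ^ 2)) := by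
  have hτ : 0 < t₀ - t := by linarith
  have he := edens_nonneg z x
  have hP2 : 0 ≤ toL2 z.1 x ^ 2 / (t₀ - t) ^ 2 := by positivity
  have hKs := (neg_nonneg.2 (isProfile_step_two_three.deriv_nonpos (sim t₀ x₀ t x))).trans (hK _)
  rw [scaling_rateDensity isProfile_step_two_three ht]
  rcases le_or_gt (sim t₀ x₀ t x) 3 with hs | hs
  · have hz := norm_le_of_sim_le ht (show sim t₀ x₀ t x ≤ 4 by linarith)
    have hY := norm_inward_le_of_sim_le hr ht htr hs
    obtain ⟨hX, hF⟩ := edens_bounds z x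
    have hM : |inner ℝ (x - x₀) (inward x₀ w x) / (t₀ - t) ^ 2| ≤ 8 := by
      rw [abs_div, abs_of_pos (by positivity : 0 < (t₀ - t) ^ 2), div_le_iff₀ (by positivity)]
      refine (abs_real_inner_le_norm _ _).trans ?_
      calc ‖x - x₀‖ * ‖inward x₀ w x‖ ≤ 2 * (t₀ - t) * (4 * (t₀ - t)) := by gcongr
        _ = 8 * (t₀ - t) ^ 2 := by ring
    have hb := boundary_terms_le (P := toL2 z.1 x / (t₀ - t)) ⟨sim_nonneg t₀ x₀ t x, hs⟩
      (norm_nonneg _) hX (abs_inner_div_le (ξ := gradH z.1 x) hτ hz)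
      (abs_inner_div_le (ξ := gradH z.1 x) hτ hY) hM hF
    have hm : |inner ℝ (x - x₀) w| ≤ 2 * (t₀ - t) * ‖w‖ :=
      (abs_real_inner_le_norm _ _).trans (by gcongr)
    have hα : |inner ℝ (x - x₀) (gradH z.1 x) * inner ℝ (gradH z.1 x) w| ≤
        2 * (t₀ - t) * ‖gradH z.1 x‖ * (‖gradH z.1 x‖ * ‖w‖) := by
      rw [abs_mul]
      have h1 : |inner ℝ (x - x₀) (gradH z.1 x)| ≤ 2 * (t₀ - t) * ‖gradH z.1 x‖ :=
        (abs_real_inner_le_norm _ _).trans (by gcongr)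
      exact mul_le_mul h1 (abs_real_inner_le_norm _ _) (abs_nonneg _) (by positivity)
    have hi := interior_terms_le hτ.le hX hm (norm_nonneg w) hα hF
    refine add_le_add ?_ ?_
    · have h0 : 0 ≤ 12 * (t₀ - t) * ‖w‖ * edens z x := by positivity
      rw [mul_assoc 2 (inner ℝ (x - x₀) (gradH z.1 x))]
      calc _ ≤ step 2 3 (sim t₀ x₀ t x) * (12 * (t₀ - t) * ‖w‖ * edens z x) :=
            mul_le_mul_of_nonneg_left hi (step_nonneg _ _ _)
        _ ≤ 1 * (12 * (t₀ - t) * ‖w‖ * edens z x) :=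
            mul_le_mul_of_nonneg_right (step_le_one _ _ _) h0
        _ = _ := one_mul _
    · rw [div_pow] at hb
      have h1 := mul_le_mul_of_nonneg_left hb
        (neg_nonneg.2 (isProfile_step_two_three.deriv_nonpos (sim t₀ x₀ t x)))
      have h2 := mul_le_mul_of_nonneg_right (hK (sim t₀ x₀ t x))
        (show 0 ≤ 92 * (edens z x + toL2 z.1 x ^ 2 / (t₀ - t) ^ 2) by positivity)
      refine le_trans (le_of_eq ?_) (h1.trans (h2.trans (le_of_eq ?_)))
      · field_simp
      · ring
  · rw [step_two_three_eq_zero hs.le, deriv_step_two_three_eq_zero hs, zero_mul, zero_mul, zero_add]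
    rw [← mul_assoc, mul_assoc 92]
    positivity

end

/-! ### The scaled mass u²/(t₀ - t)² and an integration by parts for the dilation field. -/

section

variable {Ω : Set E3} {t₀ t : ℝ} {x₀ w : E3} {u : ℝ → H10 Ω} {ut : ℝ → L2 Ω}

/-- One of the two terms dominates according to whether p²τ ≤ κ. Integrated over a ball of radius
2τ, the first gives O(κ), and the second is controlled by the potential energy. -/
theorem sq_div_sq_le {κ τ : ℝ} (hκ : 0 < κ) (hτ : 0 < τ) (p : ℝ) :
    p ^ 2 / τ ^ 2 ≤ κ / τ ^ 3 + p ^ 6 / κ ^ 2 := by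
  rcases le_total (p ^ 2 * τ) κ with h | h
  · have h1 : p ^ 2 / τ ^ 2 ≤ κ / τ ^ 3 := by
      rw [div_le_div_iff₀ (by positivity) (by positivity)]
      nlinarith [mul_le_mul_of_nonneg_right h (by positivity : 0 ≤ τ ^ 2)]
    have : 0 ≤ p ^ 6 / κ ^ 2 := by positivity
    linarith
  · have h1 : p ^ 2 / τ ^ 2 ≤ p ^ 6 / κ ^ 2 := by
      rw [div_le_div_iff₀ (by positivity) (by positivity)]
      have h2 : κ ^ 2 ≤ (p ^ 2 * τ) ^ 2 := by gcongr
      nlinarith [mul_le_mul_of_nonneg_left h2 (sq_nonneg p)]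
    have : 0 ≤ κ / τ ^ 3 := by positivity
    linarith

/-- The scaled mass with weight `W`. -/
def mass (Ω : Set E3) (t₀ : ℝ) (x₀ : E3) (W : ℝ → ℝ) (u : ℝ → H10 Ω) (t : ℝ) : ℝ :=
  ∫ x in Ω, W (sim t₀ x₀ t x) * (toL2 (u t) x ^ 2 / (t₀ - t) ^ 2)

theorem hasInt_mass (hΩ : IsSmoothBoundedDomain Ω) {W : ℝ → ℝ} (hW : Continuous W) :
    HasInt Ω (fun x => W (sim t₀ x₀ t x) * (toL2 (u t) x ^ 2 / (t₀ - t) ^ 2))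
      (mass Ω t₀ x₀ W u t) := by
  refine ⟨HasInt.congr (
    (hasInt_smulOp hΩ.isBounded hΩ.isOpen (hW.comp (contDiff_sim t₀ x₀ t).continuous)
    (toL2 (u t)) (toL2 (u t))).div_const ((t₀ - t) ^ 2)) (fun x => ?_) |>.1, rfl⟩
  simp only [real_inner_self_eq_norm_sq, Real.norm_eq_abs, sq_abs, Function.comp_apply]
  ring

theorem integral_indicator_closedBall_le (Ω : Set E3) (x₀ : E3) {τ c : ℝ} (hτ : 0 < τ)
    (hc : 0 ≤ c) : IntegrableOn ((Metric.closedBall x₀ (2 * τ)).indicator fun _ => c / τ ^ 3) Ω ∧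
    ∫ x in Ω, (Metric.closedBall x₀ (2 * τ)).indicator (fun _ => c / τ ^ 3) x ≤
      8 * c * volume.real (Metric.ball (0 : E3) 1) := by
  have hi : Integrable ((Metric.closedBall x₀ (2 * τ)).indicator fun _ : E3 => c / τ ^ 3) :=
    (integrable_indicator_iff Metric.isClosed_closedBall.measurableSet).2
      (integrableOn_const Metric.isBounded_closedBall.measure_lt_top.ne)
  refine ⟨hi.integrableOn, ?_⟩
  refine (setIntegral_le_integral hi (Eventually.of_forall fun x =>
    indicator_nonneg (fun _ _ => by positivity) x)).trans_eq ?_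
  rw [integral_indicator Metric.isClosed_closedBall.measurableSet, setIntegral_const, measureReal_def,
    Measure.addHaar_closedBall _ _ (by positivity), ENNReal.toReal_mul,
    ENNReal.toReal_ofReal (by positivity), finrank_euclideanSpace_fin, measureReal_def, smul_eq_mul]
  field_simp
  ring

/-- The factor 8 is the cube of the ratio in |x - x₀| ≤ 2τ, and 6 comes from u⁶ ≤ 6e. With κ small
and then A small, the mass is small; κ = 1 gives a crude bound. -/
theorem mass_le (hΩ : IsSmoothBoundedDomain Ω) {W : ℝ → ℝ} (hW : Continuous W)
    (h0 : ∀ s, 0 ≤ W s) (h1 : ∀ s, W s ≤ 1) (h4 : ∀ s, 4 ≤ s → W s = 0) (ht : t < t₀)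
    {κ A : ℝ} (hκ : 0 < κ)
    (hA : HasInt Ω (fun x => W (sim t₀ x₀ t x) * edens (u t, ut t) x) A) :
    mass Ω t₀ x₀ W u t ≤ 8 * κ * volume.real (Metric.ball (0 : E3) 1) + 6 / κ ^ 2 * A := by
  have hτ : 0 < t₀ - t := by linarith
  obtain ⟨hi, hle⟩ := integral_indicator_closedBall_le Ω x₀ hτ hκ.le
  refine le_trans ((hasInt_mass (u := u) hΩ hW).le (HasInt.add ⟨hi, rfl⟩ (hA.const_mul (6 / κ ^ 2)))
    fun x => ?_) (by linarith)
  have h6 : toL2 (u t) x ^ 6 ≤ 6 * edens (u t, ut t) x := by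
    simp only [edens]
    nlinarith [sq_nonneg (ut t x), sq_nonneg ‖gradH (u t) x‖]
  have hm : W (sim t₀ x₀ t x) * (κ / (t₀ - t) ^ 3) ≤
      (Metric.closedBall x₀ (2 * (t₀ - t))).indicator (fun _ => κ / (t₀ - t) ^ 3) x := by
    by_cases hx : x ∈ Metric.closedBall x₀ (2 * (t₀ - t))
    · rw [indicator_of_mem hx]
      exact mul_le_of_le_one_left (by positivity) (h1 _)
    · rw [indicator_of_notMem hx, h4 _, zero_mul]
      by_contra hs
      exact hx (mem_closedBall_iff_norm.2 (norm_le_of_sim_le ht (not_le.1 hs).le))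
  calc W (sim t₀ x₀ t x) * (toL2 (u t) x ^ 2 / (t₀ - t) ^ 2)
      ≤ W (sim t₀ x₀ t x) * (κ / (t₀ - t) ^ 3 + toL2 (u t) x ^ 6 / κ ^ 2) :=
        mul_le_mul_of_nonneg_left (sq_div_sq_le hκ hτ _) (h0 _)
    _ ≤ W (sim t₀ x₀ t x) * (κ / (t₀ - t) ^ 3 + 6 * edens (u t, ut t) x / κ ^ 2) := by
        have := h0 (sim t₀ x₀ t x)
        gcongr
    _ = W (sim t₀ x₀ t x) * (κ / (t₀ - t) ^ 3) +
        6 / κ ^ 2 * (W (sim t₀ x₀ t x) * edens (u t, ut t) x) := by ring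
    _ ≤ _ := by gcongr

theorem ring_hasInt (hΩ : IsSmoothBoundedDomain Ω) {c d : ℝ} (hc : 1 < c) (hcd : c < d)
    (ht : t ∈ Ioo 0 t₀) :
    HasInt Ω (fun x => ringWeight c d (sim t₀ x₀ t x) * edens (u t, ut t) x)
      (coneEnergy Ω t₀ x₀ (step 3 4) u ut t - coneEnergy Ω t₀ x₀ (step c d) u ut t) :=
  hasInt_ring hΩ (isProfile_step (by norm_num) (by norm_num)) (isProfile_step hc.le hcd) ht

/-- The energy and the scaled mass of the ring. -/
def ringTotal (Ω : Set E3) (t₀ : ℝ) (x₀ : E3) (c d : ℝ) (u : ℝ → H10 Ω) (ut : ℝ → L2 Ω) (t : ℝ) :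
    ℝ := coneEnergy Ω t₀ x₀ (step 3 4) u ut t - coneEnergy Ω t₀ x₀ (step c d) u ut t +
      mass Ω t₀ x₀ (ringWeight c d) u t

theorem hasInt_ringTotal (hΩ : IsSmoothBoundedDomain Ω) {c d : ℝ} (hc : 1 < c) (hcd : c < d)
    (ht : t ∈ Ioo 0 t₀) :
    HasInt Ω (fun x => ringWeight c d (sim t₀ x₀ t x) * (edens (u t, ut t) x +
      toL2 (u t) x ^ 2 / (t₀ - t) ^ 2)) (ringTotal Ω t₀ x₀ c d u ut t) :=
  ((ring_hasInt hΩ hc hcd ht).add (hasInt_mass hΩ (continuous_ringWeight c d))).congr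
    fun x => by ring

theorem tendsto_ringTotal (hΩ : IsSmoothBoundedDomain Ω) (ht₀ : 0 < t₀)
    (hX : MemX Ω t₀ u ut) (heq : SatisfiesNLW Ω t₀ u) {c d : ℝ} (hc : 1 < c) (hcd : c < d)
    (hd : d ≤ 3) : Tendsto (ringTotal Ω t₀ x₀ c d u ut) (𝓝[<] t₀) (𝓝 0) := by
  have hZ := tendsto_ring (x₀ := x₀) hΩ ht₀ hX heq hc hcd hd
  rw [show (0 : ℝ) = 0 + 0 from (add_zero 0).symm]
  refine hZ.add ?_
  set V := volume.real (Metric.ball (0 : E3) 1) with hV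
  have hV0 : 0 ≤ V := measureReal_nonneg
  refine tendsto_order.2 ⟨fun a ha => ?_, fun a ha => ?_⟩
  · refine Eventually.of_forall fun t => ha.trans_le (integral_nonneg fun x => ?_)
    exact mul_nonneg (ringWeight_nonneg hcd hd _) (by positivity)
  -- This κ makes the volume term at most a/2; the ring energy, multiplied by the fixed constant
  -- 6/κ², is eventually below a/2.
  · have hκ : 0 < a / (16 * (V + 1)) := by positivity
    have h1 := hZ.const_mul (6 / (a / (16 * (V + 1))) ^ 2)
    rw [mul_zero] at h1
    filter_upwards [h1.eventually_lt_const (half_pos ha), left_nhds_eventually_mem ht₀] with t h2 ht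
    have h3 := mass_le hΩ (continuous_ringWeight c d) (ringWeight_nonneg hcd hd)
      (ringWeight_le_one c d) (fun s hs => ringWeight_eq_zero hcd hd hs) ht.2 hκ
      (ring_hasInt (u := u) (ut := ut) (x₀ := x₀) hΩ hc hcd ht)
    have h4 : 8 * (a / (16 * (V + 1))) * V ≤ a / 2 := by
      have : 8 * (a / (16 * (V + 1))) * V = a / 2 * (V / (V + 1)) := by
        field_simp
        ring
      rw [this]
      exact mul_le_of_le_one_right (by positivity) ((div_le_one (by positivity)).2 (by linarith))
    linarith

/-- An integration by parts for the scaling field. -/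
theorem hasInt_scaling_parts (hΩ : IsSmoothBoundedDomain Ω) {Θ : ℝ → ℝ} (hΘ : ContDiff ℝ ∞ Θ)
    (ht : t < t₀) (v : H10 Ω) :
    HasInt Ω (fun x => Θ (sim t₀ x₀ t x) * inner ℝ (x - x₀) (gradH v x) * toL2 v x +
      (3 * Θ (sim t₀ x₀ t x) + 2 * sim t₀ x₀ t x * deriv Θ (sim t₀ x₀ t x)) / 2 * toL2 v x ^ 2)
      0 := by
  have hτ : t₀ - t ≠ 0 := by linarith
  have hs : ContDiff ℝ 1 fun x => Θ (sim t₀ x₀ t x) • (x - x₀) :=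
    ((hΘ.comp (contDiff_sim t₀ x₀ t)).of_le (by norm_cast)).smul (contDiff_id.sub contDiff_const)
  have h := inner_dotOp_self hΩ.isBounded hΩ.isOpen hs v
  -- The divergence of Θ(s)(x - x₀) is 3Θ + 2sΘ', since the gradient of s pairs with x - x₀ to 2s.
  have h1 := (hasInt_dotOp hΩ.isBounded hΩ.isOpen hs.continuous (gradH v) (toL2 v)).add
    ((hasInt_smulOp hΩ.isBounded hΩ.isOpen (continuous_dv_fderiv hs) (toL2 v) (toL2 v)).div_const 2)
  rw [h, neg_add_cancel] at h1
  refine h1.congr fun x => ?_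
  have hf := fderiv_smul_field (differentiable_cut hΘ t₀ x₀ t x)
    ((hasFDerivAt_id x).sub_const x₀)
  have hd : dv (ContinuousLinearMap.id ℝ E3) = 3 := by simp [dv]
  have hn := sq_norm_eq (x₀ := x₀) ht x
  simp only [id_eq] at hf
  rw [hf, dv_smul_add, hd, gradient_cut hΘ]
  simp only [inner_smul_left, conj_trivial, real_inner_self_eq_norm_sq, hn, Real.norm_eq_abs, sq_abs]
  field_simp

end

/-! ### From the scaling functional to decay of the sextic integral. -/

section

variable {Ω : Set E3} {t₀ t r : ℝ} {x₀ w : E3} {u : ℝ → H10 Ω} {ut : ℝ → L2 Ω}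

/-- Completing the square in q bounds e - (B + P)q below by p⁶/6 + X²/2 - (B + P)²/2. Replacing B by
A costs 28β, half of the 56β below. Then X² - A² is nonnegative up to δ when s ≤ 1 + δ, and up to 2e
when χ = 1 and s ≤ 3. The remaining AP + P²/2 is at most AP + 3P²/2, which is part of an expression
of zero integral. -/
theorem virial_terms_le {ψ s D K χ δ β e X q p P A B : ℝ} (hψ0 : 0 ≤ ψ) (hψ1 : ψ ≤ 1)
    (hD : -(s * D) ≤ 3 * (K * χ)) (he : X ^ 2 + q ^ 2 + p ^ 6 / 3 = 2 * e)
    (hδ : 0 ≤ δ) (hχ : 0 ≤ χ) (hs : s ≤ 1 + δ ∨ s ≤ 3 ∧ χ = 1) (hβ : 0 ≤ β) (hX : 0 ≤ X)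
    (hA2 : A ^ 2 ≤ s * X ^ 2) (hA : |A| ≤ 2 * X) (hB : |B| ≤ 4 * X) (hBA : |B - A| ≤ 4 * β * X) :
    ψ * (p ^ 6 / 6) ≤ ψ * (e - (B + P) * q) + δ * e + 2 * (χ * e) + 3 * K * (χ * P ^ 2) +
      28 * β * (ψ * (e + P ^ 2)) + (ψ * A * P + (3 * ψ + 2 * s * D) / 2 * P ^ 2) := by
  have h6 : 0 ≤ p ^ 6 := by positivity
  have hX2 : X ^ 2 ≤ 2 * e := by nlinarith [sq_nonneg q]
  have he0 : 0 ≤ e := by nlinarith [sq_nonneg X]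
  have i1 : p ^ 6 / 6 + X ^ 2 / 2 - (B + P) ^ 2 / 2 ≤ e - (B + P) * q := by
    nlinarith [sq_nonneg (B + P - q)]
  have i2 : (B + P) ^ 2 ≤ (A + P) ^ 2 + 56 * β * (e + P ^ 2) := by
    have h1 : (B - A) * (A + B + 2 * P) ≤ 4 * β * X * (6 * X + 2 * |P|) := by
      refine (le_abs_self _).trans ?_
      rw [abs_mul]
      refine mul_le_mul hBA ?_ (abs_nonneg _) (by positivity)
      calc |A + B + 2 * P| ≤ |A| + |B| + |2 * P| := abs_add_three _ _ _
        _ ≤ 6 * X + 2 * |P| := by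
          rw [abs_mul, abs_two]
          linarith
    have h2 : X * (6 * X + 2 * |P|) ≤ 14 * (e + P ^ 2) := by
      nlinarith [sq_abs P, sq_nonneg (X - |P|)]
    nlinarith [mul_le_mul_of_nonneg_left h2 hβ]
  have i3 : 0 ≤ ψ * (X ^ 2 - A ^ 2) / 2 + δ * e + 2 * (χ * e) := by
    have h1 : ψ * ((1 - s) * X ^ 2) ≤ ψ * (X ^ 2 - A ^ 2) :=
      mul_le_mul_of_nonneg_left (by linarith) hψ0
    have hψX : ψ * X ^ 2 ≤ 2 * e := by nlinarith [sq_nonneg X]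
    have hψX0 : 0 ≤ ψ * X ^ 2 := by positivity
    rcases hs with hs | ⟨hs, rfl⟩
    · nlinarith [mul_le_mul_of_nonneg_right hs hψX0, mul_le_mul_of_nonneg_left hψX hδ,
        mul_nonneg hχ he0]
    · nlinarith [mul_le_mul_of_nonneg_right hs hψX0, mul_nonneg hδ he0]
  have i4 : -(s * D * P ^ 2) ≤ 3 * K * (χ * P ^ 2) := by
    nlinarith [mul_le_mul_of_nonneg_right hD (sq_nonneg P)]
  have i5 := mul_le_mul_of_nonneg_left i1 hψ0
  have i6 := mul_le_mul_of_nonneg_left i2 hψ0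
  nlinarith

/-- The functional divided by -τ has density ψ(e - (B + P)q). The last group of terms integrates to
0 by `hasInt_scaling_parts`; the other errors are δ times the energy, ring terms, and O(τ). -/
theorem virial_density_le {K c d : ℝ} (hcd : c < d) (hd1 : 1 ≤ d) (hd : d ≤ 2)
    (hK : ∀ s, -deriv (step 2 3) s ≤ K * ringWeight c d s) (hK0 : 0 ≤ K)
    (hr : r * ‖w‖ ≤ 1) (ht : t < t₀) (htr : 2 * (t₀ - t) ≤ r) (z : H10 Ω × L2 Ω) (x : E3) :
    step 2 3 (sim t₀ x₀ t x) * (toL2 z.1 x ^ 6 / 6) ≤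
      (-1 / (t₀ - t)) * (scalingMultiplier t₀ x₀ w (step 2 3)).density t z x +
      (d - 1) * edens z x +
      (2 + 3 * K) * (ringWeight c d (sim t₀ x₀ t x) * (edens z x +
        toL2 z.1 x ^ 2 / (t₀ - t) ^ 2)) +
      28 * (‖w‖ * (t₀ - t)) * (step 2 3 (sim t₀ x₀ t x) * edens z x +
        step 2 3 (sim t₀ x₀ t x) * (toL2 z.1 x ^ 2 / (t₀ - t) ^ 2)) +
      1 / (t₀ - t) ^ 2 * (step 2 3 (sim t₀ x₀ t x) * inner ℝ (x - x₀) (gradH z.1 x) * toL2 z.1 x +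
        (3 * step 2 3 (sim t₀ x₀ t x) + 2 * sim t₀ x₀ t x * deriv (step 2 3) (sim t₀ x₀ t x)) / 2 *
          toL2 z.1 x ^ 2) := by
  have hτ : 0 < t₀ - t := by linarith
  have he := edens_nonneg z x
  have hχ := ringWeight_nonneg hcd (by linarith) (sim t₀ x₀ t x)
  have hP2 : 0 ≤ toL2 z.1 x ^ 2 / (t₀ - t) ^ 2 := by positivity
  rcases le_or_gt (sim t₀ x₀ t x) 3 with hs | hs
  · have hs0 := sim_nonneg t₀ x₀ t x
    have hz := norm_le_of_sim_le ht (show sim t₀ x₀ t x ≤ 4 by linarith)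
    have hY := norm_inward_le_of_sim_le hr ht htr hs
    have hD : -(sim t₀ x₀ t x * deriv (step 2 3) (sim t₀ x₀ t x)) ≤
        3 * (K * ringWeight c d (sim t₀ x₀ t x)) := by
      have h0 : 0 ≤ K * ringWeight c d (sim t₀ x₀ t x) := mul_nonneg hK0 hχ
      nlinarith [mul_le_mul_of_nonneg_left (hK (sim t₀ x₀ t x)) hs0]
    have hA2 : (inner ℝ (x - x₀) (gradH z.1 x) / (t₀ - t)) ^ 2 ≤
        sim t₀ x₀ t x * ‖gradH z.1 x‖ ^ 2 := by
      rw [div_pow, div_le_iff₀ (by positivity)]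
      calc inner ℝ (x - x₀) (gradH z.1 x) ^ 2 ≤ (‖x - x₀‖ * ‖gradH z.1 x‖) ^ 2 :=
            sq_le_sq' (neg_le_of_abs_le (abs_real_inner_le_norm _ _)) (real_inner_le_norm _ _)
        _ = _ := by rw [mul_pow, sq_norm_eq (x₀ := x₀) ht x]; ring
    have hBA : |inner ℝ (inward x₀ w x) (gradH z.1 x) / (t₀ - t) -
        inner ℝ (x - x₀) (gradH z.1 x) / (t₀ - t)| ≤ 4 * (‖w‖ * (t₀ - t)) * ‖gradH z.1 x‖ := by
      rw [← sub_div, ← inner_sub_left]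
      refine abs_inner_div_le hτ ?_
      have e : inward x₀ w x - (x - x₀) = -(‖x - x₀‖ ^ 2 • w) := by
        unfold inward
        abel
      rw [e, norm_neg, norm_smul, norm_pow, norm_norm]
      calc ‖x - x₀‖ ^ 2 * ‖w‖ ≤ (2 * (t₀ - t)) ^ 2 * ‖w‖ := by gcongr
        _ = _ := by ring
    have hcase : sim t₀ x₀ t x ≤ 1 + (d - 1) ∨
        sim t₀ x₀ t x ≤ 3 ∧ ringWeight c d (sim t₀ x₀ t x) = 1 := by
      rcases le_total (sim t₀ x₀ t x) d with h | h
      · exact Or.inl (by linarith)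
      · exact Or.inr ⟨hs, ringWeight_eq_one hcd ⟨h, hs⟩⟩
    have key := virial_terms_le (P := toL2 z.1 x / (t₀ - t)) (p := toL2 z.1 x) (q := z.2 x)
      (step_nonneg 2 3 (sim t₀ x₀ t x)) (step_le_one 2 3 _) hD
      (e := edens z x) (by unfold edens; ring) (by linarith : 0 ≤ d - 1) hχ hcase
      (by positivity : 0 ≤ ‖w‖ * (t₀ - t)) (norm_nonneg _) hA2
      (abs_inner_div_le (ξ := gradH z.1 x) hτ hz) (abs_inner_div_le (ξ := gradH z.1 x) hτ hY) hBA
    have hχP := mul_nonneg hχ hP2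
    have hχe := mul_nonneg (mul_nonneg hK0 hχ) he
    rw [div_pow] at key
    refine key.trans ?_
    have e1 : (-1 / (t₀ - t)) * (scalingMultiplier t₀ x₀ w (step 2 3)).density t z x =
        step 2 3 (sim t₀ x₀ t x) * (edens z x - (inner ℝ (inward x₀ w x) (gradH z.1 x) / (t₀ - t) +
          toL2 z.1 x / (t₀ - t)) * z.2 x) := by
      simp only [Multiplier.density, scalingMultiplier, inner_smul_left, conj_trivial]
      field_simp
      ring
    rw [e1]
    have e2 : ∀ a b : ℝ, a * (inner ℝ (x - x₀) (gradH z.1 x) / (t₀ - t)) * (toL2 z.1 x / (t₀ - t)) +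
        b * (toL2 z.1 x ^ 2 / (t₀ - t) ^ 2) = 1 / (t₀ - t) ^ 2 *
          (a * inner ℝ (x - x₀) (gradH z.1 x) * toL2 z.1 x + b * toL2 z.1 x ^ 2) := by
      intro a b
      field_simp
    rw [e2]
    nlinarith
  · have hd0 : (scalingMultiplier t₀ x₀ w (step 2 3)).density t z x = 0 := by
      simp [Multiplier.density, scalingMultiplier, step_two_three_eq_zero hs.le]
    rw [hd0, step_two_three_eq_zero hs.le, deriv_step_two_three_eq_zero hs]
    have h1 := mul_nonneg (by linarith : 0 ≤ d - 1) he
    have h2 := mul_nonneg (by linarith : 0 ≤ 2 + 3 * K) (mul_nonneg hχ (add_nonneg he hP2))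
    linarith

/-- All coefficients of the multiplier are O(τ) relative to the energy and scaled mass, so the
functional is at least -O(τ); this supplies the terminal value at t₀. -/
theorem neg_scaling_density_le (hr : r * ‖w‖ ≤ 1) (ht : t < t₀) (htr : 2 * (t₀ - t) ≤ r)
    (z : H10 Ω × L2 Ω) (x : E3) :
    -(scalingMultiplier t₀ x₀ w (step 2 3)).density t z x ≤ (t₀ - t) *
      (6 * (step 2 3 (sim t₀ x₀ t x) * edens z x) +
        step 2 3 (sim t₀ x₀ t x) * (toL2 z.1 x ^ 2 / (t₀ - t) ^ 2)) := by
  have hτ : 0 < t₀ - t := by linarith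
  rcases le_or_gt (sim t₀ x₀ t x) 3 with hs | hs
  · have hY := norm_inward_le_of_sim_le hr ht htr hs
    have hB := abs_inner_div_le (ξ := gradH z.1 x) hτ hY
    obtain ⟨hX, -⟩ := edens_bounds z x
    have e1 : -(scalingMultiplier t₀ x₀ w (step 2 3)).density t z x = (t₀ - t) *
        (step 2 3 (sim t₀ x₀ t x) * (edens z x - (inner ℝ (inward x₀ w x) (gradH z.1 x) / (t₀ - t) +
          toL2 z.1 x / (t₀ - t)) * z.2 x)) := by
      simp only [Multiplier.density, scalingMultiplier, inner_smul_left, conj_trivial]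
      field_simp
      ring
    rw [e1, ← div_pow]
    refine mul_le_mul_of_nonneg_left ?_ hτ.le
    have key : edens z x - (inner ℝ (inward x₀ w x) (gradH z.1 x) / (t₀ - t) +
        toL2 z.1 x / (t₀ - t)) * z.2 x ≤ 6 * edens z x + (toL2 z.1 x / (t₀ - t)) ^ 2 := by
      generalize inner ℝ (inward x₀ w x) (gradH z.1 x) / (t₀ - t) = B at hB
      generalize toL2 z.1 x / (t₀ - t) = P
      have h1 : -(B * z.2 x) ≤ 4 * ‖gradH z.1 x‖ * |z.2 x| := by
        refine (neg_le_abs _).trans ?_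
        rw [abs_mul]
        gcongr
      have h2 := sq_abs (z.2 x)
      nlinarith [sq_nonneg (‖gradH z.1 x‖ - |z.2 x|), sq_nonneg (P + z.2 x),
        sq_nonneg ‖gradH z.1 x‖, sq_nonneg P]
    have := mul_le_mul_of_nonneg_left key (step_nonneg 2 3 (sim t₀ x₀ t x))
    linarith
  · have hd0 : (scalingMultiplier t₀ x₀ w (step 2 3)).density t z x = 0 := by
      simp [Multiplier.density, scalingMultiplier, step_two_three_eq_zero hs.le]
    rw [hd0, step_two_three_eq_zero hs.le]
    simp

theorem eventually_cut_sixth_le (hΩ : IsSmoothBoundedDomain Ω) (ht₀ : 0 < t₀) (hx₀ : x₀ ∈ closure Ω)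
    (hX : MemX Ω t₀ u ut) (heq : SatisfiesNLW Ω t₀ u) {η : ℝ} (hη : 0 < η) :
    ∀ᶠ t in 𝓝[<] t₀, ∫ x in Ω, step 2 3 (sim t₀ x₀ t x) * (toL2 (u t) x ^ 6 / 6) ≤ η := by
  obtain ⟨w, r, hr0, hr, hpush⟩ := exists_inward hΩ hx₀
  obtain ⟨E, hE0, hE⟩ := exists_energy_bound hΩ ht₀ hX heq
  obtain ⟨K, hK0, hK⟩ := exists_deriv_step_bound
  -- The only error that does not vanish as t → t₀ is δ times the total energy; this choice makes it
  -- at most η/4.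
  set δ := min 1 (η / (4 * (E + 1))) with hδ
  have hδ0 : 0 < δ := lt_min one_pos (by positivity)
  have hδ1 : δ ≤ 1 := min_le_left _ _
  have hδE : δ * E ≤ η / 4 := by
    calc δ * E ≤ η / (4 * (E + 1)) * (E + 1) := by
          gcongr
          · exact min_le_right _ _
          · linarith
      _ = η / 4 := by field_simp
  have hc : 1 < 1 + δ / 2 := by linarith
  have hcd : 1 + δ / 2 < 1 + δ := by linarith
  have hK := hK _ _ hcd (by linarith)
  have hρ := tendsto_ringTotal (x₀ := x₀) hΩ ht₀ hX heq hc hcd (by linarith)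
  set V := volume.real (Metric.ball (0 : E3) 1) with hV
  have hV0 : 0 ≤ V := measureReal_nonneg
  -- This bounds 6e + p, where the cut-off energy satisfies e ≤ E and `mass_le` with κ = 1 gives p ≤
  -- 6E + 8V.
  set C := 12 * E + 8 * V with hC
  have hm := isMultiplier_scaling (Ω := Ω) (t₀ := t₀) isProfile_step_two_three
    (fun s hs => step_two_three_eq_zero hs) hpush
  have hwin : ∀ᶠ t in 𝓝[<] t₀, t ∈ Ioo (max 0 (t₀ - r / 2)) t₀ :=
    Ioo_mem_nhdsLT (max_lt ht₀ (by linarith))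
  have hτlim : Tendsto (fun t => t₀ - t) (𝓝[<] t₀) (𝓝 0) := by
    have : Tendsto (fun t => t₀ - t) (𝓝 t₀) (𝓝 (t₀ - t₀)) :=
      (continuous_const.sub continuous_id).tendsto t₀
    rw [sub_self] at this
    exact this.mono_left nhdsWithin_le_nhds
  have hcut : ∀ t ∈ Ioo (max 0 (t₀ - r / 2)) t₀, ∫ x in Ω, edens (u t, ut t) x ≤ E →
      ∃ e p, e ≤ E ∧ p ≤ 6 * E + 8 * V ∧
      HasInt Ω (fun x => step 2 3 (sim t₀ x₀ t x) * edens (u t, ut t) x) e ∧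
      HasInt Ω (fun x => step 2 3 (sim t₀ x₀ t x) * (toL2 (u t) x ^ 2 / (t₀ - t) ^ 2)) p := by
    intro t ht hEt
    have ht' : t ∈ Ioo 0 t₀ := ⟨(le_max_left _ _).trans_lt ht.1, ht.2⟩
    have h1 := cone_hasInt (u := u) (ut := ut) (x₀ := x₀) hΩ isProfile_step_two_three ht'
    have h2 : _ ≤ ∫ x in Ω, edens (u t, ut t) x :=
      h1.le ⟨integrableOn_edens hΩ.isBounded hΩ.isOpen (u t, ut t), rfl⟩ fun x =>
        mul_le_of_le_one_left (edens_nonneg _ _) (step_le_one _ _ _)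
    refine ⟨_, _, h2.trans hEt, ?_, h1, hasInt_mass hΩ (contDiff_step 2 3).continuous⟩
    refine (mass_le hΩ (contDiff_step 2 3).continuous (step_nonneg 2 3) (step_le_one 2 3)
      (fun s hs => step_two_three_eq_zero (by linarith)) ht.2 one_pos h1).trans ?_
    have := h2.trans hEt
    norm_num
    linarith
  have htwo : ∀ t ∈ Ioo (max 0 (t₀ - r / 2)) t₀, 2 * (t₀ - t) ≤ r := fun t ht => by
    have := (le_max_right 0 (t₀ - r / 2)).trans_lt ht.1
    linarith
  have hlow : ∀ᶠ t in 𝓝[<] t₀, -(scalingMultiplier t₀ x₀ w (step 2 3)).total Ω t (u t, ut t) ≤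
      (t₀ - t) * C := by
    filter_upwards [hwin, hE] with t ht hEt
    have hτ : 0 < t₀ - t := by linarith [ht.2]
    obtain ⟨e, p, he, hp, h1, h2⟩ := hcut t ht hEt
    have h3 := (hm.hasInt_total hΩ.isBounded hΩ.isOpen ht (u t, ut t)).const_mul (-1)
    have h4 := h3.le (((h1.const_mul 6).add h2).const_mul (t₀ - t)) fun x => by
      have := neg_scaling_density_le hr ht.2 (htwo t ht) (x₀ := x₀) (u t, ut t) x
      linarith
    have h5 : (t₀ - t) * (6 * e + p) ≤ (t₀ - t) * C := by
      gcongr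
      linarith
    linarith
  have hrate : ∀ᶠ t in 𝓝[<] t₀,
      (scalingMultiplier t₀ x₀ w (step 2 3)).totalRate Ω t (u t, ut t) ≤ η / 4 := by
    have h0 : Tendsto (fun t => 12 * (t₀ - t) * ‖w‖ * E + 92 * K * ringTotal Ω t₀ x₀ (1 + δ / 2)
        (1 + δ) u ut t) (𝓝[<] t₀) (𝓝 0) := by
      have := (((hτlim.const_mul 12).mul_const ‖w‖).mul_const E).add (hρ.const_mul (92 * K))
      simpa using this
    filter_upwards [hwin, hE, h0.eventually_lt_const (by positivity : 0 < η / 4)] with t ht hEt h1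
    have ht' : t ∈ Ioo 0 t₀ := ⟨(le_max_left _ _).trans_lt ht.1, ht.2⟩
    have hτ : 0 < t₀ - t := by linarith [ht.2]
    have hEd : HasInt Ω (edens (u t, ut t)) _ :=
      ⟨integrableOn_edens hΩ.isBounded hΩ.isOpen (u t, ut t), rfl⟩
    have h2 := (hm.hasInt_totalRate hΩ.isBounded hΩ.isOpen ht (u t, ut t)).le
      ((hEd.const_mul (12 * (t₀ - t) * ‖w‖)).add ((hasInt_ringTotal hΩ hc hcd ht').const_mul
        (92 * K))) fun x => scaling_rateDensity_le hK hr ht.2 (htwo t ht) (u t, ut t) x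
    have h3 : 12 * (t₀ - t) * ‖w‖ * (∫ x in Ω, edens (u t, ut t) x) ≤
        12 * (t₀ - t) * ‖w‖ * E := by gcongr
    linarith
  obtain ⟨a, ha, hmem⟩ := (mem_nhdsLT_iff_exists_Ioo_subset).1
    (hrate.and (hlow.and hwin))
  -- The rate bound is integrated from S to T < t₀; as T → t₀ the terminal value contributes at most
  -- (t₀ - T)C → 0. The resulting bound is proportional to t₀ - S, so it survives division by τ.
  have hup : ∀ S ∈ Ioo a t₀, -(scalingMultiplier t₀ x₀ w (step 2 3)).total Ω S (u S, ut S) ≤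
      (t₀ - S) * (η / 4) := by
    intro S hS
    have hlim := (hτlim.mul_const C).const_add ((t₀ - S) * (η / 4))
    rw [zero_mul, add_zero] at hlim
    refine ge_of_tendsto hlim ?_
    filter_upwards [Ioo_mem_nhdsLT hS.2] with T hT
    have hJ : ∀ s ∈ Icc S T, s ∈ Ioo a t₀ := fun s hs => ⟨hS.1.trans_le hs.1, hs.2.trans_lt hT.2⟩
    have hS0 : 0 < S := (le_max_left _ _).trans_lt (hmem hS).2.2.1
    obtain ⟨hi, hle⟩ := hm.total_sub_le hΩ.isBounded hΩ.isOpen isOpen_Ioo hX heq hS0 hT.2 hT.1.le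
      fun s hs => (hmem (hJ s hs)).2.2
    have h1 : ∫ t in Icc S T, (scalingMultiplier t₀ x₀ w (step 2 3)).totalRate Ω t (u t, ut t) ≤
        (T - S) * (η / 4) := by
      calc _ ≤ ∫ _ in Icc S T, η / 4 := setIntegral_mono_on hi (integrable_const _)
            measurableSet_Icc fun t ht => (hmem (hJ t ht)).1
        _ = (T - S) * (η / 4) := by
            rw [setIntegral_const, Real.volume_real_Icc_of_le hT.1.le, smul_eq_mul]
    have h2 := (hmem (hJ T (right_mem_Icc.2 hT.1.le))).2.1
    have h3 : (T - S) * (η / 4) ≤ (t₀ - S) * (η / 4) := by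
      gcongr
      exact hT.2.le
    linarith
  have hsmall : Tendsto (fun t => (2 + 3 * K) * ringTotal Ω t₀ x₀ (1 + δ / 2) (1 + δ) u ut t +
      28 * (‖w‖ * (t₀ - t)) * (7 * E + 8 * V)) (𝓝[<] t₀) (𝓝 0) := by
    have := (hρ.const_mul (2 + 3 * K)).add (((hτlim.const_mul ‖w‖).const_mul 28).mul_const
      (7 * E + 8 * V))
    simpa using this
  filter_upwards [hE, hsmall.eventually_lt_const (by positivity : 0 < η / 4), Ioo_mem_nhdsLT ha]
    with t hEt h1 hta
  have ht := (hmem hta).2.2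
  have ht' : t ∈ Ioo 0 t₀ := ⟨(le_max_left _ _).trans_lt ht.1, ht.2⟩
  have hτ : 0 < t₀ - t := by linarith [ht.2]
  obtain ⟨e, p, he, hp, k1, k2⟩ := hcut t ht hEt
  have hEd : HasInt Ω (edens (u t, ut t)) _ :=
    ⟨integrableOn_edens hΩ.isBounded hΩ.isOpen (u t, ut t), rfl⟩
  have k3 := (hm.hasInt_total hΩ.isBounded hΩ.isOpen ht (u t, ut t)).const_mul (-1 / (t₀ - t))
  have k4 := (hasInt_scaling_parts (x₀ := x₀) hΩ (contDiff_step 2 3) ht.2 (u t)).const_mul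
    (1 / (t₀ - t) ^ 2)
  have kr := hasInt_ringTotal (x₀ := x₀) (u := u) (ut := ut) hΩ hc hcd ht'
  have k5 := (((k3.add (hEd.const_mul (1 + δ - 1))).add (kr.const_mul (2 + 3 * K))).add ((k1.add k2).const_mul (28 * (‖w‖ * (t₀ - t))))).add k4
  have k6 : HasInt Ω (fun x => step 2 3 (sim t₀ x₀ t x) * (toL2 (u t) x ^ 6 / 6)) _ :=
    hasInt_pot hΩ.isBounded hΩ.isOpen (((contDiff_step 2 3).comp
      (contDiff_sim t₀ x₀ t)).continuous) (u t)
  have k7 := k6.le k5 fun x => virial_density_le hcd (by linarith) (by linarith) hK hK0 hr ht.2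
    (htwo t ht) (u t, ut t) x
  rw [k6.2]
  refine k7.trans ?_
  have h2 : -1 / (t₀ - t) * (scalingMultiplier t₀ x₀ w (step 2 3)).total Ω t (u t, ut t) ≤
      η / 4 := by
    have h3 := hup t hta
    rw [div_mul_eq_mul_div, div_le_iff₀ hτ]
    linarith
  have h4 : (1 + δ - 1) * (∫ x in Ω, edens (u t, ut t) x) ≤ η / 4 := by
    rw [add_sub_cancel_left]
    exact (mul_le_mul_of_nonneg_left hEt hδ0.le).trans hδE
  have h5 : 28 * (‖w‖ * (t₀ - t)) * (e + p) ≤ 28 * (‖w‖ * (t₀ - t)) * (7 * E + 8 * V) :=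
    mul_le_mul_of_nonneg_left (by linarith) (by positivity)
  rw [mul_zero, add_zero]
  linarith

/-- Inside the light cone s < 1, where the cut-off equals 1; the integrand is nonnegative elsewhere.
-/
theorem integral_cone_sixth_le (hΩ : IsSmoothBoundedDomain Ω) (ht : t < t₀) (v : H10 Ω) :
    ∫ x in Ω ∩ {x | ‖x - x₀‖ < t₀ - t}, toL2 v x ^ 6 ≤
      6 * ∫ x in Ω, step 2 3 (sim t₀ x₀ t x) * (toL2 v x ^ 6 / 6) := by
  have hτ : 0 < t₀ - t := by linarith
  have hS : MeasurableSet {x : E3 | ‖x - x₀‖ < t₀ - t} :=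
    (isOpen_lt (by fun_prop) continuous_const).measurableSet
  have k6 : HasInt Ω (fun x => step 2 3 (sim t₀ x₀ t x) * (toL2 v x ^ 6 / 6)) _ :=
    hasInt_pot hΩ.isBounded hΩ.isOpen (((contDiff_step 2 3).comp
      (contDiff_sim t₀ x₀ t)).continuous) v
  have h := (k6.const_mul 6)
  rw [← integral_const_mul]
  refine le_trans (le_of_eq ?_) (setIntegral_mono_set h.1 (Eventually.of_forall fun x => ?_)
    (LE.le.eventuallyLE (inter_subset_left (t := {x | ‖x - x₀‖ < t₀ - t}))))
  · refine setIntegral_congr_fun (hΩ.isOpen.measurableSet.inter hS) fun x hx => ?_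
    have hx2 : ‖x - x₀‖ < t₀ - t := hx.2
    have hs : sim t₀ x₀ t x ≤ 2 := by
      unfold sim
      rw [div_le_iff₀ (by positivity)]
      nlinarith [norm_nonneg (x - x₀)]
    rw [step_eq_one (by norm_num) hs]
    ring
  · have := step_nonneg 2 3 (sim t₀ x₀ t x)
    simp only [Pi.zero_apply]
    positivity

end

end NLW

end

theorem mainTheorem5 (Ω : Set NLW.E3) (hΩ : NLW.IsSmoothBoundedDomain Ω) (t₀ : ℝ) (ht₀ : 0 < t₀)
    (u₀ : NLW.H10 Ω) (u₁ : NLW.L2 Ω) (u : ℝ → NLW.H10 Ω) (ut : ℝ → NLW.L2 Ω)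
    (hu : NLW.IsSolution Ω t₀ u₀ u₁ u ut) (x₀ : NLW.E3) (hx₀ : x₀ ∈ closure Ω) :
    (∀ t ∈ Ico 0 t₀,
      IntegrableOn (fun x => NLW.toL2 (u t) x ^ 6) (Ω ∩ {x | ‖x - x₀‖ < t₀ - t}) volume) ∧
    Tendsto (fun t => ∫ x in Ω ∩ {x | ‖x - x₀‖ < t₀ - t}, NLW.toL2 (u t) x ^ 6)
      (𝓝[<] t₀) (𝓝 0) := by
  have hX := hu.memX
  have hsix : ∀ t, IntegrableOn (fun x => NLW.toL2 (u t) x ^ 6)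
      (Ω ∩ {x | ‖x - x₀‖ < t₀ - t}) volume := fun t => by
    obtain ⟨C, -, hC⟩ := NLW.exists_sixth_bound Ω
    exact (hC (u t)).1.mono_set inter_subset_left
  refine ⟨fun t _ => hsix t, ?_⟩
  refine tendsto_order.2 ⟨fun a ha => ?_, fun a ha => ?_⟩
  · exact Eventually.of_forall fun t => ha.trans_le (integral_nonneg fun x => by positivity)
  -- With η = a/7 the factor 6 lost in passing from u⁶/6 to u⁶ leaves 6a/7 < a.
  · filter_upwards [NLW.eventually_cut_sixth_le hΩ ht₀ hx₀ hX hu.equation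
      (by positivity : 0 < a / 7), self_mem_nhdsWithin] with t ht htt
    have := NLW.integral_cone_sixth_le (x₀ := x₀) hΩ (mem_Iio.1 htt) (u t)
    linarith
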